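/- Let $1\le n\le N$ and $m_1,\dots,m_N\ge 1$ be integers, $r_1,\dots,r_N>0$, $s_1,\dots,s_n>0$. Let $D=D_{m_1}\times\dots\times D_{m_N}$, where $D_m=\{(q_1,\dots,q_m):q_i>0,\ \sum_i q_i<1\}$. For $p=(p_\nu)_{\nu=1}^N\in D$ with $p_\nu=(p_{i,\nu})_{i=1}^{m_\nu}$ write $p_{\cdot,\nu}=\sum_{i=1}^{m_\nu}p_{i,\nu}$ and $p_{0,\nu}=1-p_{\cdot,\nu}$. The negative multinomial distribution $\mathrm{NM}(t,p_\nu)$, $t>0$, is the distribution on $\mathbb N_0^{m_\nu}$ with mass function $$\frac{\Gamma(t+\sum_{i}x_i)}{\Gamma(t)\prod_{i}x_i!}\,p_{0,\nu}^{t}\prod_{i=1}^{m_\nu}p_{i,\nu}^{x_i}.$$ Fix $p\in D$, and let $X_\nu\sim\mathrm{NM}(r_\nu,p_\nu)$ $(\nu=1,\dots,N)$ and $Y_\nu\sim\mathrm{NM}(s_\nu,p_\nu)$ $(\nu=1,\dots,n)$ be independent; put $X=(X_\nu)_{\nu\le N}$, $Y=(Y_\nu)_{\nu\le n}$ and let $g(y\mid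 p)$ be the joint mass function of $Y$. For a (possibly improper) prior density $\pi$ on $D$, the Bayesian predictive mass is the posterior mean $\hat g^{(\pi)}(y;X)=E_\pi[g(y\mid p)\mid X]$, and its risk is $R(p,\hat g^{(\pi)})=E[\log\{g(Y\mid p)/\hat g^{(\pi)}(Y;X)\}]$. Let $a_{0,\nu}\in\mathbb R$ and $a_{i,\nu}>0$, with $r_\nu+a_{0,\nu}>0$ for all $\nu=1,\dots,N$. Let $M$ be a measure on $(0,\infty)$ and let $\tilde\gamma=(\tilde\gamma_\nu)_{\nu=1}^N:(0,\infty)\to(0,\infty)^N$ be measurable. Consider the prior densities $$\pi_{a_0,a}(p)\propto\prod_{\nu=1}^N\Big(p_{0,\nu}^{a_{0,\nu}-1}\prod_{i=1}^{m_\nu}p_{i,\nu}^{a_{i,\nu}-1}\Big),\qquad \pi_{M,\tilde\gamma,a_0,a}(p)=\int_{(0,\infty)}\prod_{\nu=1}^N\Big(p_{0,\nu}^{\tilde\gamma_\nu(u)+a_{0,\nu}-1}\prod_{i=1}^{m_\nu}p_{i,\nu}^{a_{i,\nu}-1}\Big)\,dM(u),$$ and assume that the posterior under $\pi_{M,\tilde\gamma,a_0,a}$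 given $X=x$ is proper for every $x$ (that is, its normalizing constant is positive and finite). Let $t_1,\dots,t_N:[0,1]\to(0,\infty)$ be smooth and nondecreasing with $t_\nu(0)=r_\nu$ for all $\nu$, $t_\nu(1)=r_\nu+s_\nu$ for $\nu\le n$ and $t_\nu(1)=r_\nu$ for $\nu>n$. For $\tau\in[0,1]$ let $Z(\tau)=(Z_\nu(\tau))_{\nu=1}^N$ have independent components $Z_\nu(\tau)\sim\mathrm{NM}(t_\nu(\tau),p_\nu)$, and let $E_\pi[\,\cdot\mid Z(\tau)]$ denote posterior expectation under the prior $\pi$ given the observation $Z(\tau)$. Let $L^{\mathrm{KL}}(d,\theta)=d-\theta-\theta\log(d/\theta)$ for $d,\theta>0$. Then $$R(p,\hat g^{(\pi_{M,\tilde\gamma,a_0,a})})-R(p,\hat g^{(\pi_{a_0,a})})=\int_0^1\Big\{\sum_{\nu=1}^n t_\nu'(\tau)\sum_{k=1}^\infty\frac1k\,E\Big[L^{\mathrm{KL}}\big(E_{\pi_{M,\tilde\gamma,a_0,a}}[p_{\cdot,\nu}^k\mid Z(\tau)],\,p_{\cdot,\nu}^k\big)-L^{\mathrm{KL}}\big(E_{\pi_{a_0,a}}[p_{\cdot,\nu}^k\mid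 Z(\tau)],\,p_{\cdot,\nu}^k\big)\Big]\Big\}\,d\tau,$$ where both risks and all the expected losses are finite, the series over $k$ converges absolutely for every $\tau\in[0,1]$ and $\nu\le n$, and the integrand is integrable over $[0,1]$. -/

import Mathlib

open MeasureTheory Set
open scoped ENNReal

noncomputable section

namespace NegMult

/-- Families of count vectors `x = (x_ν)_ν` with `x_ν = (x_{i,ν})_{1 ≤ i ≤ m_ν} ∈ ℕ₀^{m_ν}`. -/
abbrev Counts {ι : Type} (m : ι → ℕ) : Type := (ν : ι) → Fin (m ν) → ℕ

/-- Families of real vectors `p = (p_ν)_ν` with `p_ν = (p_{i,ν})_{1 ≤ i ≤ m_ν} ∈ ℝ^{m_ν}`. -/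
abbrev Params {ι : Type} (m : ι → ℕ) : Type := (ν : ι) → Fin (m ν) → ℝ

/-- The parameter space `D = ∏_ν D_{m_ν}`, where `D_k` is the set of vectors in `ℝ^k` with
positive coordinates whose sum is less than one. -/
def paramSpace {ι : Type} (m : ι → ℕ) : Set (Params m) :=
  {p | ∀ ν, (∀ i, 0 < p ν i) ∧ ∑ i, p ν i < 1}

/-- The negative multinomial mass function
`Γ(r + ∑ x_i) / (Γ(r) ∏ x_i!) * p_0 ^ r * ∏ p_i ^ x_i`, with `p_0 = 1 - ∑ p_i`. -/
def nmMass {k : ℕ} (r : ℝ) (p : Fin k → ℝ) (x : Fin k → ℕ) : ℝ :=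
  Real.Gamma (r + ∑ i, (x i : ℝ)) / (Real.Gamma r * ∏ i, ((x i).factorial : ℝ))
    * (1 - ∑ i, p i) ^ r * ∏ i, p i ^ x i

/-- The joint mass function of independent negative multinomial vectors. -/
def jointMass {ι : Type} [Fintype ι] {m : ι → ℕ} (t : ι → ℝ) (p : Params m) (x : Counts m) : ℝ :=
  ∏ ν, nmMass (t ν) (p ν) (x ν)

/-- The joint law of independent negative multinomial vectors. -/
def jointLaw {ι : Type} [Fintype ι] {m : ι → ℕ} (t : ι → ℝ) (p : Params m) : Measure (Counts m) :=
  Measure.sum fun x => ENNReal.ofReal (jointMass t p x) • Measure.dirac x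

/-- The (unnormalised, possibly improper) Dirichlet prior density
`∏_ν (p_{0,ν} ^ (a_{0,ν} - 1) ∏_i p_{i,ν} ^ (a_{i,ν} - 1))`. -/
def dirichletPrior {ι : Type} [Fintype ι] {m : ι → ℕ} (a₀ : ι → ℝ) (a : Params m)
    (p : Params m) : ℝ≥0∞ :=
  ENNReal.ofReal (∏ ν, ((1 - ∑ i, p ν i) ^ (a₀ ν - 1) * ∏ i, p ν i ^ (a ν i - 1)))

/-- The (possibly improper) mixed shrinkage prior density
`∫ ∏_ν (p_{0,ν} ^ (γ_ν(u) + a_{0,ν} - 1) ∏_i p_{i,ν} ^ (a_{i,ν} - 1)) dM(u)`,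
the integral being over `(0, ∞)`. -/
def mixedPrior {ι : Type} [Fintype ι] {m : ι → ℕ} (M : Measure (Ioi (0 : ℝ)))
    (γ : Ioi (0 : ℝ) → ι → ℝ) (a₀ : ι → ℝ) (a : Params m) (p : Params m) : ℝ≥0∞ :=
  ∫⁻ u, ENNReal.ofReal
    (∏ ν, ((1 - ∑ i, p ν i) ^ (γ u ν + a₀ ν - 1) * ∏ i, p ν i ^ (a ν i - 1))) ∂M

/-- The marginal mass at `x` under the prior density `π`, when the observed vectors have size
parameters `t`. -/
def marginal {ι : Type} [Fintype ι] {m : ι → ℕ} (π : Params m → ℝ≥0∞) (t : ι → ℝ)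
    (x : Counts m) : ℝ≥0∞ :=
  ∫⁻ q in paramSpace m, π q * ENNReal.ofReal (jointMass t q x)

/-- The posterior is proper for every possible observation. -/
def ProperPosterior {ι : Type} [Fintype ι] {m : ι → ℕ} (π : Params m → ℝ≥0∞) (t : ι → ℝ) : Prop :=
  ∀ x : Counts m, marginal π t x ≠ 0 ∧ marginal π t x ≠ ⊤

/-- The posterior distribution of the parameter under the prior density `π`, given the observation
`x` of independent negative multinomial vectors with size parameters `t`. -/
def posterior {ι : Type} [Fintype ι] {m : ι → ℕ} (π : Params m → ℝ≥0∞) (t : ι → ℝ)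
    (x : Counts m) : Measure (Params m) :=
  (marginal π t x)⁻¹ •
    (volume.restrict (paramSpace m)).withDensity fun q => π q * ENNReal.ofReal (jointMass t q x)

/-- The posterior mean `E_π[p_{·,ν} ^ k | x]`, where `p_{·,ν} = ∑_i p_{i,ν}`. -/
def posteriorMeanPow {ι : Type} [Fintype ι] {m : ι → ℕ} (π : Params m → ℝ≥0∞) (t : ι → ℝ)
    (ν : ι) (k : ℕ) (x : Counts m) : ℝ :=
  ∫ q, (∑ i, q ν i) ^ k ∂(posterior π t x)

/-- The loss `L^KL(d, θ) = d - θ - θ log (d / θ)`. -/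
def klLoss (d θ : ℝ) : ℝ := d - θ - θ * Real.log (d / θ)

/-- The first `n` of the `N` vectors of a family. -/
def firstParams {N n : ℕ} {m : Fin N → ℕ} (h : n ≤ N) (p : Params m) :
    Params (fun ν : Fin n => m (Fin.castLE h ν)) :=
  fun ν => p (Fin.castLE h ν)

/-- The Bayesian predictive mass `ĝ^(π)(y; x) = E_π[g(y | p) | X = x]` of the future vectors
`Y_1, …, Y_n`, where `X` has size parameters `r` and `Y` has size parameters `s`. -/
def predictiveMass {N n : ℕ} {m : Fin N → ℕ} (h : n ≤ N) (π : Params m → ℝ≥0∞) (r : Fin N → ℝ)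
    (s : Fin n → ℝ) (y : Counts fun ν : Fin n => m (Fin.castLE h ν)) (x : Counts m) : ℝ :=
  ∫ q, jointMass s (firstParams h q) y ∂(posterior π r x)

/-- The log ratio `log (g(y | p) / ĝ^(π)(y; x))`, as a function of `(x, y)`. -/
def logRatio {N n : ℕ} {m : Fin N → ℕ} (h : n ≤ N) (π : Params m → ℝ≥0∞) (r : Fin N → ℝ)
    (s : Fin n → ℝ) (p : Params m)
    (xy : Counts m × Counts fun ν : Fin n => m (Fin.castLE h ν)) : ℝ :=
  Real.log (jointMass s (firstParams h p) xy.2 / predictiveMass h π r s xy.2 xy.1)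

/-- The joint law of the independent observations `X` and `Y`. -/
def sampleLaw {N n : ℕ} {m : Fin N → ℕ} (h : n ≤ N) (r : Fin N → ℝ) (s : Fin n → ℝ)
    (p : Params m) : Measure (Counts m × Counts fun ν : Fin n => m (Fin.castLE h ν)) :=
  (jointLaw r p).prod (jointLaw s (firstParams h p))

/-- The Kullback-Leibler risk `R(p, ĝ^(π)) = E[log (g(Y | p) / ĝ^(π)(Y; X))]`. -/
def risk {N n : ℕ} {m : Fin N → ℕ} (h : n ≤ N) (π : Params m → ℝ≥0∞) (r : Fin N → ℝ)
    (s : Fin n → ℝ) (p : Params m) : ℝ :=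
  ∫ xy, logRatio h π r s p xy ∂(sampleLaw h r s p)

/-- The expected loss difference
`E[L^KL(E_π₁[p_{·,ν}^k | Z], p_{·,ν}^k) - L^KL(E_π₂[p_{·,ν}^k | Z], p_{·,ν}^k)]`
for `Z` with size parameters `t` and true parameter `p`. -/
def expectedLossDiff {ι : Type} [Fintype ι] {m : ι → ℕ} (π₁ π₂ : Params m → ℝ≥0∞) (t : ι → ℝ)
    (p : Params m) (ν : ι) (k : ℕ) : ℝ :=
  ∫ z, (klLoss (posteriorMeanPow π₁ t ν k z) ((∑ i, p ν i) ^ k)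
    - klLoss (posteriorMeanPow π₂ t ν k z) ((∑ i, p ν i) ^ k)) ∂(jointLaw t p)

end NegMult

end

/-! Write σ_ν = p_{·,ν} and let Φ_t(y) be the integral of ∏ (1 - σ_ν)^{t_ν} σ_ν^{y_ν} against a
prior (`moment`). Under every prior considered, the direction p_ν / σ_ν is independent of the block
sums, and its Dirichlet law depends on a alone. Hence the integrated likelihood of counts z is Φ_t
at the block totals of z times a constant K(z) common to all these priors
(`exists_integral_likelihood_mul_pow`). So E[σ_ν^k | z] = Φ_t(y + k e_ν) / Φ_t(y), where y is the
vector of block totals. As X and Y share the parameter, they pool into one observation with sizes r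
+ s (`likelihood_mul_likelihood`). With G(t) = E log Φ_t under independent negative binomial totals
of sizes t, the risk difference is therefore G(t(0)) - G(t(1)) for the mixed prior minus the same
quantity for the Dirichlet prior (`risk_sub_risk`).

It remains to differentiate G along the path. The derivative of the negative binomial law in t_ν is
a compound Poisson generator, F ↦ ∑ θ_ν^k / k · (F(y + k e_ν) - F(y)) (`hasSum_nbMassDeriv_mul`).
The derivative of -log Φ_t in t_ν is the posterior mean of -log(1 - σ_ν), that is ∑ k⁻¹ Φ_t(y + k
e_ν) / Φ_t(y). Adding the two, -∂G/∂t_ν = ∑ k⁻¹ E[d_k - θ_ν^k log d_k] with d_k the posterior mean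
of σ_ν^k (`hasSum_lossTerm`); up to a term free of the prior the expectation is the expected loss
(`integrable_and_integral_klLoss`). The fundamental theorem of calculus (`integral_lossTerm`),
applied to both priors and subtracted, gives the identity.

The analysis rests on two bounds linear in y. First, |log Φ_t(y)| ≤ C(1 + |y|), because the σ_ν stay
away from 0 on a set of positive measure (`exists_abs_log_moment_le`). Second, the beta mean formula
bounds the posterior mean of 1 - σ_ν below by δ / (A_ν + y_ν + δ), where A_ν = ∑ a_{i,ν}; this
telescopes into a bound on ∑ k⁻¹ Φ_t(y + k e_ν) (`sum_range_moment_le`). Negative binomial tails are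
geometric, so linear and quadratic growth is summable, uniformly for r ≤ t ≤ T. `MomentData`
isolates what is used of the prior. -/

noncomputable section

namespace NegMult

open Filter Topology

/-! ### Beta and Liouville integrals -/

/-- The beta integral `∫ s ^ (b - 1) (1 - s) ^ (c - 1) ds` over `(0, 1)`. -/
theorem lintegral_beta {b c : ℝ} (hb : 0 < b) (hc : 0 < c) :
    ∫⁻ s in Ioo (0 : ℝ) 1, ENNReal.ofReal (s ^ (b - 1) * (1 - s) ^ (c - 1))
      = ENNReal.ofReal (ProbabilityTheory.beta b c) := by
  have h := ProbabilityTheory.lintegral_betaPDF_eq_one hb hc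
  rw [ProbabilityTheory.lintegral_betaPDF] at h
  have hB := ProbabilityTheory.beta_pos hb hc
  simp_rw [mul_assoc] at h
  simp_rw [ENNReal.ofReal_mul (one_div_pos.2 hB).le] at h
  rw [lintegral_const_mul' _ _ ENNReal.ofReal_ne_top] at h
  have h1 : ENNReal.ofReal (ProbabilityTheory.beta b c)
      * ENNReal.ofReal (1 / ProbabilityTheory.beta b c) = 1 := by
    rw [← ENNReal.ofReal_mul hB.le, mul_one_div_cancel hB.ne', ENNReal.ofReal_one]
  calc _ = ENNReal.ofReal (ProbabilityTheory.beta b c) *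
        (ENNReal.ofReal (1 / ProbabilityTheory.beta b c) * _) := by
          rw [← mul_assoc, h1, one_mul]
    _ = _ := by rw [h, mul_one]

/-- The factor c / (b + c) is the mean of 1 - s under the beta law; the lower bound on posterior
means of 1 - σ_ν comes from it. -/
theorem beta_add_one {b c : ℝ} (hb : 0 < b) (hc : 0 < c) :
    ProbabilityTheory.beta b (c + 1) = c / (b + c) * ProbabilityTheory.beta b c := by
  unfold ProbabilityTheory.beta
  rw [← add_assoc, Real.Gamma_add_one hc.ne', Real.Gamma_add_one (by positivity)]
  have := (Real.Gamma_pos_of_pos (add_pos hb hc)).ne'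
  field_simp

/-- Scaled beta integral. -/
theorem lintegral_beta_scaled {a b s : ℝ} (ha : 0 < a) (hb : 0 < b) (hs : 0 < s) :
    ∫⁻ x in Ioo (0 : ℝ) s, ENNReal.ofReal (x ^ (a - 1) * (s - x) ^ (b - 1))
      = ENNReal.ofReal (ProbabilityTheory.beta a b) * ENNReal.ofReal (s ^ (a + b - 1)) := by
  have himg : Ioo (0 : ℝ) s = (fun v => s * v) '' Ioo 0 1 := by
    rw [Set.image_mul_left_Ioo hs]; simp
  rw [himg, lintegral_image_eq_lintegral_abs_deriv_mul measurableSet_Ioo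
    (fun x _ => ((hasDerivAt_id' x).const_mul s).hasDerivWithinAt)
    (fun x _ y _ h => mul_left_cancel₀ hs.ne' h)]
  rw [← lintegral_beta ha hb, ← lintegral_mul_const' _ _ ENNReal.ofReal_ne_top]
  refine setLIntegral_congr_fun measurableSet_Ioo fun v hv => ?_
  have h0 : 0 < v := hv.1
  have h1 : 0 < 1 - v := by linarith [hv.2]
  rw [← ENNReal.ofReal_mul (by positivity), ← ENNReal.ofReal_mul (by positivity)]
  congr 1
  have : s - s * v = s * (1 - v) := by ring
  rw [this, Real.mul_rpow hs.le hv.1.le, Real.mul_rpow hs.le h1.le, mul_one, abs_of_pos hs]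
  have : s ^ (a + b - 1) = s * (s ^ (a - 1) * s ^ (b - 1)) := by
    rw [← Real.rpow_add hs]
    nth_rw 2 [← Real.rpow_one s]
    rw [← Real.rpow_add hs]; ring_nf
  rw [this]; ring

/-- The convolution of two power functions on the half line, tested against `F`. -/
theorem lintegral_add_rpow {a b : ℝ} (ha : 0 < a) (hb : 0 < b) {F : ℝ → ℝ≥0∞}
    (hF : Measurable F) :
    ∫⁻ x in Ioi (0 : ℝ), ∫⁻ y in Ioi (0 : ℝ),
        F (x + y) * ENNReal.ofReal (x ^ (a - 1)) * ENNReal.ofReal (y ^ (b - 1))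
      = ENNReal.ofReal (ProbabilityTheory.beta a b) *
        ∫⁻ s in Ioi (0 : ℝ), F s * ENNReal.ofReal (s ^ (a + b - 1)) := by
  have hinner : ∀ x : ℝ, ∫⁻ y in Ioi (0 : ℝ),
        F (x + y) * ENNReal.ofReal (x ^ (a - 1)) * ENNReal.ofReal (y ^ (b - 1))
      = ∫⁻ s, (Ioi x).indicator (fun s => F s * ENNReal.ofReal (x ^ (a - 1)) *
          ENNReal.ofReal ((s - x) ^ (b - 1))) s := by
    intro x
    rw [← lintegral_indicator measurableSet_Ioi,
      ← lintegral_add_left_eq_self (μ := volume) ((Ioi x).indicator _) x]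
    refine lintegral_congr fun y => ?_
    by_cases hy : 0 < y <;> simp [indicator, hy]
  simp_rw [hinner]
  rw [lintegral_lintegral_swap, ← lintegral_const_mul' _ _ ENNReal.ofReal_ne_top,
    ← lintegral_indicator measurableSet_Ioi]
  · refine lintegral_congr fun s => ?_
    by_cases hs : 0 < s
    · rw [indicator_of_mem (show s ∈ Ioi (0 : ℝ) from hs), mul_left_comm,
        ← lintegral_beta_scaled ha hb hs, ← lintegral_const_mul _ (by fun_prop),
        ← lintegral_indicator measurableSet_Ioo, ← lintegral_indicator measurableSet_Ioi]
      refine lintegral_congr fun x => ?_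
      by_cases hx : 0 < x
      · by_cases hxs : x < s
        · have : 0 ≤ x ^ (a - 1) := by positivity
          simp [indicator, hx, hxs, ENNReal.ofReal_mul this, mul_assoc]
        · simp [indicator, hx, hxs]
      · simp [indicator, hx]
    · rw [indicator_of_notMem (show s ∉ Ioi (0 : ℝ) from hs)]
      rw [← lintegral_indicator measurableSet_Ioi]
      rw [lintegral_eq_zero_of_ae_eq_zero]
      refine Filter.Eventually.of_forall fun x => ?_
      by_cases hx : 0 < x
      · have : ¬ x < s := by linarith
        simp [indicator, this]
      · simp [indicator, hx]
  · refine Measurable.aemeasurable ?_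
    have : Measurable fun q : ℝ × ℝ => F q.2 * ENNReal.ofReal (q.1 ^ (a - 1)) *
          ENNReal.ofReal ((q.2 - q.1) ^ (b - 1)) := by fun_prop
    exact this.indicator (s := {q : ℝ × ℝ | q.1 < q.2})
      (measurableSet_lt measurable_fst measurable_snd)

/-- Liouville's formula on the positive orthant. -/
theorem exists_lintegral_orthant {k : ℕ} (b : Fin (k + 1) → ℝ) (hb : ∀ i, 0 < b i) :
    ∃ C : ℝ, 0 < C ∧ ∀ F : ℝ → ℝ≥0∞, Measurable F →
      ∫⁻ q in {q : Fin (k + 1) → ℝ | ∀ i, 0 < q i},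
          F (∑ i, q i) * ENNReal.ofReal (∏ i, q i ^ (b i - 1))
        = ENNReal.ofReal C * ∫⁻ s in Ioi (0 : ℝ), F s * ENNReal.ofReal (s ^ (∑ i, b i - 1)) := by
  -- The strengthened claim keeps one distinguished variable x with its own exponent b₀. Each
  -- induction step merges x with the first coordinate by the convolution formula, and their sum
  -- becomes the new distinguished variable.
  have key : ∀ (k : ℕ) (b : Fin k → ℝ) (b₀ : ℝ), (∀ i, 0 < b i) → 0 < b₀ →
      ∃ C : ℝ, 0 < C ∧ ∀ F : ℝ → ℝ≥0∞, Measurable F →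
      ∫⁻ x in Ioi (0 : ℝ), ∫⁻ q in {q : Fin k → ℝ | ∀ i, 0 < q i},
          F (x + ∑ i, q i) * ENNReal.ofReal (x ^ (b₀ - 1)) * ENNReal.ofReal (∏ i, q i ^ (b i - 1))
        = ENNReal.ofReal C *
          ∫⁻ s in Ioi (0 : ℝ), F s * ENNReal.ofReal (s ^ (b₀ + ∑ i, b i - 1)) := by
    intro k
    induction k with
    | zero =>
      intro b b₀ hb hb₀
      refine ⟨1, one_pos, fun F hF => ?_⟩
      simp [volume_pi]
    | succ k ih =>
      intro b b₀ hb hb₀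
      obtain ⟨C, hC, h⟩ := ih (fun i => b i.succ) (b₀ + b 0) (fun i => hb _)
        (add_pos hb₀ (hb 0))
      have hB := ProbabilityTheory.beta_pos hb₀ (hb 0)
      refine ⟨ProbabilityTheory.beta b₀ (b 0) * C, mul_pos hB hC, fun F hF => ?_⟩
      have hS : ∀ k, MeasurableSet {q : Fin k → ℝ | ∀ i, 0 < q i} := fun k => by measurability
      have step : ∀ x, ∫⁻ q in {q : Fin (k + 1) → ℝ | ∀ i, 0 < q i},
          F (x + ∑ i, q i) * ENNReal.ofReal (x ^ (b₀ - 1)) * ENNReal.ofReal (∏ i, q i ^ (b i - 1))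
          = ∫⁻ y in Ioi (0 : ℝ), (∫⁻ q in {q : Fin k → ℝ | ∀ i, 0 < q i},
            F (x + y + ∑ i, q i) * ENNReal.ofReal (∏ i, q i ^ (b i.succ - 1)))
              * ENNReal.ofReal (x ^ (b₀ - 1)) * ENNReal.ofReal (y ^ (b 0 - 1)) := by
        intro x
        have hmp := (volume_preserving_piFinSuccAbove (fun _ : Fin (k + 1) => ℝ) 0).symm
        rw [← hmp.setLIntegral_comp_preimage_emb (MeasurableEquiv.measurableEmbedding _)]
        have : (MeasurableEquiv.piFinSuccAbove (fun _ : Fin (k + 1) => ℝ) 0).symm ⁻¹'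
            {q : Fin (k + 1) → ℝ | ∀ i, 0 < q i}
            = Ioi 0 ×ˢ {q : Fin k → ℝ | ∀ i, 0 < q i} := by
          ext q
          simp [Fin.forall_fin_succ, MeasurableEquiv.piFinSuccAbove, Fin.insertNthEquiv]
        rw [this, Measure.volume_eq_prod, ← Measure.prod_restrict, lintegral_prod]
        · refine setLIntegral_congr_fun measurableSet_Ioi fun y hy => ?_
          have hy' : (0:ℝ) ≤ y ^ (b 0 - 1) := Real.rpow_nonneg (le_of_lt hy) _
          rw [← lintegral_mul_const' _ _ ENNReal.ofReal_ne_top,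
            ← lintegral_mul_const' _ _ ENNReal.ofReal_ne_top]
          refine lintegral_congr fun q => ?_
          simp [MeasurableEquiv.piFinSuccAbove, Fin.insertNthEquiv, Fin.sum_univ_succ,
            Fin.prod_univ_succ, ENNReal.ofReal_mul hy', add_assoc]
          ring
        · refine Measurable.aemeasurable ?_
          fun_prop
      simp_rw [step]
      have hG : Measurable fun z : ℝ => ∫⁻ q in {q : Fin k → ℝ | ∀ i, 0 < q i},
            F (z + ∑ i, q i) * ENNReal.ofReal (∏ i, q i ^ (b i.succ - 1)) := by
        refine Measurable.lintegral_prod_right' (f := fun q : ℝ × (Fin k → ℝ) =>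
          F (q.1 + ∑ i, q.2 i) * ENNReal.ofReal (∏ i, q.2 i ^ (b i.succ - 1))) ?_
        fun_prop
      rw [lintegral_add_rpow hb₀ (hb 0) hG, ENNReal.ofReal_mul hB.le, mul_assoc]
      congr 1
      have h' := h F hF
      rw [Fin.sum_univ_succ, ← add_assoc, ← h']
      refine lintegral_congr fun z => ?_
      rw [← lintegral_mul_const' _ _ ENNReal.ofReal_ne_top]
      exact lintegral_congr fun q => by ring
  obtain ⟨C, hC, h⟩ := key k (fun i => b i.succ) (b 0) (fun i => hb _) (hb 0)
  refine ⟨C, hC, fun F hF => ?_⟩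
  rw [Fin.sum_univ_succ, ← h F hF]
  have hmp := (volume_preserving_piFinSuccAbove (fun _ : Fin (k + 1) => ℝ) 0).symm
  rw [← hmp.setLIntegral_comp_preimage_emb (MeasurableEquiv.measurableEmbedding _)]
  have : (MeasurableEquiv.piFinSuccAbove (fun _ : Fin (k + 1) => ℝ) 0).symm ⁻¹'
      {q : Fin (k + 1) → ℝ | ∀ i, 0 < q i}
      = Ioi 0 ×ˢ {q : Fin k → ℝ | ∀ i, 0 < q i} := by
    ext q
    simp [Fin.forall_fin_succ, MeasurableEquiv.piFinSuccAbove, Fin.insertNthEquiv]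
  rw [this, Measure.volume_eq_prod, ← Measure.prod_restrict, lintegral_prod]
  · refine setLIntegral_congr_fun measurableSet_Ioi fun y hy => ?_
    have hy' : (0:ℝ) ≤ y ^ (b 0 - 1) := Real.rpow_nonneg (le_of_lt hy) _
    refine lintegral_congr fun q => ?_
    simp [MeasurableEquiv.piFinSuccAbove, Fin.insertNthEquiv, Fin.sum_univ_succ,
      Fin.prod_univ_succ, ENNReal.ofReal_mul hy']
    ring
  · refine Measurable.aemeasurable ?_
    fun_prop

/-- Liouville's formula on the simplex. -/
theorem exists_lintegral_simplex {k : ℕ} (hk : 1 ≤ k) (b : Fin k → ℝ) (hb : ∀ i, 0 < b i) :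
    ∃ C : ℝ, 0 < C ∧ ∀ F : ℝ → ℝ≥0∞, Measurable F →
      ∫⁻ q in {q : Fin k → ℝ | (∀ i, 0 < q i) ∧ ∑ i, q i < 1},
          F (∑ i, q i) * ENNReal.ofReal (∏ i, q i ^ (b i - 1))
        = ENNReal.ofReal C * ∫⁻ s in Ioo (0 : ℝ) 1, F s * ENNReal.ofReal (s ^ (∑ i, b i - 1)) := by
  obtain ⟨k, rfl⟩ : ∃ j, k = j + 1 := ⟨k - 1, by omega⟩
  obtain ⟨C, hC, h⟩ := exists_lintegral_orthant b hb
  refine ⟨C, hC, fun F hF => ?_⟩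
  -- Cutting F off at 1 turns the orthant into the simplex.
  have h' := h ((Iio 1).indicator F) (hF.indicator measurableSet_Iio)
  have hS : MeasurableSet {q : Fin (k + 1) → ℝ | ∀ i, 0 < q i} := by measurability
  have hT : MeasurableSet {q : Fin (k + 1) → ℝ | ∑ i, q i < 1} :=
    measurableSet_lt (by fun_prop) measurable_const
  have e1 : {q : Fin (k + 1) → ℝ | (∀ i, 0 < q i) ∧ ∑ i, q i < 1}
      = {q | ∑ i, q i < 1} ∩ {q | ∀ i, 0 < q i} := by ext q; simp [and_comm]
  have e2 : Ioo (0 : ℝ) 1 = Iio 1 ∩ Ioi 0 := by ext; simp [and_comm]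
  rw [e1, e2, ← Measure.restrict_restrict hT, ← lintegral_indicator hT,
    ← Measure.restrict_restrict measurableSet_Iio, ← lintegral_indicator measurableSet_Iio]
  refine Eq.trans ?_ (h'.trans ?_)
  · refine lintegral_congr fun q => ?_
    by_cases hq : ∑ i, q i < 1 <;> simp [indicator, hq]
  · congr 1
    refine lintegral_congr fun s => ?_
    by_cases hs : s < 1 <;> simp [indicator, hs]

/-- Tonelli's theorem for a product of functions of the coordinates. -/
theorem lintegral_pi_prod {N : ℕ} {E : Fin N → Type*} [∀ i, MeasureSpace (E i)]
    [∀ i, SigmaFinite (volume : Measure (E i))]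
    (S : ∀ i, Set (E i)) (hS : ∀ i, MeasurableSet (S i))
    (f : ∀ i, E i → ℝ≥0∞) (hf : ∀ i, Measurable (f i)) :
    ∫⁻ q in {q : ∀ i, E i | ∀ i, q i ∈ S i}, ∏ i, f i (q i)
      = ∏ i, ∫⁻ x in S i, f i x := by
  induction N with
  | zero => simp [volume_pi]
  | succ N ih =>
    have hmp := (volume_preserving_piFinSuccAbove E 0).symm
    rw [← hmp.setLIntegral_comp_preimage_emb (MeasurableEquiv.measurableEmbedding _)]
    have : (MeasurableEquiv.piFinSuccAbove E 0).symm ⁻¹' {q : ∀ i, E i | ∀ i, q i ∈ S i}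
        = S 0 ×ˢ {q : ∀ i : Fin N, E (Fin.succAbove 0 i) | ∀ i, q i ∈ S (Fin.succAbove 0 i)} := by
      ext q
      exact Fin.forall_fin_succ
    have e := ih (fun i => S (Fin.succAbove 0 i)) (fun i => hS _)
      (fun i => f (Fin.succAbove 0 i)) (fun i => hf _)
    have hm : Measurable fun q : ∀ i : Fin N, E (Fin.succAbove 0 i) =>
        ∏ i, f (Fin.succAbove 0 i) (q i) :=
      Finset.measurable_prod _ fun i _ => (hf _).comp (measurable_pi_apply i)
    rw [this, Measure.volume_eq_prod, ← Measure.prod_restrict,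
      Fin.prod_univ_succAbove _ 0, ← e, ← lintegral_prod_mul (hf 0).aemeasurable hm.aemeasurable]
    refine lintegral_congr fun q => ?_
    rw [Fin.prod_univ_succAbove _ 0]
    rfl

/-! ### Block sums and the prior measure -/

/-- The open simplex `D_k`. -/
def simplex (k : ℕ) : Set (Fin k → ℝ) := {q | (∀ i, 0 < q i) ∧ ∑ i, q i < 1}

/-- The vector `(q_{·,ν})_ν` of block sums. -/
def blockSum {ι : Type} {m : ι → ℕ} (q : Params m) (ν : ι) : ℝ := ∑ i, q ν i

/-- The vector `(x_{·,ν})_ν` of block totals. -/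
def blockTotal {ι : Type} {m : ι → ℕ} (x : Counts m) (ν : ι) : ℕ := ∑ i, x ν i

/-- The kernel `∏_ν (1 - s_ν) ^ t_ν s_ν ^ y_ν` of independent negative binomial variables. -/
def kern {ι : Type} [Fintype ι] (t : ι → ℝ) (y : ι → ℕ) (s : ι → ℝ) : ℝ :=
  ∏ ν, ((1 - s ν) ^ t ν * s ν ^ y ν)

/-- The measure on the parameter space with the mixed prior density. -/
def priorMeasure {ι : Type} [Fintype ι] {m : ι → ℕ} (M : Measure (Ioi (0 : ℝ)))
    (γ : Ioi (0 : ℝ) → ι → ℝ) (a₀ : ι → ℝ) (a : Params m) : Measure (Params m) :=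
  (volume.restrict (paramSpace m)).withDensity (mixedPrior M γ a₀ a)

theorem measurableSet_simplex (k : ℕ) : MeasurableSet (simplex k) :=
  MeasurableSet.inter (s₁ := {q : Fin k → ℝ | ∀ i, 0 < q i}) (s₂ := {q | ∑ i, q i < 1})
    (by measurability) (measurableSet_lt (by fun_prop) measurable_const)

theorem measurableSet_paramSpace {ι : Type} [Fintype ι] (m : ι → ℕ) :
    MeasurableSet (paramSpace m) := by
  have : paramSpace m = ⋂ ν, (fun q : Params m => q ν) ⁻¹' simplex (m ν) := by
    ext q; simp [paramSpace, simplex]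
  rw [this]
  exact MeasurableSet.iInter fun ν => measurable_pi_apply ν (measurableSet_simplex _)

@[fun_prop]
theorem measurable_blockSum {ι : Type} {m : ι → ℕ} :
    Measurable (blockSum : Params m → ι → ℝ) := by
  unfold blockSum; fun_prop

@[fun_prop]
theorem measurable_kern {ι : Type} [Fintype ι] (t : ι → ℝ) (y : ι → ℕ) :
    Measurable (kern t y) := by
  unfold kern; fun_prop

theorem blockSum_mem {ι : Type} {m : ι → ℕ} (hm : ∀ ν, 1 ≤ m ν) {q : Params m}
    (hq : q ∈ paramSpace m) (ν : ι) : blockSum q ν ∈ Ioo (0 : ℝ) 1 := by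
  have : Nonempty (Fin (m ν)) := ⟨⟨0, hm ν⟩⟩
  exact ⟨Finset.sum_pos (fun i _ => (hq ν).1 i) Finset.univ_nonempty, (hq ν).2⟩

theorem kern_pos {ι : Type} [Fintype ι] (t : ι → ℝ) (y : ι → ℕ) {s : ι → ℝ}
    (hs : ∀ ν, s ν ∈ Ioo (0 : ℝ) 1) : 0 < kern t y s :=
  Finset.prod_pos fun ν _ => mul_pos (Real.rpow_pos_of_pos (by linarith [(hs ν).2]) _)
    (pow_pos (hs ν).1 _)

/-! ### Moments of the mixed prior -/

section Prior

variable {N : ℕ} {m : Fin N → ℕ} {M : Measure (Ioi (0 : ℝ))} {γ : Ioi (0 : ℝ) → Fin N → ℝ}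
  {a₀ : Fin N → ℝ} {a : Params m}

theorem measurable_mixedPrior_integrand (hγ : Measurable γ) :
    Measurable fun x : Params m × Ioi (0 : ℝ) => ENNReal.ofReal
      (∏ ν, ((1 - ∑ i, x.1 ν i) ^ (γ x.2 ν + a₀ ν - 1) * ∏ i, x.1 ν i ^ (a ν i - 1))) := by
  refine ENNReal.measurable_ofReal.comp (Finset.measurable_prod _ fun ν _ => Measurable.mul
    (Measurable.pow (by fun_prop) ?_) (by fun_prop))
  have : Measurable fun x : Params m × Ioi (0 : ℝ) => γ x.2 ν :=
    (measurable_pi_apply ν).comp (hγ.comp measurable_snd)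
  fun_prop

theorem measurable_mixedPrior [SFinite M] (hγ : Measurable γ) :
    Measurable (mixedPrior M γ a₀ a) :=
  (measurable_mixedPrior_integrand hγ).lintegral_prod_right'

/-- A one-point mixture with γ = 0 lets a single argument serve both priors; this is why the general
lemmas ask only for γ ≥ 0. The location of the point mass is immaterial. -/
theorem dirichletPrior_eq_mixedPrior :
    dirichletPrior a₀ a = mixedPrior (Measure.dirac ⟨1, mem_Ioi.2 one_pos⟩) (fun _ _ => 0) a₀ a := by
  ext q
  unfold dirichletPrior mixedPrior
  rw [lintegral_const]
  simp

/-- For a fixed mixing variable u the density is a product over blocks, so Tonelli in (q, u)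
followed by Tonelli over the blocks applies. -/
theorem lintegral_priorMeasure_prod [SFinite M] (hγ : Measurable γ)
    (f : ∀ ν, (Fin (m ν) → ℝ) → ℝ≥0∞) (hf : ∀ ν, Measurable (f ν)) :
    ∫⁻ q, ∏ ν, f ν (q ν) ∂(priorMeasure M γ a₀ a)
      = ∫⁻ u, (∏ ν, ∫⁻ x in simplex (m ν),
          ENNReal.ofReal ((1 - ∑ i, x i) ^ (γ u ν + a₀ ν - 1) * ∏ i, x i ^ (a ν i - 1))
            * f ν x) ∂M := by
  have hfm : Measurable fun q : Params m => ∏ ν, f ν (q ν) := by fun_prop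
  rw [priorMeasure, lintegral_withDensity_eq_lintegral_mul _ (measurable_mixedPrior hγ) hfm]
  simp only [Pi.mul_apply, mixedPrior]
  have e : ∀ q : Params m, (∫⁻ u, ENNReal.ofReal
      (∏ ν, ((1 - ∑ i, q ν i) ^ (γ u ν + a₀ ν - 1) * ∏ i, q ν i ^ (a ν i - 1))) ∂M)
        * ∏ ν, f ν (q ν) = ∫⁻ u, ENNReal.ofReal
      (∏ ν, ((1 - ∑ i, q ν i) ^ (γ u ν + a₀ ν - 1) * ∏ i, q ν i ^ (a ν i - 1)))
        * ∏ ν, f ν (q ν) ∂M := fun q => (lintegral_mul_const _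
    ((measurable_mixedPrior_integrand hγ).comp measurable_prodMk_left)).symm
  simp_rw [e]
  rw [lintegral_lintegral_swap]
  · refine lintegral_congr fun u => ?_
    rw [← lintegral_pi_prod _ (fun ν => measurableSet_simplex (m ν)) _ (fun ν => by fun_prop)]
    refine setLIntegral_congr_fun (measurableSet_paramSpace m) fun q hq => ?_
    rw [ENNReal.ofReal_prod_of_nonneg, Finset.prod_mul_distrib]
    intro ν _
    refine mul_nonneg (Real.rpow_nonneg (by linarith [(hq ν).2]) _)
      (Finset.prod_nonneg fun i _ => Real.rpow_nonneg ((hq ν).1 i).le _)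
  · exact ((measurable_mixedPrior_integrand hγ).mul (hfm.comp measurable_fst)).aemeasurable

theorem ae_priorMeasure_mem : ∀ᵐ q ∂(priorMeasure M γ a₀ a), q ∈ paramSpace m :=
  (withDensity_absolutelyContinuous _ _).ae_le
    (ae_restrict_mem (measurableSet_paramSpace m))

/-- A single block integrated against a Dirichlet type density. -/
theorem exists_lintegral_block {k : ℕ} (hk : 1 ≤ k) (a : Fin k → ℝ) (ha : ∀ i, 0 < a i)
    (z : Fin k → ℕ) : ∃ C : ℝ, 0 < C ∧ ∀ (c t : ℝ) (e : ℕ),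
      ∫⁻ x in simplex k, ENNReal.ofReal ((1 - ∑ i, x i) ^ (c - 1) * ∏ i, x i ^ (a i - 1))
          * ENNReal.ofReal ((1 - ∑ i, x i) ^ t * (∑ i, x i) ^ e * ∏ i, x i ^ z i)
        = ENNReal.ofReal C * ∫⁻ s in Ioo (0 : ℝ) 1, ENNReal.ofReal
            (s ^ (∑ i, a i + ((e + ∑ i, z i : ℕ) : ℝ) - 1) * (1 - s) ^ (c + t - 1)) := by
  obtain ⟨C, hC, h⟩ := exists_lintegral_simplex hk (fun i => a i + z i)
    (fun i => by have := ha i; positivity)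
  refine ⟨C, hC, fun c t e => ?_⟩
  have : Nonempty (Fin k) := ⟨⟨0, hk⟩⟩
  have h' := h (fun s => ENNReal.ofReal (s ^ e * (1 - s) ^ (c + t - 1))) (by fun_prop)
  refine Eq.trans ?_ (h'.trans ?_)
  · refine setLIntegral_congr_fun (measurableSet_simplex k) fun q hq => ?_
    have h1 : 0 < 1 - ∑ i, q i := by linarith [hq.2]
    have h0 : 0 ≤ ∑ i, q i := Finset.sum_nonneg fun i _ => (hq.1 i).le
    have h2 : 0 ≤ ∏ i, q i ^ (a i - 1) :=
      Finset.prod_nonneg fun i _ => Real.rpow_nonneg (hq.1 i).le _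
    rw [← ENNReal.ofReal_mul (by positivity), ← ENNReal.ofReal_mul (by positivity)]
    congr 1
    have e1 : ∏ i, q i ^ (a i + z i - 1) = (∏ i, q i ^ (a i - 1)) * ∏ i, q i ^ z i := by
      rw [← Finset.prod_mul_distrib]
      refine Finset.prod_congr rfl fun i _ => ?_
      rw [← Real.rpow_natCast, ← Real.rpow_add (hq.1 i)]
      ring_nf
    have e2 : (1 - ∑ i, q i) ^ (c + t - 1)
        = (1 - ∑ i, q i) ^ (c - 1) * (1 - ∑ i, q i) ^ t := by
      rw [← Real.rpow_add h1]; ring_nf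
    rw [e1, e2]; ring
  · congr 1
    refine setLIntegral_congr_fun measurableSet_Ioo fun s hs => ?_
    have h0 : 0 < s := hs.1
    have h1 : 0 < 1 - s := by linarith [hs.2]
    rw [← ENNReal.ofReal_mul (by positivity)]
    congr 1
    have : s ^ (∑ i, a i + ((e + ∑ i, z i : ℕ) : ℝ) - 1)
        = s ^ e * s ^ (∑ i, (a i + (z i : ℝ)) - 1) := by
      rw [← Real.rpow_natCast s e, ← Real.rpow_add h0, Finset.sum_add_distrib]
      push_cast
      ring_nf
    rw [this]; ring

theorem ofReal_kern_mul_eq (t : Fin N → ℝ) (e : Fin N → ℕ) (z : Counts m) {q : Params m}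
    (hq : q ∈ paramSpace m) :
    ENNReal.ofReal (kern t e (blockSum q) * ∏ ν, ∏ i, q ν i ^ z ν i)
      = ∏ ν, ENNReal.ofReal ((1 - ∑ i, q ν i) ^ t ν * (∑ i, q ν i) ^ e ν * ∏ i, q ν i ^ z ν i) := by
  rw [kern, ← Finset.prod_mul_distrib, ENNReal.ofReal_prod_of_nonneg]
  · rfl
  · intro ν _
    have h1 : 0 < 1 - ∑ i, q ν i := by linarith [(hq ν).2]
    have h0 : 0 ≤ ∑ i, q ν i := Finset.sum_nonneg fun i _ => ((hq ν).1 i).le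
    have h2 : 0 ≤ ∏ i, q ν i ^ z ν i := Finset.prod_nonneg fun i _ => pow_nonneg ((hq ν).1 i).le _
    unfold blockSum
    positivity

/-- Moments of the mixed prior as mixtures of beta integrals. -/
theorem exists_lintegral_kern_mul (hm : ∀ ν, 1 ≤ m ν) (ha : ∀ ν i, 0 < a ν i) (z : Counts m) :
    ∃ C : Fin N → ℝ, (∀ ν, 0 < C ν) ∧ ∀ (M : Measure (Ioi (0 : ℝ))) [SFinite M]
      (γ : Ioi (0 : ℝ) → Fin N → ℝ), Measurable γ → ∀ (a₀ t : Fin N → ℝ) (e : Fin N → ℕ),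
      ∫⁻ q, ENNReal.ofReal (kern t e (blockSum q) * ∏ ν, ∏ i, q ν i ^ z ν i)
          ∂(priorMeasure M γ a₀ a)
        = (∏ ν, ENNReal.ofReal (C ν)) * ∫⁻ u, (∏ ν, ∫⁻ s in Ioo (0 : ℝ) 1, ENNReal.ofReal
            (s ^ (∑ i, a ν i + ((e ν + blockTotal z ν : ℕ) : ℝ) - 1)
              * (1 - s) ^ (γ u ν + a₀ ν + t ν - 1))) ∂M := by
  choose C hC h using fun ν => exists_lintegral_block (hm ν) (a ν) (ha ν) (z ν)
  refine ⟨C, hC, fun M _ γ hγ a₀ t e => ?_⟩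
  rw [lintegral_congr_ae (ae_priorMeasure_mem.mono fun q hq => ofReal_kern_mul_eq t e z hq),
    lintegral_priorMeasure_prod hγ (fun ν x => ENNReal.ofReal
      ((1 - ∑ i, x i) ^ t ν * (∑ i, x i) ^ e ν * ∏ i, x i ^ z ν i)) (fun ν => by fun_prop),
    ← lintegral_const_mul' _ _ (ENNReal.prod_ne_top fun ν _ => ENNReal.ofReal_ne_top)]
  refine lintegral_congr fun u => ?_
  simp_rw [h, Finset.prod_mul_distrib]
  rfl

/-- The direction of `q_ν` is independent of the block sums under every mixed prior, and its
distribution does not depend on the mixing measure. -/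
theorem exists_lintegral_kern_mul_eq (hm : ∀ ν, 1 ≤ m ν) (ha : ∀ ν i, 0 < a ν i) (z : Counts m) :
    ∃ K : ℝ, 0 < K ∧ ∀ (M : Measure (Ioi (0 : ℝ))) [SFinite M]
      (γ : Ioi (0 : ℝ) → Fin N → ℝ), Measurable γ → ∀ (a₀ t : Fin N → ℝ) (e : Fin N → ℕ),
      ∫⁻ q, ENNReal.ofReal (kern t e (blockSum q) * ∏ ν, ∏ i, q ν i ^ z ν i)
          ∂(priorMeasure M γ a₀ a)
        = ENNReal.ofReal K *
          ∫⁻ q, ENNReal.ofReal (kern t (e + blockTotal z) (blockSum q))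
            ∂(priorMeasure M γ a₀ a) := by
  obtain ⟨C, hC, h⟩ := exists_lintegral_kern_mul hm ha z
  obtain ⟨C', hC', h'⟩ := exists_lintegral_kern_mul hm ha (0 : Counts m)
  refine ⟨(∏ ν, C ν) / ∏ ν, C' ν, div_pos (Finset.prod_pos fun ν _ => hC ν)
    (Finset.prod_pos fun ν _ => hC' ν), fun M _ γ hγ a₀ t e => ?_⟩
  -- With z = 0 and the totals of z moved into the exponents e, the beta mixture is unchanged; only
  -- the block constants C and C' differ, and they do not involve M, γ, a₀ or t.
  have h2 := h' M γ hγ a₀ t (e + blockTotal z)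
  simp only [Pi.zero_apply, pow_zero, Finset.prod_const_one, mul_one, blockTotal,
    Finset.sum_const_zero, add_zero, Pi.add_apply] at h2
  rw [h M γ hγ, ← ENNReal.ofReal_prod_of_nonneg fun ν _ => (hC ν).le]
  rw [← ENNReal.ofReal_prod_of_nonneg fun ν _ => (hC' ν).le] at h2
  have hP := Finset.prod_pos fun ν (_ : ν ∈ Finset.univ) => hC' ν
  have hQ := Finset.prod_pos fun ν (_ : ν ∈ Finset.univ) => hC ν
  have h2' : ∫⁻ q, ENNReal.ofReal (kern t (e + blockTotal z) (blockSum q))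
      ∂(priorMeasure M γ a₀ a) = _ := h2
  rw [h2', ← mul_assoc, ← ENNReal.ofReal_mul (by positivity), div_mul_cancel₀ _ hP.ne']
  rfl

/-- The factor 1 - σ_ν raises t_ν by one, which multiplies the beta integral of block ν by c / (b +
c), with b = ∑ a_{i,ν} + y_ν and c = γ_ν(u) + a_{0,ν} + t_ν. This ratio increases in c and c ≥ δ, so
the bound is uniform in u and survives the mixture. -/
theorem lintegral_one_sub_mul_kern_ge [SFinite M] (hγ : Measurable γ) (hγ0 : ∀ u ν, 0 ≤ γ u ν)
    (hm : ∀ ν, 1 ≤ m ν) (ha : ∀ ν i, 0 < a ν i) {δ : ℝ} (hδ : 0 < δ) (t : Fin N → ℝ)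
    (ht : ∀ ν, δ ≤ t ν + a₀ ν) (y : Fin N → ℕ) (ν : Fin N) :
    ENNReal.ofReal (δ / (∑ i, a ν i + y ν + δ)) *
        ∫⁻ q, ENNReal.ofReal (kern t y (blockSum q)) ∂(priorMeasure M γ a₀ a)
      ≤ ∫⁻ q, ENNReal.ofReal ((1 - blockSum q ν) * kern t y (blockSum q))
          ∂(priorMeasure M γ a₀ a) := by
  obtain ⟨C, hC, h⟩ := exists_lintegral_kern_mul hm ha (0 : Counts m)
  have hA : 0 < ∑ i, a ν i := by
    have : Nonempty (Fin (m ν)) := ⟨⟨0, hm ν⟩⟩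
    exact Finset.sum_pos (fun i _ => ha ν i) Finset.univ_nonempty
  have e1 : ∫⁻ q, ENNReal.ofReal ((1 - blockSum q ν) * kern t y (blockSum q))
      ∂(priorMeasure M γ a₀ a)
      = ∫⁻ q, ENNReal.ofReal (kern (Function.update t ν (t ν + 1)) y (blockSum q))
        ∂(priorMeasure M γ a₀ a) := by
    refine lintegral_congr_ae (ae_priorMeasure_mem.mono fun q hq => ?_)
    have h1 := (blockSum_mem hm hq ν).2
    simp only [kern]
    congr 1
    rw [← Finset.mul_prod_erase _ _ (Finset.mem_univ ν),
      ← Finset.mul_prod_erase (a := ν) _ (fun j => (1 - blockSum q j) ^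
        (Function.update t ν (t ν + 1) j) * _) (Finset.mem_univ ν)]
    rw [Function.update_self, Real.rpow_add_one (by linarith)]
    have : ∏ j ∈ Finset.univ.erase ν, (1 - blockSum q j) ^
        (Function.update t ν (t ν + 1) j) * blockSum q j ^ y j
        = ∏ j ∈ Finset.univ.erase ν, (1 - blockSum q j) ^ t j * blockSum q j ^ y j :=
      Finset.prod_congr rfl fun j hj => by
        rw [Function.update_of_ne (Finset.ne_of_mem_erase hj)]
    rw [this]; ring
  have h0 := h M γ hγ a₀ t y
  have h1 := h M γ hγ a₀ (Function.update t ν (t ν + 1)) y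
  simp only [Pi.zero_apply, pow_zero, Finset.prod_const_one, mul_one, blockTotal,
    Finset.sum_const_zero, add_zero] at h0 h1
  rw [e1, h0, h1, mul_left_comm, ← lintegral_const_mul' _ _ ENNReal.ofReal_ne_top]
  gcongr with u
  rw [← Finset.mul_prod_erase _ _ (Finset.mem_univ ν),
    ← Finset.mul_prod_erase (a := ν) _ (fun j => ∫⁻ s in Ioo (0 : ℝ) 1, ENNReal.ofReal
            (s ^ (∑ i, a j i + (y j : ℝ) - 1)
              * (1 - s) ^ (γ u j + a₀ j + Function.update t ν (t ν + 1) j - 1)))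
      (Finset.mem_univ ν), ← mul_assoc]
  have hc : δ ≤ γ u ν + a₀ ν + t ν := by linarith [ht ν, hγ0 u ν]
  have hc0 := hδ.trans_le hc
  have hb : 0 < ∑ i, a ν i + (y ν : ℝ) := by positivity
  gcongr ?_ * ?_
  · rw [Function.update_self, ← add_assoc, lintegral_beta hb hc0, lintegral_beta hb (by linarith),
      beta_add_one hb hc0, ← ENNReal.ofReal_mul (by positivity)]
    refine ENNReal.ofReal_le_ofReal ?_
    gcongr ?_ * _
    · exact (ProbabilityTheory.beta_pos hb hc0).le
    · rw [div_le_div_iff₀ (by positivity) (by positivity)]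
      nlinarith
  · refine le_of_eq (Finset.prod_congr rfl fun j hj => ?_)
    rw [Function.update_of_ne (Finset.ne_of_mem_erase hj)]

/-- For the Dirichlet prior the integral is a product of beta functions, and r + a₀ > 0 is what
makes them finite. -/
theorem lintegral_kern_dirac (hm : ∀ ν, 1 ≤ m ν)
    (ha : ∀ ν i, 0 < a ν i) (t : Fin N → ℝ) (ht : ∀ ν, 0 < t ν + a₀ ν) :
    ∫⁻ q, ENNReal.ofReal (kern t 0 (blockSum q))
        ∂(priorMeasure (Measure.dirac ⟨1, mem_Ioi.2 one_pos⟩) (fun _ _ => 0) a₀ a) ≠ 0 ∧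
      ∫⁻ q, ENNReal.ofReal (kern t 0 (blockSum q))
        ∂(priorMeasure (Measure.dirac ⟨1, mem_Ioi.2 one_pos⟩) (fun _ _ => 0) a₀ a) ≠ ⊤ := by
  obtain ⟨C, hC, h⟩ := exists_lintegral_kern_mul hm ha (0 : Counts m)
  have h0 := h (Measure.dirac ⟨1, mem_Ioi.2 one_pos⟩) (fun _ _ => 0) measurable_const a₀ t 0
  simp only [Pi.zero_apply, pow_zero, Finset.prod_const_one, mul_one, blockTotal,
    Finset.sum_const_zero, add_zero, zero_add, Nat.cast_zero, lintegral_const,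
    measure_univ] at h0
  have hA : ∀ ν, 0 < ∑ i, a ν i := fun ν => by
    have : Nonempty (Fin (m ν)) := ⟨⟨0, hm ν⟩⟩
    exact Finset.sum_pos (fun i _ => ha ν i) Finset.univ_nonempty
  have hB : ∀ ν, 0 < a₀ ν + t ν := fun ν => by linarith [ht ν]
  simp_rw [fun ν => lintegral_beta (hA ν) (hB ν)] at h0
  rw [h0]
  constructor
  · refine mul_ne_zero (Finset.prod_ne_zero_iff.2 fun ν _ => ?_)
      (Finset.prod_ne_zero_iff.2 fun ν _ => ?_)
    · exact (ENNReal.ofReal_pos.2 (hC ν)).ne'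
    · exact (ENNReal.ofReal_pos.2 (ProbabilityTheory.beta_pos (hA ν) (hB ν))).ne'
  · exact ENNReal.mul_ne_top (ENNReal.prod_ne_top fun ν _ => ENNReal.ofReal_ne_top)
      (ENNReal.prod_ne_top fun ν _ => ENNReal.ofReal_ne_top)

end Prior

/-! ### Rising factorial coefficients -/

section

/-- The coefficient `t (t + 1) ⋯ (t + y - 1) / y!`. -/
def risingCoeff (y : ℕ) (t : ℝ) : ℝ := (ascPochhammer ℝ y).eval t / y.factorial

@[simp] theorem risingCoeff_zero (t : ℝ) : risingCoeff 0 t = 1 := by simp [risingCoeff]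

theorem succ_mul_risingCoeff_succ (y : ℕ) (t : ℝ) :
    ((y : ℝ) + 1) * risingCoeff (y + 1) t = (t + y) * risingCoeff y t := by
  rw [risingCoeff, risingCoeff, ascPochhammer_succ_eval, Nat.factorial_succ]
  have : (y.factorial : ℝ) ≠ 0 := by positivity
  push_cast
  field_simp

theorem risingCoeff_succ (y : ℕ) (t : ℝ) :
    risingCoeff (y + 1) t = (t + y) * risingCoeff y t / (y + 1) := by
  rw [← succ_mul_risingCoeff_succ]; field_simp

theorem risingCoeff_pos {t : ℝ} (ht : 0 < t) (y : ℕ) : 0 < risingCoeff y t :=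
  div_pos (ascPochhammer_pos _ _ ht) (by positivity)

theorem risingCoeff_nonneg {t : ℝ} (ht : 0 ≤ t) (y : ℕ) : 0 ≤ risingCoeff y t := by
  induction y with
  | zero => simp
  | succ y ih => rw [risingCoeff_succ]; positivity

theorem risingCoeff_mono {s t : ℝ} (hs : 0 ≤ s) (hst : s ≤ t) (y : ℕ) :
    risingCoeff y s ≤ risingCoeff y t := by
  induction y with
  | zero => simp
  | succ y ih =>
    rw [risingCoeff_succ, risingCoeff_succ]
    have := risingCoeff_nonneg hs y
    gcongr
    linarith [y.cast_nonneg (α := ℝ)]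

/-- Vandermonde's identity. -/
theorem risingCoeff_add (r s : ℝ) (n : ℕ) :
    ∑ ij ∈ Finset.HasAntidiagonal.antidiagonal n, risingCoeff ij.1 r * risingCoeff ij.2 s
      = risingCoeff n (r + s) := by
  induction n with
  | zero => simp
  | succ n ih =>
    have h1 : ((n : ℝ) + 1) * ∑ ij ∈ Finset.HasAntidiagonal.antidiagonal (n + 1),
          risingCoeff ij.1 r * risingCoeff ij.2 s
        = ∑ ij ∈ Finset.HasAntidiagonal.antidiagonal (n + 1), (ij.1 : ℝ) * risingCoeff ij.1 r * risingCoeff ij.2 s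
          + ∑ ij ∈ Finset.HasAntidiagonal.antidiagonal (n + 1),
            risingCoeff ij.1 r * ((ij.2 : ℝ) * risingCoeff ij.2 s) := by
      rw [Finset.mul_sum, ← Finset.sum_add_distrib]
      refine Finset.sum_congr rfl fun ij hij => ?_
      have : (ij.1 : ℝ) + ij.2 = n + 1 := by exact_mod_cast Finset.HasAntidiagonal.mem_antidiagonal.1 hij
      rw [← this]; ring
    have h2 : ∑ ij ∈ Finset.HasAntidiagonal.antidiagonal (n + 1),
          (ij.1 : ℝ) * risingCoeff ij.1 r * risingCoeff ij.2 s
        = ∑ ij ∈ Finset.HasAntidiagonal.antidiagonal n,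
          (r + ij.1) * risingCoeff ij.1 r * risingCoeff ij.2 s := by
      rw [Finset.Nat.sum_antidiagonal_succ]
      simp [succ_mul_risingCoeff_succ]
    have h3 : ∑ ij ∈ Finset.HasAntidiagonal.antidiagonal (n + 1),
          risingCoeff ij.1 r * ((ij.2 : ℝ) * risingCoeff ij.2 s)
        = ∑ ij ∈ Finset.HasAntidiagonal.antidiagonal n,
          risingCoeff ij.1 r * ((s + ij.2) * risingCoeff ij.2 s) := by
      rw [Finset.Nat.sum_antidiagonal_succ']
      simp [succ_mul_risingCoeff_succ]
    rw [h2, h3, ← Finset.sum_add_distrib] at h1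
    rw [risingCoeff_succ, ← ih, eq_div_iff (by positivity), mul_comm, h1, Finset.mul_sum]
    refine Finset.sum_congr rfl fun ij hij => ?_
    have : (ij.1 : ℝ) + ij.2 = n := by exact_mod_cast Finset.HasAntidiagonal.mem_antidiagonal.1 hij
    rw [← this]; ring

/-- The derivative of `risingCoeff y`. -/
def risingCoeffDeriv (y : ℕ) (t : ℝ) : ℝ :=
  ∑ k ∈ Finset.range y, risingCoeff (y - 1 - k) t / (k + 1)

theorem risingCoeffDeriv_succ_eq (y : ℕ) (t : ℝ) : risingCoeffDeriv (y + 1) t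
    = ∑ kj ∈ Finset.HasAntidiagonal.antidiagonal y, risingCoeff kj.2 t / ((kj.1 : ℝ) + 1) := by
  rw [Finset.Nat.sum_antidiagonal_eq_sum_range_succ_mk]
  rfl

/-- This is the formal derivative in t of (y + 1) c_{y+1} = (t + y) c_y, verified directly on the
convolution sum so that differentiability follows by induction. -/
theorem risingCoeffDeriv_succ (y : ℕ) (t : ℝ) : ((y : ℝ) + 1) * risingCoeffDeriv (y + 1) t
    = (t + y) * risingCoeffDeriv y t + risingCoeff y t := by
  cases y with
  | zero => simp [risingCoeffDeriv]
  | succ y =>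
    rw [risingCoeffDeriv_succ_eq, risingCoeffDeriv_succ_eq]
    have h1 : (((y + 1 : ℕ) : ℝ) + 1) * ∑ kj ∈ Finset.HasAntidiagonal.antidiagonal (y + 1),
          risingCoeff kj.2 t / ((kj.1 : ℝ) + 1)
        = ∑ kj ∈ Finset.HasAntidiagonal.antidiagonal (y + 1), risingCoeff kj.2 t
          + ∑ kj ∈ Finset.HasAntidiagonal.antidiagonal (y + 1),
            ((kj.2 : ℝ) * risingCoeff kj.2 t) / ((kj.1 : ℝ) + 1) := by
      rw [Finset.mul_sum, ← Finset.sum_add_distrib]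
      refine Finset.sum_congr rfl fun ij hij => ?_
      have : (ij.1 : ℝ) + ij.2 = y + 1 := by exact_mod_cast Finset.HasAntidiagonal.mem_antidiagonal.1 hij
      push_cast
      rw [← this]; field_simp; ring
    rw [h1, Finset.Nat.sum_antidiagonal_succ, Finset.Nat.sum_antidiagonal_succ']
    simp only [Nat.cast_zero, zero_mul, zero_div, Nat.cast_add, Nat.cast_one,
      succ_mul_risingCoeff_succ]
    rw [zero_add, add_assoc, add_comm (risingCoeff (y + 1) t), ← Finset.sum_add_distrib,
      Finset.mul_sum]
    congr 1
    refine Finset.sum_congr rfl fun ij hij => ?_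
    have : (ij.1 : ℝ) + ij.2 = y := by exact_mod_cast Finset.HasAntidiagonal.mem_antidiagonal.1 hij
    rw [← this]; field_simp; ring

/-- The shape of the derivative comes from the generating function (1 - x)^{-t}: differentiating in
t multiplies it by -log(1 - x) = ∑ x^k / k, hence convolves its coefficients with 1 / k. -/
theorem hasDerivAt_risingCoeff (y : ℕ) (t : ℝ) :
    HasDerivAt (risingCoeff y) (risingCoeffDeriv y t) t := by
  induction y with
  | zero =>
    have : risingCoeff 0 = fun _ => (1 : ℝ) := by ext; simp
    rw [this]; simpa [risingCoeffDeriv] using hasDerivAt_const t (1 : ℝ)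
  | succ y ih =>
    have : risingCoeff (y + 1) = fun t => (t + y) * risingCoeff y t / ((y : ℝ) + 1) := by
      ext; rw [risingCoeff_succ]
    rw [this]
    have e : risingCoeffDeriv (y + 1) t
        = (1 * risingCoeff y t + (t + y) * risingCoeffDeriv y t) / ((y : ℝ) + 1) := by
      rw [eq_div_iff (by positivity), mul_comm, risingCoeffDeriv_succ]; ring
    rw [e]
    exact (((hasDerivAt_id' t).add_const (y : ℝ)).mul ih).div_const _

theorem risingCoeffDeriv_nonneg {t : ℝ} (ht : 0 ≤ t) (y : ℕ) : 0 ≤ risingCoeffDeriv y t :=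
  Finset.sum_nonneg fun k _ => div_nonneg (risingCoeff_nonneg ht _) (by positivity)

/-- The logarithmic derivative is ∑_{j<y} 1 / (t + j), each of whose y terms is at most 1 / t. -/
theorem risingCoeffDeriv_le {t : ℝ} (ht : 0 < t) (y : ℕ) :
    risingCoeffDeriv y t ≤ y / t * risingCoeff y t := by
  induction y with
  | zero => simp [risingCoeffDeriv]
  | succ y ih =>
    have hP := risingCoeff_pos ht y
    have hy : (0 : ℝ) < y + 1 := by positivity
    refine le_of_mul_le_mul_left ?_ hy
    rw [risingCoeffDeriv_succ, mul_left_comm, succ_mul_risingCoeff_succ]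
    have h1 : (t + y) * risingCoeffDeriv y t ≤ (t + y) * (y / t * risingCoeff y t) := by gcongr
    have h2 : ((y + 1 : ℕ) : ℝ) / t * ((t + y) * risingCoeff y t)
        - (t + y) * (y / t * risingCoeff y t) - risingCoeff y t = y / t * risingCoeff y t := by
      push_cast; field_simp; ring
    have h3 : 0 ≤ y / t * risingCoeff y t := by positivity
    linarith

/-- Polynomial weights do not affect the limiting ratio of successive terms, which is θ < 1. -/
theorem summable_pow_mul_risingCoeff {T θ : ℝ} (hT : 0 < T) (hθ : θ ∈ Ioo (0 : ℝ) 1) (d : ℕ) :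
    Summable fun y : ℕ => (1 + (y : ℝ)) ^ d * (risingCoeff y T * θ ^ y) := by
  have hpos : ∀ y : ℕ, 0 < (1 + (y : ℝ)) ^ d * (risingCoeff y T * θ ^ y) := fun y => by
    have := risingCoeff_pos hT y
    have := hθ.1
    positivity
  refine summable_of_ratio_test_tendsto_lt_one hθ.2 (Eventually.of_forall fun y => (hpos y).ne') ?_
  have e : ∀ y : ℕ, ‖(1 + ((y + 1 : ℕ) : ℝ)) ^ d * (risingCoeff (y + 1) T * θ ^ (y + 1))‖
      / ‖(1 + (y : ℝ)) ^ d * (risingCoeff y T * θ ^ y)‖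
      = (1 + 1 / ((y : ℝ) + 1)) ^ d * ((1 + (T - 1) * (1 / ((y : ℝ) + 1))) * θ) := by
    intro y
    rw [Real.norm_of_nonneg (hpos _).le, Real.norm_of_nonneg (hpos y).le, risingCoeff_succ]
    have h1 := (risingCoeff_pos hT y).ne'
    have h2 := hθ.1.ne'
    have h3 : (1 : ℝ) + 1 / ((y : ℝ) + 1) = (1 + ((y + 1 : ℕ) : ℝ)) / (1 + y) := by
      push_cast; field_simp; ring
    rw [h3, div_pow]
    field_simp
    ring
  simp_rw [e]
  have h := tendsto_one_div_add_atTop_nhds_zero_nat (𝕜 := ℝ)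
  have := ((h.const_add 1).pow d).mul (((h.const_mul (T - 1)).const_add 1).mul_const θ)
  simpa using this

theorem hasSum_risingCoeff_mul_pow (t : ℝ) {θ : ℝ} (hθ : θ ∈ Ioo (0 : ℝ) 1) :
    HasSum (fun y : ℕ => risingCoeff y t * θ ^ y) ((1 - θ) ^ (-t)) := by
  have h := (Real.one_div_one_sub_rpow_hasFPowerSeriesOnBall_zero t).hasSum (y := θ) (by
    simp [abs_of_pos hθ.1, hθ.2, enorm_eq_nnnorm, ← NNReal.coe_lt_one])
  rw [zero_add, one_div, ← Real.rpow_neg (by linarith [hθ.2])] at h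
  convert! h using 2 with y
  simp only [FormalMultilinearSeries.ofScalars_apply_eq, smul_eq_mul]
  rw [← Ring.multichoose_eq, risingCoeff]
  have := Ring.factorial_nsmul_multichoose_eq_ascPochhammer t y
  rw [Polynomial.ascPochhammer_smeval_eq_eval] at this
  rw [← this, nsmul_eq_mul, mul_div_cancel_left₀ _ (by positivity)]

end

/-! ### Negative binomial masses and their derivative in the size parameter -/

section

variable {ι : Type} [Fintype ι]

theorem summable_pi_prod {f : ι → ℕ → ℝ} (hf0 : ∀ ν n, 0 ≤ f ν n) (hf : ∀ ν, Summable (f ν)) :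
    Summable fun y : ι → ℕ => ∏ ν, f ν (y ν) := by
  classical
  refine summable_of_sum_le (c := ∏ ν, ∑' n, f ν n)
    (fun y => Finset.prod_nonneg fun ν _ => hf0 _ _) fun u => ?_
  calc ∑ y ∈ u, ∏ ν, f ν (y ν)
      ≤ ∑ y ∈ Fintype.piFinset fun ν => u.image fun y => y ν, ∏ ν, f ν (y ν) := by
        refine Finset.sum_le_sum_of_subset_of_nonneg (fun y hy => ?_)
          fun y _ _ => Finset.prod_nonneg fun ν _ => hf0 _ _
        exact Fintype.mem_piFinset.2 fun ν => Finset.mem_image_of_mem _ hy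
    _ = ∏ ν, ∑ n ∈ u.image fun y => y ν, f ν n := (Finset.prod_univ_sum _ _).symm
    _ ≤ ∏ ν, ∑' n, f ν n := Finset.prod_le_prod
        (fun ν _ => Finset.sum_nonneg fun n _ => hf0 _ _)
        fun ν _ => (hf ν).sum_le_tsum _ fun n _ => hf0 _ _

theorem hasSum_pi_prod {f : ι → ℕ → ℝ} {c : ι → ℝ} (hf0 : ∀ ν n, 0 ≤ f ν n)
    (hf : ∀ ν, HasSum (f ν) (c ν)) : HasSum (fun y : ι → ℕ => ∏ ν, f ν (y ν)) (∏ ν, c ν) := by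
  classical
  have hs := (summable_pi_prod hf0 fun ν => (hf ν).summable).hasSum
  -- Cubes exhaust the index set and the partial sums over them factor; summability is already
  -- known, so the limit along cubes identifies the sum.
  have ht : Tendsto (fun n : ℕ => Fintype.piFinset fun _ : ι => Finset.range n) atTop atTop := by
    refine tendsto_atTop_finset_of_monotone
      (fun a b hab => Fintype.piFinset_subset _ _ fun _ => Finset.range_mono hab) fun y => ?_
    refine ⟨∑ ν, y ν + 1, Fintype.mem_piFinset.2 fun ν => Finset.mem_range.2 ?_⟩
    exact Nat.lt_succ_of_le (Finset.single_le_sum (fun _ _ => Nat.zero_le _) (Finset.mem_univ ν))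
  have h1 := hs.comp ht
  have h2 : Tendsto (fun n : ℕ => ∏ ν, ∑ k ∈ Finset.range n, f ν k) atTop (𝓝 (∏ ν, c ν)) :=
    tendsto_finsetProd _ fun ν _ => (hf ν).tendsto_sum_nat
  have h3 : (fun n : ℕ => ∏ ν, ∑ k ∈ Finset.range n, f ν k)
      = (fun s => ∑ y ∈ s, ∏ ν, f ν (y ν)) ∘
        fun n : ℕ => Fintype.piFinset fun _ : ι => Finset.range n := by
    ext n; exact Finset.prod_univ_sum _ _
  rw [h3] at h2
  rw [← tendsto_nhds_unique h1 h2]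
  exact hs

/-- The total `∑_ν y_ν`. -/
def size (y : ι → ℕ) : ℝ := ∑ ν, (y ν : ℝ)

theorem size_nonneg (y : ι → ℕ) : 0 ≤ size y := Finset.sum_nonneg fun _ _ => by positivity

theorem le_size (y : ι → ℕ) (ν : ι) : (y ν : ℝ) ≤ size y :=
  Finset.single_le_sum (f := fun ν => (y ν : ℝ)) (fun _ _ => by positivity) (Finset.mem_univ ν)

theorem size_add (x y : ι → ℕ) : size (x + y) = size x + size y := by
  simp [size, Finset.sum_add_distrib]

theorem size_single [DecidableEq ι] (ν : ι) (k : ℕ) : size (Pi.single ν k) = k := by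
  rw [size, Finset.sum_eq_single ν] <;> simp +contextual

/-- Replaces a weight in the total by a product weight, so that multivariate summability reduces to
one coordinate. -/
theorem one_add_size_le (y : ι → ℕ) : 1 + size y ≤ ∏ ν, (1 + (y ν : ℝ)) := by
  classical
  unfold size
  induction (Finset.univ : Finset ι) using Finset.induction_on with
  | empty => simp
  | insert i s hi ih =>
    rw [Finset.sum_insert hi, Finset.prod_insert hi]
    have : 0 ≤ ∑ ν ∈ s, (y ν : ℝ) := Finset.sum_nonneg fun _ _ => by positivity
    nlinarith [(y i).cast_nonneg (α := ℝ)]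

/-- The mass function of the negative binomial distribution. -/
def nb (t θ : ℝ) (y : ℕ) : ℝ := risingCoeff y t * ((1 - θ) ^ t * θ ^ y)

/-- The joint mass function of independent negative binomial variables. -/
def nbMass (t θ : ι → ℝ) (y : ι → ℕ) : ℝ := ∏ ν, nb (t ν) (θ ν) (y ν)

/-- A mass function that dominates `nbMass t θ` for `t ≤ T`. -/
def domMass (T θ : ι → ℝ) (y : ι → ℕ) : ℝ := ∏ ν, risingCoeff (y ν) (T ν) * θ ν ^ y ν

variable {t T θ : ι → ℝ}

theorem nb_nonneg {t θ : ℝ} (ht : 0 ≤ t) (hθ : θ ∈ Ioo (0 : ℝ) 1) (y : ℕ) : 0 ≤ nb t θ y := by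
  have := risingCoeff_nonneg ht y
  have := hθ.1
  have : 0 < 1 - θ := by linarith [hθ.2]
  unfold nb; positivity

theorem hasSum_nb (t : ℝ) {θ : ℝ} (hθ : θ ∈ Ioo (0 : ℝ) 1) : HasSum (nb t θ) 1 := by
  have h := (hasSum_risingCoeff_mul_pow t hθ).mul_left ((1 - θ) ^ t)
  rw [← Real.rpow_add (by linarith [hθ.2]), add_neg_cancel, Real.rpow_zero] at h
  refine h.congr_fun fun y => ?_
  unfold nb; ring

theorem nbMass_nonneg (ht : ∀ ν, 0 ≤ t ν) (hθ : ∀ ν, θ ν ∈ Ioo (0 : ℝ) 1) (y : ι → ℕ) :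
    0 ≤ nbMass t θ y := Finset.prod_nonneg fun ν _ => nb_nonneg (ht ν) (hθ ν) _

theorem hasSum_nbMass (ht : ∀ ν, 0 ≤ t ν) (hθ : ∀ ν, θ ν ∈ Ioo (0 : ℝ) 1) :
    HasSum (nbMass t θ) 1 := by
  have := hasSum_pi_prod (fun ν n => nb_nonneg (ht ν) (hθ ν) n) fun ν => hasSum_nb (t ν) (hθ ν)
  rw [Finset.prod_const_one] at this
  exact this

theorem domMass_nonneg (hT : ∀ ν, 0 ≤ T ν) (hθ : ∀ ν, θ ν ∈ Ioo (0 : ℝ) 1) (y : ι → ℕ) :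
    0 ≤ domMass T θ y :=
  Finset.prod_nonneg fun ν _ => mul_nonneg (risingCoeff_nonneg (hT ν) _) (pow_nonneg (hθ ν).1.le _)

/-- The coefficient increases in t and (1 - θ)^t ≤ 1, so the majorant depends on T only and serves
for all t ≤ T. -/
theorem nb_le {t T θ : ℝ} (ht : 0 ≤ t) (htT : t ≤ T) (hθ : θ ∈ Ioo (0 : ℝ) 1) (y : ℕ) :
    nb t θ y ≤ risingCoeff y T * θ ^ y := by
  have h1 := risingCoeff_nonneg ht y
  have h2 := risingCoeff_mono ht htT y
  have := hθ.1
  have h3 : (1 - θ) ^ t ≤ 1 := Real.rpow_le_one (by linarith [hθ.2]) (by linarith) ht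
  have h4 : 0 ≤ θ ^ y := by positivity
  unfold nb
  exact mul_le_mul h2 (by nlinarith) (mul_nonneg (Real.rpow_nonneg (by linarith [hθ.2]) _) h4)
    (h1.trans h2)

theorem nbMass_le_domMass (ht : ∀ ν, 0 ≤ t ν) (htT : ∀ ν, t ν ≤ T ν)
    (hθ : ∀ ν, θ ν ∈ Ioo (0 : ℝ) 1) (y : ι → ℕ) : nbMass t θ y ≤ domMass T θ y :=
  Finset.prod_le_prod (fun ν _ => nb_nonneg (ht ν) (hθ ν) _)
    fun ν _ => nb_le (ht ν) (htT ν) (hθ ν) _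

theorem summable_size_pow_mul_domMass (hT : ∀ ν, 0 < T ν) (hθ : ∀ ν, θ ν ∈ Ioo (0 : ℝ) 1) (d : ℕ) :
    Summable fun y : ι → ℕ => (1 + size y) ^ d * domMass T θ y := by
  have h := summable_pi_prod (f := fun ν n => (1 + (n : ℝ)) ^ d * (risingCoeff n (T ν) * θ ν ^ n))
    (fun ν n => by
      have := risingCoeff_pos (hT ν) n
      have := (hθ ν).1
      positivity) fun ν => summable_pow_mul_risingCoeff (hT ν) (hθ ν) d
  refine Summable.of_nonneg_of_le (fun y => mul_nonneg (pow_nonneg (by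
    linarith [size_nonneg y]) _) (domMass_nonneg (fun ν => (hT ν).le) hθ y)) (fun y => ?_) h
  rw [Finset.prod_mul_distrib, Finset.prod_pow]
  have := one_add_size_le y
  have := size_nonneg y
  exact mul_le_mul_of_nonneg_right (pow_le_pow_left₀ (by linarith) (by linarith) _)
    (domMass_nonneg (fun ν => (hT ν).le) hθ y)

theorem summable_size_pow_mul_nbMass (ht : ∀ ν, 0 < t ν) (hθ : ∀ ν, θ ν ∈ Ioo (0 : ℝ) 1) (d : ℕ) :
    Summable fun y : ι → ℕ => (1 + size y) ^ d * nbMass t θ y := by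
  refine Summable.of_nonneg_of_le (fun y => mul_nonneg (pow_nonneg (by
    linarith [size_nonneg y]) _) (nbMass_nonneg (fun ν => (ht ν).le) hθ y)) (fun y => ?_)
    (summable_size_pow_mul_domMass ht hθ d)
  exact mul_le_mul_of_nonneg_left (nbMass_le_domMass (fun ν => (ht ν).le) (fun _ => le_rfl) hθ y)
    (pow_nonneg (by linarith [size_nonneg y]) _)

/-- Functions of linear growth are summable against `nbMass`. -/
theorem summable_nbMass_mul (ht : ∀ ν, 0 < t ν) (hθ : ∀ ν, θ ν ∈ Ioo (0 : ℝ) 1)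
    {F : (ι → ℕ) → ℝ} {C : ℝ} (hF : ∀ y, |F y| ≤ C * (1 + size y)) :
    Summable fun y => nbMass t θ y * F y := by
  refine Summable.of_norm_bounded ((summable_size_pow_mul_nbMass ht hθ 1).mul_left C) fun y => ?_
  rw [Real.norm_eq_abs, abs_mul, abs_of_nonneg (nbMass_nonneg (fun ν => (ht ν).le) hθ y)]
  calc nbMass t θ y * |F y| ≤ nbMass t θ y * (C * (1 + size y)) :=
        mul_le_mul_of_nonneg_left (hF y) (nbMass_nonneg (fun ν => (ht ν).le) hθ y)
    _ = _ := by ring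

/-- The derivative of `nb t θ y` in `t`. -/
def nbDeriv (t θ : ℝ) (y : ℕ) : ℝ :=
  (risingCoeffDeriv y t + Real.log (1 - θ) * risingCoeff y t) * ((1 - θ) ^ t * θ ^ y)

/-- The partial derivative of `nbMass t θ y` in `t ν`. -/
def nbMassDeriv [DecidableEq ι] (t θ : ι → ℝ) (ν : ι) (y : ι → ℕ) : ℝ :=
  (∏ j ∈ Finset.univ.erase ν, nb (t j) (θ j) (y j)) * nbDeriv (t ν) (θ ν) (y ν)

theorem hasDerivAt_nb (t : ℝ) {θ : ℝ} (hθ : θ ∈ Ioo (0 : ℝ) 1) (y : ℕ) :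
    HasDerivAt (fun t => nb t θ y) (nbDeriv t θ y) t := by
  have h := (hasDerivAt_risingCoeff y t).mul
    (((hasDerivAt_id' t).const_rpow (a := 1 - θ) (by linarith [hθ.2])).mul_const (θ ^ y))
  refine h.congr_deriv ?_
  unfold nbDeriv; ring

theorem hasDerivAt_nbMass [DecidableEq ι] {t : ι → ℝ → ℝ} {t' : ι → ℝ} {τ : ℝ}
    (ht : ∀ ν, HasDerivAt (t ν) (t' ν) τ) (hθ : ∀ ν, θ ν ∈ Ioo (0 : ℝ) 1) (y : ι → ℕ) :
    HasDerivAt (fun τ => nbMass (fun ν => t ν τ) θ y)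
      (∑ ν, t' ν * nbMassDeriv (fun ν => t ν τ) θ ν y) τ := by
  have h := HasDerivAt.fun_finsetProd (u := Finset.univ) (x := τ)
    (f := fun ν τ => nb (t ν τ) (θ ν) (y ν))
    (f' := fun ν => nbDeriv (t ν τ) (θ ν) (y ν) * t' ν)
    fun ν _ => (hasDerivAt_nb (t ν τ) (hθ ν) (y ν)).comp τ (ht ν)
  refine h.congr_deriv (Finset.sum_congr rfl fun ν _ => ?_)
  rw [nbMassDeriv, smul_eq_mul]; ring

/-- Relative to the mass, the derivative is at most y_ν / t_ν + |log(1 - θ_ν)|, and t_ν ≥ r_ν > 0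
makes this uniform along the path at the price of one factor 1 + |y|. -/
theorem abs_nbMassDeriv_le [DecidableEq ι] {r : ι → ℝ} (hr : ∀ ν, 0 < r ν) (hrt : ∀ ν, r ν ≤ t ν)
    (htT : ∀ ν, t ν ≤ T ν) (hθ : ∀ ν, θ ν ∈ Ioo (0 : ℝ) 1) (ν : ι) (y : ι → ℕ) :
    |nbMassDeriv t θ ν y|
      ≤ (1 / r ν + |Real.log (1 - θ ν)|) * ((1 + size y) * domMass T θ y) := by
  have ht : ∀ ν, 0 < t ν := fun ν => (hr ν).trans_le (hrt ν)
  have h1 : |nbDeriv (t ν) (θ ν) (y ν)| ≤ (1 / r ν + |Real.log (1 - θ ν)|) * (1 + size y)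
      * (risingCoeff (y ν) (T ν) * θ ν ^ y ν) := by
    have e : nbDeriv (t ν) (θ ν) (y ν) = (risingCoeffDeriv (y ν) (t ν)
        + Real.log (1 - θ ν) * risingCoeff (y ν) (t ν)) * ((1 - θ ν) ^ t ν * θ ν ^ y ν) := rfl
    have h2 := risingCoeffDeriv_le (ht ν) (y ν)
    have h3 := risingCoeff_pos (ht ν) (y ν)
    have h4 := nb_le (ht ν).le (htT ν) (hθ ν) (y ν)
    have h5 : 0 ≤ (1 - θ ν) ^ t ν * θ ν ^ y ν :=
      mul_nonneg (Real.rpow_nonneg (by linarith [(hθ ν).2]) _) (pow_nonneg (hθ ν).1.le _)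
    have h6 : |risingCoeffDeriv (y ν) (t ν) + Real.log (1 - θ ν) * risingCoeff (y ν) (t ν)|
        ≤ (1 / r ν + |Real.log (1 - θ ν)|) * (1 + size y) * risingCoeff (y ν) (t ν) := by
      refine (abs_add_le _ _).trans ?_
      rw [abs_of_nonneg (risingCoeffDeriv_nonneg (ht ν).le _), abs_mul, abs_of_pos h3]
      have h7 : (y ν : ℝ) / t ν ≤ 1 / r ν * (1 + size y) := by
        rw [div_eq_inv_mul, ← one_div]
        have := le_size y ν
        have := hr ν
        gcongr
        · exact hrt ν
        · linarith
      have h8 : |Real.log (1 - θ ν)| ≤ |Real.log (1 - θ ν)| * (1 + size y) :=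
        le_mul_of_one_le_right (abs_nonneg _) (by linarith [size_nonneg y])
      have := mul_le_mul_of_nonneg_right (add_le_add h7 h8) h3.le
      linarith
    rw [e, abs_mul, abs_of_nonneg h5]
    calc _ ≤ (1 / r ν + |Real.log (1 - θ ν)|) * (1 + size y) * risingCoeff (y ν) (t ν)
          * ((1 - θ ν) ^ t ν * θ ν ^ y ν) := mul_le_mul_of_nonneg_right h6 h5
      _ = (1 / r ν + |Real.log (1 - θ ν)|) * (1 + size y) * nb (t ν) (θ ν) (y ν) := by
          unfold nb; ring
      _ ≤ _ := by
          have := size_nonneg y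
          have := hr ν
          gcongr
  have h2 : ∏ j ∈ Finset.univ.erase ν, nb (t j) (θ j) (y j)
      ≤ ∏ j ∈ Finset.univ.erase ν, risingCoeff (y j) (T j) * θ j ^ y j :=
    Finset.prod_le_prod (fun j _ => nb_nonneg (ht j).le (hθ j) _)
      fun j _ => nb_le (ht j).le (htT j) (hθ j) _
  have h0 : 0 ≤ ∏ j ∈ Finset.univ.erase ν, nb (t j) (θ j) (y j) :=
    Finset.prod_nonneg fun j _ => nb_nonneg (ht j).le (hθ j) _
  rw [nbMassDeriv, abs_mul, abs_of_nonneg h0]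
  refine (mul_le_mul h2 h1 (abs_nonneg _) (h0.trans h2)).trans (le_of_eq ?_)
  rw [domMass, ← Finset.mul_prod_erase _ _ (Finset.mem_univ ν)]
  ring

theorem nbMass_update [DecidableEq ι] (t θ : ι → ℝ) (y : ι → ℕ) (ν : ι) (k : ℕ) :
    nbMass t θ (Function.update y ν k)
      = (∏ j ∈ Finset.univ.erase ν, nb (t j) (θ j) (y j)) * nb (t ν) (θ ν) k := by
  rw [nbMass, ← Finset.mul_prod_erase _ _ (Finset.mem_univ ν), Function.update_self, mul_comm]
  congr 1
  exact Finset.prod_congr rfl fun j hj => by rw [Function.update_of_ne (Finset.ne_of_mem_erase hj)]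

/-- The compound Poisson form of the derivative of the negative binomial mass function. -/
theorem nbMassDeriv_eq [DecidableEq ι] (t θ : ι → ℝ) (ν : ι) (y : ι → ℕ) :
    nbMassDeriv t θ ν y = Real.log (1 - θ ν) * nbMass t θ y
      + ∑ k ∈ Finset.range (y ν), θ ν ^ (k + 1) / ((k : ℝ) + 1)
          * nbMass t θ (Function.update y ν (y ν - 1 - k)) := by
  have h := nbMass_update t θ y ν (y ν)
  rw [Function.update_eq_self] at h
  have e : nbDeriv (t ν) (θ ν) (y ν) = Real.log (1 - θ ν) * nb (t ν) (θ ν) (y ν)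
      + ∑ k ∈ Finset.range (y ν), θ ν ^ (k + 1) / ((k : ℝ) + 1)
          * nb (t ν) (θ ν) (y ν - 1 - k) := by
    rw [nbDeriv, add_mul, add_comm, risingCoeffDeriv, Finset.sum_mul]
    congr 1
    · unfold nb; ring
    · refine Finset.sum_congr rfl fun k hk => ?_
      have hk' : y ν = (k + 1) + (y ν - 1 - k) := by have := Finset.mem_range.1 hk; omega
      have : θ ν ^ y ν = θ ν ^ (k + 1) * θ ν ^ (y ν - 1 - k) := by rw [← pow_add, ← hk']
      rw [this, nb]; ring
  simp_rw [nbMass_update, nbMassDeriv, e, h, mul_add, Finset.mul_sum]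
  congr 1
  · ring
  · exact Finset.sum_congr rfl fun k _ => by ring

/-- The shifted double series has a product majorant. -/
theorem summable_shift [DecidableEq ι] (ht : ∀ ν, 0 < t ν) (hθ : ∀ ν, θ ν ∈ Ioo (0 : ℝ) 1)
    {F : (ι → ℕ) → ℝ} {C : ℝ} (hF : ∀ y, |F y| ≤ C * (1 + size y)) (ν : ι) :
    Summable fun x : ℕ × (ι → ℕ) => θ ν ^ (x.1 + 1) / ((x.1 : ℝ) + 1)
      * (nbMass t θ x.2 * F (x.2 + Pi.single ν (x.1 + 1))) := by
  have hC : 0 ≤ C := by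
    have := (abs_nonneg _).trans (hF 0)
    have h0 := size_nonneg (0 : ι → ℕ)
    by_contra h
    nlinarith
  have h1 : Summable fun k : ℕ => θ ν ^ (k + 1) * ((k : ℝ) + 2) := by
    have ha : ‖θ ν‖ < 1 := by rw [Real.norm_of_nonneg (hθ ν).1.le]; exact (hθ ν).2
    have hb := (summable_pow_mul_geometric_of_norm_lt_one 1 ha).add
      ((summable_geometric_of_norm_lt_one ha).mul_left 2)
    refine (hb.mul_left (θ ν)).congr fun k => ?_
    ring
  have h2 := (summable_size_pow_mul_nbMass ht hθ 1).mul_left C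
  have h3 := h1.mul_of_nonneg h2 (fun k => by have := (hθ ν).1; positivity) fun y => by
    have := nbMass_nonneg (fun ν => (ht ν).le) hθ y
    have := size_nonneg y
    positivity
  refine Summable.of_norm_bounded h3 fun x => ?_
  have hm := nbMass_nonneg (fun ν => (ht ν).le) hθ x.2
  have hs := size_nonneg x.2
  have hp := (hθ ν).1
  rw [norm_mul, norm_mul, Real.norm_of_nonneg (by positivity), Real.norm_of_nonneg hm,
    Real.norm_eq_abs]
  have h4 := hF (x.2 + Pi.single ν (x.1 + 1))
  rw [size_add, size_single] at h4
  push_cast at h4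
  have h5 : θ ν ^ (x.1 + 1) / ((x.1 : ℝ) + 1) ≤ θ ν ^ (x.1 + 1) :=
    div_le_self (by positivity) (by linarith [x.1.cast_nonneg (α := ℝ)])
  have h6 : 1 + (size x.2 + ((x.1 : ℝ) + 1)) ≤ ((x.1 : ℝ) + 2) * (1 + size x.2) := by
    nlinarith [x.1.cast_nonneg (α := ℝ)]
  calc _ ≤ θ ν ^ (x.1 + 1) * (nbMass t θ x.2 * (C * (((x.1 : ℝ) + 2) * (1 + size x.2)))) := by
        gcongr
        exact h4.trans (by gcongr)
    _ = _ := by ring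

theorem hasSum_log_one_sub {x : ℝ} (hx : x ∈ Ioo (0 : ℝ) 1) :
    HasSum (fun k : ℕ => x ^ (k + 1) / ((k : ℝ) + 1)) (-Real.log (1 - x)) :=
  Real.hasSum_pow_div_log_of_abs_lt_one (by rw [abs_of_pos hx.1]; exact hx.2)

theorem abs_shift_le [DecidableEq ι] {F : (ι → ℕ) → ℝ} {C : ℝ} (hF : ∀ y, |F y| ≤ C * (1 + size y))
    (ν : ι) (k : ℕ) (y : ι → ℕ) :
    |F (y + Pi.single ν k)| ≤ C * (1 + k) * (1 + size y) := by
  have hC : 0 ≤ C := by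
    have := (abs_nonneg _).trans (hF 0)
    have h0 := size_nonneg (0 : ι → ℕ)
    by_contra h
    nlinarith
  have h := hF (y + Pi.single ν k)
  rw [size_add, size_single] at h
  refine h.trans ?_
  have := size_nonneg y
  have : 1 + (size y + (k : ℝ)) ≤ (1 + k) * (1 + size y) := by
    nlinarith [k.cast_nonneg (α := ℝ)]
  rw [mul_assoc]
  gcongr

/-- The negative binomial process is compound Poisson with jump rates θ^k / k and total rate -log(1
- θ), and the right-hand side is its generator applied to F. The proof sums `nbMassDeriv_eq` against
F, interchanges the sums over jump and end point, and reindexes by the point before the jump. -/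
theorem hasSum_nbMassDeriv_mul [DecidableEq ι] (ht : ∀ ν, 0 < t ν)
    (hθ : ∀ ν, θ ν ∈ Ioo (0 : ℝ) 1) {F : (ι → ℕ) → ℝ} {C : ℝ}
    (hF : ∀ y, |F y| ≤ C * (1 + size y)) (ν : ι) :
    HasSum (fun k : ℕ => θ ν ^ (k + 1) / ((k : ℝ) + 1)
        * ∑' y, nbMass t θ y * (F (y + Pi.single ν (k + 1)) - F y))
      (∑' y, nbMassDeriv t θ ν y * F y) := by
  set g : ℕ × (ι → ℕ) → ℝ := fun x => θ ν ^ (x.1 + 1) / ((x.1 : ℝ) + 1)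
      * (nbMass t θ x.2 * F (x.2 + Pi.single ν (x.1 + 1))) with hg
  have hgs : Summable g := summable_shift ht hθ hF ν
  -- f is indexed by the end point of the jump and g by its starting point; the shift (k, y) ↦ (k, y
  -- + (k + 1) e_ν) is injective, carries g to f, and its range contains the support of f.
  set f : ℕ × (ι → ℕ) → ℝ := fun x => if x.1 < x.2 ν then θ ν ^ (x.1 + 1) / ((x.1 : ℝ) + 1)
      * nbMass t θ (Function.update x.2 ν (x.2 ν - 1 - x.1)) * F x.2 else 0 with hf
  have hinj : ∀ k : ℕ, Function.Injective fun y : ι → ℕ => y + Pi.single ν (k + 1) :=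
    fun k => add_left_injective _
  have hfg : ∀ (k : ℕ) (y : ι → ℕ), f (k, y + Pi.single ν (k + 1)) = g (k, y) := by
    intro k y
    have h1 : k < (y + Pi.single ν (k + 1) : ι → ℕ) ν := by simp; omega
    have h2 : Function.update (y + Pi.single ν (k + 1) : ι → ℕ) ν
        ((y + Pi.single ν (k + 1) : ι → ℕ) ν - 1 - k) = y := by
      ext j
      by_cases hj : j = ν
      · subst hj; simp
      · simp [hj]
    simp only [hf, hg]
    rw [if_pos h1, h2]; ring
  have hsupp : ∀ (k : ℕ) (y : ι → ℕ), f (k, y) ≠ 0 →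
      ∃ y' : ι → ℕ, y' + Pi.single ν (k + 1) = y := by
    intro k y h
    have hk : k < y ν := by
      by_contra hk
      exact h (if_neg hk)
    refine ⟨Function.update y ν (y ν - 1 - k), ?_⟩
    ext j
    by_cases hj : j = ν
    · subst hj; simp; omega
    · simp [hj]
  have hfs : Summable f := by
    have hinj2 : Function.Injective
        fun x : ℕ × (ι → ℕ) => (x.1, x.2 + Pi.single ν (x.1 + 1)) := by
      rintro ⟨k, y⟩ ⟨k', y'⟩ h
      simp only [Prod.mk.injEq] at h
      obtain ⟨rfl, h⟩ := h
      rw [hinj k h]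
    refine (hinj2.summable_iff ?_).1 (hgs.congr fun x => ?_)
    · rintro ⟨k, y⟩ h
      by_contra h0
      obtain ⟨y', hy'⟩ := hsupp k y h0
      exact h ⟨(k, y'), by simp [hy']⟩
    · exact (hfg x.1 x.2).symm
  have hk : ∀ k, ∑' y, f (k, y) = θ ν ^ (k + 1) / ((k : ℝ) + 1)
      * ∑' y, nbMass t θ y * F (y + Pi.single ν (k + 1)) := by
    intro k
    rw [← tsum_mul_left, ← (hinj k).tsum_eq (f := fun y => f (k, y))]
    · exact tsum_congr fun y => hfg k y
    · intro y h
      exact hsupp k y h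
  have hy : ∀ y, ∑' k, f (k, y) = nbMassDeriv t θ ν y * F y
      - Real.log (1 - θ ν) * (nbMass t θ y * F y) := by
    intro y
    rw [nbMassDeriv_eq, tsum_eq_sum (s := Finset.range (y ν))]
    · rw [add_mul, Finset.sum_mul]
      have : ∑ k ∈ Finset.range (y ν), f (k, y) = ∑ k ∈ Finset.range (y ν),
          θ ν ^ (k + 1) / ((k : ℝ) + 1) * nbMass t θ (Function.update y ν (y ν - 1 - k)) * F y :=
        Finset.sum_congr rfl fun k hk => if_pos (Finset.mem_range.1 hk)
      rw [this]; ring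
    · intro k hk
      exact if_neg fun h => hk (Finset.mem_range.2 h)
  have hsum0 : Summable fun y => nbMass t θ y * F y := summable_nbMass_mul ht hθ hF
  have hfs' : Summable fun x : (ι → ℕ) × ℕ => f (x.2, x.1) :=
    hfs.comp_injective Prod.swap_injective
  have hDs : Summable fun y => nbMassDeriv t θ ν y * F y := by
    have := hfs'.prod.add (hsum0.mul_left (Real.log (1 - θ ν)))
    refine this.congr fun y => ?_
    rw [hy]; ring
  have hcomm : ∑' y, ∑' k, f (k, y) = ∑' k, ∑' y, f (k, y) :=
    Summable.tsum_comm (f := fun k y => f (k, y)) hfs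
  simp_rw [hy] at hcomm
  rw [hDs.tsum_sub (hsum0.mul_left _), tsum_mul_left] at hcomm
  have h1 : HasSum (fun k => ∑' y, f (k, y)) (∑' k, ∑' y, f (k, y)) := hfs.prod.hasSum
  -- The diagonal term of the generator: the coefficient log(1 - θ_ν) is itself expanded over jump
  -- sizes, pairing F(y) with each F(y + (k + 1) e_ν).
  have h2 := (hasSum_log_one_sub (hθ ν)).mul_right (∑' y, nbMass t θ y * F y)
  have h3 := h1.sub h2
  rw [← hcomm] at h3
  convert! h3 using 1
  · ext k
    have hs1 : Summable fun y => nbMass t θ y * F (y + Pi.single ν (k + 1)) :=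
      summable_nbMass_mul ht hθ fun y => abs_shift_le hF ν (k + 1) y
    rw [hk, ← mul_sub, ← hs1.tsum_sub hsum0]
    simp_rw [mul_sub]
  · ring

theorem summable_abs_nbMassDeriv_mul [DecidableEq ι] (ht : ∀ ν, 0 < t ν)
    (hθ : ∀ ν, θ ν ∈ Ioo (0 : ℝ) 1) {F : (ι → ℕ) → ℝ} {C : ℝ}
    (hF : ∀ y, |F y| ≤ C * (1 + size y)) (ν : ι) :
    Summable fun y => nbMassDeriv t θ ν y * F y := by
  refine Summable.of_norm_bounded (((summable_size_pow_mul_domMass ht hθ 2).mul_left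
    ((1 / t ν + |Real.log (1 - θ ν)|) * C))) fun y => ?_
  rw [norm_mul, Real.norm_eq_abs, Real.norm_eq_abs]
  have h1 := abs_nbMassDeriv_le ht (fun _ => le_rfl) (fun _ => le_rfl) hθ ν y (T := t)
  refine (mul_le_mul h1 (hF y) (abs_nonneg _) ((abs_nonneg _).trans h1)).trans (le_of_eq ?_)
  ring

end

/-! ### Moments: growth bounds and the logarithmic integral -/

section

/-- As f > 0 almost everywhere, f ≥ ε on some non-null set, where g has positive integral c₀; hence
the integral of h is at least ε^n c₀. The constant c = min(ε, c₀, 1) does not depend on n, so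
logarithms of such integrals are bounded below linearly in n. -/
theorem exists_pow_le_integral {α : Type*} [MeasurableSpace α] {μ : Measure α} (hμ : μ ≠ 0)
    {f g : α → ℝ} (hf : Measurable f) (hf0 : ∀ᵐ q ∂μ, 0 < f q) (hg : Integrable g μ)
    (hg0 : ∀ᵐ q ∂μ, 0 < g q) :
    ∃ c ∈ Ioc (0 : ℝ) 1, ∀ (n : ℕ) (h : α → ℝ), Integrable h μ →
      (∀ᵐ q ∂μ, f q ^ n * g q ≤ h q) → c ^ (n + 1) ≤ ∫ q, h q ∂μ := by
  obtain ⟨N, hN⟩ : ∃ N : ℕ, μ {q | 1 / ((N : ℝ) + 1) ≤ f q} ≠ 0 := by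
    by_contra! hcon
    have h0 := (measure_iUnion_null_iff (μ := μ)).2 hcon
    have : ∀ᵐ q ∂μ, False := by
      filter_upwards [hf0, measure_eq_zero_iff_ae_notMem.1 h0] with q hq hq'
      obtain ⟨N, hN⟩ := exists_nat_one_div_lt hq
      exact hq' (mem_iUnion.2 ⟨N, hN.le⟩)
    exact hμ (ae_eq_bot.1 (eventually_false_iff_eq_bot.1 this))
  set ε : ℝ := 1 / ((N : ℝ) + 1) with hε
  have hε0 : 0 < ε := by positivity
  have hS : MeasurableSet {q | ε ≤ f q} := measurableSet_le measurable_const hf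
  have hc0 : 0 < ∫ q in {q | ε ≤ f q}, g q ∂μ := by
    rw [setIntegral_pos_iff_support_of_nonneg_ae (ae_restrict_of_ae (hg0.mono fun q h => h.le))
      hg.integrableOn]
    refine lt_of_lt_of_le (pos_iff_ne_zero.2 hN) (measure_mono_ae ?_)
    filter_upwards [hg0] with q hq hqS
    exact ⟨hq.ne', hqS⟩
  set c₀ := ∫ q in {q | ε ≤ f q}, g q ∂μ with hc₀
  refine ⟨min (min ε c₀) 1, ⟨lt_min (lt_min hε0 hc0) one_pos, min_le_right _ _⟩,
    fun n h hh hfg => ?_⟩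
  have hm0 : 0 ≤ min (min ε c₀) 1 := (lt_min (lt_min hε0 hc0) one_pos).le
  calc min (min ε c₀) 1 ^ (n + 1) = min (min ε c₀) 1 ^ n * min (min ε c₀) 1 := pow_succ _ _
    _ ≤ ε ^ n * c₀ := by
        have h1 : min (min ε c₀) 1 ≤ ε := (min_le_left _ _).trans (min_le_left _ _)
        have h2 : min (min ε c₀) 1 ≤ c₀ := (min_le_left _ _).trans (min_le_right _ _)
        gcongr
    _ = ∫ q in {q | ε ≤ f q}, ε ^ n * g q ∂μ := (integral_const_mul _ _).symm
    _ ≤ ∫ q in {q | ε ≤ f q}, h q ∂μ := by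
        refine integral_mono_ae (hg.integrableOn.const_mul _) hh.integrableOn ?_
        filter_upwards [ae_restrict_mem hS, ae_restrict_of_ae hfg, ae_restrict_of_ae hg0]
          with q h1 h2 h3
        refine le_trans ?_ h2
        have : ε ≤ f q := h1
        gcongr
    _ ≤ ∫ q, h q ∂μ := by
        refine setIntegral_le_integral hh ?_
        filter_upwards [hf0, hg0, hfg] with q h1 h2 h3
        exact le_trans (by positivity) h3

theorem abs_log_le_of_pow_le {c x B : ℝ} (hc : c ∈ Ioc (0 : ℝ) 1) {n : ℕ} (hx : c ^ (n + 1) ≤ x)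
    (hB : x ≤ B) : |Real.log x| ≤ (|Real.log B| + |Real.log c|) * (1 + n) := by
  have hx0 : 0 < x := (pow_pos hc.1 _).trans_le hx
  have h1 := Real.log_le_log (pow_pos hc.1 _) hx
  have h2 := Real.log_le_log hx0 hB
  rw [Real.log_pow] at h1
  push_cast at h1
  have h3 := le_abs_self (Real.log B)
  have h4 := neg_abs_le (Real.log c)
  have h5 := abs_nonneg (Real.log B)
  have h6 := abs_nonneg (Real.log c)
  have hn := n.cast_nonneg (α := ℝ)
  rw [abs_le]
  constructor <;> nlinarith

variable {ι : Type} [Fintype ι]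

theorem kern_eq (t : ι → ℝ) (y : ι → ℕ) (s : ι → ℝ) :
    kern t y s = kern t 0 s * ∏ ν, s ν ^ y ν := by
  simp [kern, Finset.prod_mul_distrib]

theorem kern_zero_anti {t T : ι → ℝ} (h : ∀ ν, t ν ≤ T ν) {s : ι → ℝ}
    (hs : ∀ ν, s ν ∈ Ioo (0 : ℝ) 1) : kern T 0 s ≤ kern t 0 s := by
  simp only [kern, Pi.zero_apply, pow_zero, mul_one]
  refine Finset.prod_le_prod (fun ν _ => Real.rpow_nonneg (by linarith [(hs ν).2]) _) fun ν _ => ?_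
  exact Real.rpow_le_rpow_of_exponent_ge (by linarith [(hs ν).2]) (by linarith [(hs ν).1]) (h ν)

theorem kern_le_kern_zero {t T : ι → ℝ} (h : ∀ ν, t ν ≤ T ν) (y : ι → ℕ) {s : ι → ℝ}
    (hs : ∀ ν, s ν ∈ Ioo (0 : ℝ) 1) : kern T y s ≤ kern t 0 s := by
  rw [kern_eq]
  refine (mul_le_of_le_one_right (kern_pos _ _ hs).le ?_).trans (kern_zero_anti h hs)
  exact Finset.prod_le_one (fun ν _ => pow_nonneg (hs ν).1.le _)
    fun ν _ => pow_le_one₀ (hs ν).1.le (hs ν).2.le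

theorem kern_add_single [DecidableEq ι] (t : ι → ℝ) (y : ι → ℕ) (ν : ι) (k : ℕ) (s : ι → ℝ) :
    kern t (y + Pi.single ν k) s = kern t y s * s ν ^ k := by
  rw [kern_eq, kern_eq t y, mul_assoc]
  congr 1
  simp_rw [Pi.add_apply, pow_add, Finset.prod_mul_distrib]
  congr 1
  rw [Finset.prod_eq_single ν] <;> simp +contextual

/-- Since ∏ s is below each s_ν, one function raised to the total degree bounds every monomial,
which is the form `exists_pow_le_integral` requires. -/
theorem prod_pow_le {s : ι → ℝ} (hs : ∀ ν, s ν ∈ Ioo (0 : ℝ) 1) (y : ι → ℕ) :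
    (∏ ν, s ν) ^ (∑ ν, y ν) ≤ ∏ ν, s ν ^ y ν := by
  rw [← Finset.prod_pow_eq_pow_sum]
  refine Finset.prod_le_prod (fun ν _ => pow_nonneg
    (Finset.prod_nonneg fun j _ => (hs j).1.le) _) fun ν _ => ?_
  refine pow_le_pow_left₀ (Finset.prod_nonneg fun j _ => (hs j).1.le) ?_ _
  classical
  rw [← Finset.mul_prod_erase _ _ (Finset.mem_univ ν)]
  exact mul_le_of_le_one_right (hs ν).1.le
    (Finset.prod_le_one (fun j _ => (hs j).1.le) fun j _ => (hs j).2.le)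

theorem kern_eq_exp (t : ι → ℝ) (y : ι → ℕ) {s : ι → ℝ} (hs : ∀ ν, s ν ∈ Ioo (0 : ℝ) 1) :
    kern t y s = Real.exp (∑ ν, Real.log (1 - s ν) * t ν) * ∏ ν, s ν ^ y ν := by
  rw [kern_eq, Real.exp_sum]
  congr 1
  simp only [kern, Pi.zero_apply, pow_zero, mul_one]
  exact Finset.prod_congr rfl fun ν _ => Real.rpow_def_of_pos (by linarith [(hs ν).2]) _

theorem hasDerivAt_kern {t : ι → ℝ → ℝ} {t' : ι → ℝ} {τ : ℝ}
    (ht : ∀ ν, HasDerivAt (t ν) (t' ν) τ) (y : ι → ℕ) {s : ι → ℝ}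
    (hs : ∀ ν, s ν ∈ Ioo (0 : ℝ) 1) :
    HasDerivAt (fun τ => kern (fun ν => t ν τ) y s)
      (-∑ ν, t' ν * (-Real.log (1 - s ν) * kern (fun ν => t ν τ) y s)) τ := by
  simp_rw [kern_eq_exp _ y hs]
  have h := ((HasDerivAt.fun_sum fun ν (_ : ν ∈ Finset.univ) =>
    (ht ν).const_mul (Real.log (1 - s ν))).exp).mul_const (∏ ν, s ν ^ y ν)
  refine h.congr_deriv ?_
  rw [Finset.mul_sum, Finset.sum_mul, ← Finset.sum_neg_distrib]
  exact Finset.sum_congr rfl fun ν _ => by ring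

variable {α : Type*} [MeasurableSpace α] {μ : Measure α} {σ : α → ι → ℝ} {r A : ι → ℝ} {δ : ℝ}

/-- Conditions on a measure with variables `σ_ν ∈ (0, 1)` under which the moments
`∫ ∏_ν (1 - σ_ν) ^ t_ν σ_ν ^ y_ν` are controlled for all `t ≥ r`. -/
structure MomentData (μ : Measure α) (σ : α → ι → ℝ) (r A : ι → ℝ) (δ : ℝ) : Prop where
  meas : Measurable σ
  mem : ∀ᵐ q ∂μ, ∀ ν, σ q ν ∈ Ioo (0 : ℝ) 1
  ne : μ ≠ 0
  int : Integrable (fun q => kern r 0 (σ q)) μ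
  pos : 0 < δ
  nonneg : ∀ ν, 0 ≤ A ν
  gap : ∀ t : ι → ℝ, (∀ ν, r ν ≤ t ν) → ∀ (y : ι → ℕ) (ν : ι),
    δ / (A ν + y ν + δ) * ∫ q, kern t y (σ q) ∂μ ≤ ∫ q, (1 - σ q ν) * kern t y (σ q) ∂μ

/-- The moment `∫ ∏_ν (1 - σ_ν) ^ t_ν σ_ν ^ y_ν dμ`. -/
def moment (μ : Measure α) (σ : α → ι → ℝ) (t : ι → ℝ) (y : ι → ℕ) : ℝ :=
  ∫ q, kern t y (σ q) ∂μ

namespace MomentData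

variable (h : MomentData μ σ r A δ) {t T : ι → ℝ} (ht : ∀ ν, r ν ≤ t ν)
include h ht

theorem integrable_kern (y : ι → ℕ) : Integrable (fun q => kern t y (σ q)) μ := by
  refine h.int.mono' ((measurable_kern t y).comp h.meas).aestronglyMeasurable ?_
  filter_upwards [h.mem] with q hq
  rw [Real.norm_of_nonneg (kern_pos _ _ hq).le]
  exact kern_le_kern_zero ht y hq

theorem moment_pos (y : ι → ℕ) : 0 < moment μ σ t y := by
  rw [moment, integral_pos_iff_support_of_nonneg_ae
    (h.mem.mono fun q hq => (kern_pos t y hq).le) (h.integrable_kern ht y)]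
  refine lt_of_lt_of_le (pos_iff_ne_zero.2 fun h0 => h.ne (Measure.measure_univ_eq_zero.1 h0))
    (measure_mono_ae ?_)
  filter_upwards [h.mem] with _ hq _
  exact (kern_pos t y hq).ne'

theorem moment_le (y : ι → ℕ) : moment μ σ t y ≤ moment μ σ r 0 :=
  integral_mono_ae (h.integrable_kern ht y) h.int
    (h.mem.mono fun _ hq => kern_le_kern_zero ht y hq)

-- The integrand dominates (∏ σ_ν)^{|y|} times the kernel at T with y = 0, which gives an
-- exponential lower bound uniform in t ≤ T; from above, Φ_t(y) ≤ Φ_r(0).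
omit ht in
theorem exists_abs_log_moment_le (hrT : ∀ ν, r ν ≤ T ν) :
    ∃ C : ℝ, ∀ t : ι → ℝ, (∀ ν, r ν ≤ t ν) → (∀ ν, t ν ≤ T ν) → ∀ y,
      |Real.log (moment μ σ t y)| ≤ C * (1 + size y) := by
  have hm := h.meas
  obtain ⟨c, hc, hcn⟩ := exists_pow_le_integral h.ne (f := fun q => ∏ ν, σ q ν)
    (g := fun q => kern T 0 (σ q)) (by fun_prop)
    (h.mem.mono fun q hq => Finset.prod_pos fun ν _ => (hq ν).1)
    (h.integrable_kern hrT 0) (h.mem.mono fun q hq => kern_pos T 0 hq)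
  refine ⟨|Real.log (moment μ σ r 0)| + |Real.log c|, fun t ht htT y => ?_⟩
  have h1 := hcn (∑ ν, y ν) _ (h.integrable_kern ht y) (by
    filter_upwards [h.mem] with q hq
    rw [kern_eq t y, mul_comm]
    have h1 := kern_zero_anti htT hq
    have h2 := prod_pow_le hq y
    exact mul_le_mul h1 h2 (pow_nonneg (Finset.prod_nonneg fun ν _ => (hq ν).1.le) _)
      (kern_pos t 0 hq).le)
  have h2 := abs_log_le_of_pow_le hc h1 (h.moment_le ht y)
  rw [Nat.cast_sum] at h2
  exact h2

variable [DecidableEq ι]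

theorem moment_sub_shift (y : ι → ℕ) (ν : ι) :
    δ / (A ν + y ν + δ) * moment μ σ t y ≤ moment μ σ t y - moment μ σ t (y + Pi.single ν 1) := by
  refine (h.gap t ht y ν).trans (le_of_eq ?_)
  rw [moment, moment, ← integral_sub (h.integrable_kern ht _) (h.integrable_kern ht _)]
  refine integral_congr_ae (Eventually.of_forall fun q => ?_)
  simp only [kern_add_single]
  ring

/-- By the gap condition at y + (k + 1) e_ν, the next moment drops by at least δ / (A + y + k + 1 +
δ) times the current one. Since A + y + k + 1 + δ ≤ (k + 1)(1 + A + y + δ), the term with weight 1 /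
(k + 1) is at most a fixed multiple of that drop, and the drops telescope. -/
theorem sum_range_moment_le (y : ι → ℕ) (ν : ι) (n : ℕ) :
    ∑ k ∈ Finset.range n, 1 / ((k : ℝ) + 1) * moment μ σ t (y + Pi.single ν (k + 1))
      ≤ (1 + A ν + y ν + δ) / δ *
        (moment μ σ t (y + Pi.single ν 1) - moment μ σ t (y + Pi.single ν (n + 1))) := by
  induction n with
  | zero => simp
  | succ n ih =>
    have hδ := h.pos
    have hA := h.nonneg ν
    have h1 := h.moment_sub_shift ht (y + Pi.single ν (n + 1)) ν
    rw [add_assoc y, ← Pi.single_add] at h1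
    have h2 := h.moment_pos ht (y + Pi.single ν (n + 1))
    have h3 : 1 / ((n : ℝ) + 1) * moment μ σ t (y + Pi.single ν (n + 1))
        ≤ (1 + A ν + y ν + δ) / δ * (δ / (A ν + (y ν + (n + 1)) + δ) *
          moment μ σ t (y + Pi.single ν (n + 1))) := by
      rw [← mul_assoc]
      gcongr
      rw [div_mul_div_cancel₀ hδ.ne', div_le_div_iff₀ (by positivity) (by positivity)]
      have hn := n.cast_nonneg (α := ℝ)
      have hy := (y ν).cast_nonneg (α := ℝ)
      nlinarith [mul_nonneg hn hA, mul_nonneg hn hy, mul_nonneg hn hδ.le]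
    simp only [Pi.add_apply, Pi.single_eq_same, Nat.cast_add, Nat.cast_one] at h1
    have h4 := mul_le_mul_of_nonneg_left h1
      (show 0 ≤ (1 + A ν + y ν + δ) / δ by positivity)
    rw [Finset.sum_range_succ]
    linarith

theorem summable_moment_shift (y : ι → ℕ) (ν : ι) :
    Summable fun k : ℕ => 1 / ((k : ℝ) + 1) * moment μ σ t (y + Pi.single ν (k + 1)) := by
  refine summable_of_sum_range_le (fun k => mul_nonneg (by positivity) (h.moment_pos ht _).le)
    fun n => (h.sum_range_moment_le ht y ν n).trans
      (b := _) (c := (1 + A ν + y ν + δ) / δ * moment μ σ t (y + Pi.single ν 1)) ?_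
  have hδ := h.pos
  have hA := h.nonneg ν
  have := (h.moment_pos ht (y + Pi.single ν (n + 1))).le
  gcongr
  linarith

/-- Dividing by Φ_t(y), this bounds the posterior mean of -log(1 - σ_ν) by an affine function of
y_ν. -/
theorem tsum_moment_shift_le (y : ι → ℕ) (ν : ι) :
    ∑' k : ℕ, 1 / ((k : ℝ) + 1) * moment μ σ t (y + Pi.single ν (k + 1))
      ≤ (1 + A ν + y ν + δ) / δ * moment μ σ t y := by
  refine Real.tsum_le_of_sum_range_le
    (fun k => mul_nonneg (by positivity) (h.moment_pos ht _).le) fun n => ?_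
  refine (h.sum_range_moment_le ht y ν n).trans ?_
  have hδ := h.pos
  have hA := h.nonneg ν
  have h1 := (h.moment_pos ht (y + Pi.single ν (n + 1))).le
  have h2 := h.moment_sub_shift ht y ν
  have h3 : 0 ≤ δ / (A ν + y ν + δ) * moment μ σ t y :=
    mul_nonneg (by positivity) (h.moment_pos ht _).le
  gcongr
  linarith

/-- Expand -log(1 - σ) = ∑ σ^k / k; the terms are nonnegative and their integrals summable by the
telescoping bound, so Tonelli yields integrability and the sum together. -/
theorem integrable_and_hasSum_log (y : ι → ℕ) (ν : ι) :
    Integrable (fun q => -Real.log (1 - σ q ν) * kern t y (σ q)) μ ∧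
      HasSum (fun k : ℕ => 1 / ((k : ℝ) + 1) * moment μ σ t (y + Pi.single ν (k + 1)))
        (∫ q, -Real.log (1 - σ q ν) * kern t y (σ q) ∂μ) := by
  have hm := h.meas
  set F : ℕ → α → ℝ := fun k q => 1 / ((k : ℝ) + 1) * kern t (y + Pi.single ν (k + 1)) (σ q)
  have hFi : ∀ k, Integrable (F k) μ := fun k => (h.integrable_kern ht _).const_mul _
  have hF0 : ∀ᵐ q ∂μ, ∀ k, 0 ≤ F k q := by
    filter_upwards [h.mem] with q hq k
    exact mul_nonneg (by positivity) (kern_pos _ _ hq).le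
  have hFI : ∀ k, ∫ q, F k q ∂μ = 1 / ((k : ℝ) + 1) * moment μ σ t (y + Pi.single ν (k + 1)) :=
    fun k => integral_const_mul _ _
  have hFS : ∀ᵐ q ∂μ, HasSum (fun k => F k q) (-Real.log (1 - σ q ν) * kern t y (σ q)) := by
    filter_upwards [h.mem] with q hq
    refine ((hasSum_log_one_sub (hq ν)).mul_right (kern t y (σ q))).congr_fun fun k => ?_
    simp only [F, kern_add_single]
    ring
  have hs := h.summable_moment_shift ht y ν
  have hN : ∀ k, ∫ q, ‖F k q‖ ∂μ = ∫ q, F k q ∂μ := fun k => integral_congr_ae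
    (hF0.mono fun q hq => Real.norm_of_nonneg (hq k))
  constructor
  · refine ⟨by fun_prop, ?_⟩
    rw [hasFiniteIntegral_iff_norm]
    have e1 : ∫⁻ q, ENNReal.ofReal ‖-Real.log (1 - σ q ν) * kern t y (σ q)‖ ∂μ
        = ∫⁻ q, ∑' k, ENNReal.ofReal (F k q) ∂μ := by
      refine lintegral_congr_ae ?_
      filter_upwards [hFS, hF0] with q hq hq0
      rw [← hq.tsum_eq, Real.norm_of_nonneg (tsum_nonneg hq0),
        ENNReal.ofReal_tsum_of_nonneg hq0 hq.summable]
    rw [e1, lintegral_tsum fun k => by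
      have : Measurable (F k) := by fun_prop
      fun_prop]
    have e2 : ∀ k, ∫⁻ q, ENNReal.ofReal (F k q) ∂μ
        = ENNReal.ofReal (1 / ((k : ℝ) + 1) * moment μ σ t (y + Pi.single ν (k + 1))) := fun k => by
      rw [← hFI, ofReal_integral_eq_lintegral_ofReal (hFi k) (hF0.mono fun q hq => hq k)]
    simp_rw [e2]
    rw [← ENNReal.ofReal_tsum_of_nonneg
      (fun k => mul_nonneg (by positivity) (h.moment_pos ht _).le) hs]
    exact ENNReal.ofReal_lt_top
  · have h1 := hasSum_integral_of_summable_integral_norm hFi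
      (by simp_rw [hN, hFI]; exact hs)
    simp_rw [hFI] at h1
    rw [integral_congr_ae (hFS.mono fun q hq => hq.tsum_eq)] at h1
    exact h1

end MomentData

end

/-! ### The expected log moment along a path of size parameters -/

section

variable {ι : Type} [Fintype ι]
variable {α : Type*} [MeasurableSpace α] {μ : Measure α} {σ : α → ι → ℝ} {r A : ι → ℝ} {δ : ℝ}

/-- A path of size parameters in `[r, T]` over `[0, 1]`, with bounded derivative `t'`. -/
structure SizePath (t t' : ι → ℝ → ℝ) (r T : ι → ℝ) (B : ℝ) : Prop where
  cont : ∀ ν, ContinuousOn (t ν) (Icc 0 1)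
  ge : ∀ τ ∈ Icc (0 : ℝ) 1, ∀ ν, r ν ≤ t ν τ
  le : ∀ τ ∈ Icc (0 : ℝ) 1, ∀ ν, t ν τ ≤ T ν
  deriv : ∀ τ ∈ Ioo (0 : ℝ) 1, ∀ ν, HasDerivAt (t ν) (t' ν τ) τ
  bound : ∀ τ ∈ Ioo (0 : ℝ) 1, ∀ ν, |t' ν τ| ≤ B

variable [DecidableEq ι]

/-- The ratio `Φ_t(y + k e_ν) / Φ_t(y)` of moments, which is a posterior mean of `σ_ν ^ k`. -/
def momentRatio (μ : Measure α) (σ : α → ι → ℝ) (t : ι → ℝ) (ν : ι) (k : ℕ) (y : ι → ℕ) : ℝ :=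
  moment μ σ t (y + Pi.single ν k) / moment μ σ t y

/-- The series `∑_{k ≥ 1} k⁻¹ Φ_t(y + k e_ν) / Φ_t(y)`. -/
def ratioSeries (μ : Measure α) (σ : α → ι → ℝ) (t : ι → ℝ) (ν : ι) (y : ι → ℕ) : ℝ :=
  ∑' k : ℕ, 1 / ((k : ℝ) + 1) * momentRatio μ σ t ν (k + 1) y

/-- The part of the expected loss that depends on the prior. -/
def lossTerm (μ : Measure α) (σ : α → ι → ℝ) (t θ : ι → ℝ) (ν : ι) (k : ℕ) : ℝ :=
  ∑' y, nbMass t θ y * (momentRatio μ σ t ν k y - θ ν ^ k *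
    (Real.log (moment μ σ t (y + Pi.single ν k)) - Real.log (moment μ σ t y)))

/-- The expectation of the log moment. -/
def expLogMoment (μ : Measure α) (σ : α → ι → ℝ) (t θ : ι → ℝ) : ℝ :=
  ∑' y, nbMass t θ y * Real.log (moment μ σ t y)

namespace MomentData

variable (h : MomentData μ σ r A δ) {t T θ : ι → ℝ} (ht : ∀ ν, r ν ≤ t ν)
include h

section
include ht

theorem momentRatio_pos (ν : ι) (k : ℕ) (y : ι → ℕ) : 0 < momentRatio μ σ t ν k y :=
  div_pos (h.moment_pos ht _) (h.moment_pos ht _)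

theorem momentRatio_le_one (ν : ι) (k : ℕ) (y : ι → ℕ) : momentRatio μ σ t ν k y ≤ 1 := by
  refine div_le_one_of_le₀ ?_ (h.moment_pos ht _).le
  refine integral_mono_ae (h.integrable_kern ht _) (h.integrable_kern ht _) ?_
  filter_upwards [h.mem] with q hq
  rw [kern_add_single]
  exact mul_le_of_le_one_right (kern_pos _ _ hq).le (pow_le_one₀ (hq ν).1.le (hq ν).2.le)

theorem hasSum_ratioSeries (ν : ι) (y : ι → ℕ) :
    HasSum (fun k : ℕ => 1 / ((k : ℝ) + 1) * momentRatio μ σ t ν (k + 1) y)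
      (ratioSeries μ σ t ν y) := by
  refine Summable.hasSum ?_
  refine ((h.summable_moment_shift ht y ν).div_const (moment μ σ t y)).congr fun k => ?_
  rw [momentRatio, mul_div_assoc]

/-- Differentiating the kernel in t_ν brings down log(1 - σ_ν); this converts the result into the
ratio series occurring in the losses. -/
theorem integral_log_eq (ν : ι) (y : ι → ℕ) :
    ∫ q, -Real.log (1 - σ q ν) * kern t y (σ q) ∂μ
      = ratioSeries μ σ t ν y * moment μ σ t y := by
  rw [← (h.integrable_and_hasSum_log ht y ν).2.tsum_eq, ratioSeries, ← tsum_mul_right]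
  refine tsum_congr fun k => ?_
  rw [momentRatio, mul_assoc, div_mul_cancel₀ _ (h.moment_pos ht y).ne']

theorem ratioSeries_nonneg (ν : ι) (y : ι → ℕ) : 0 ≤ ratioSeries μ σ t ν y :=
  tsum_nonneg fun k => mul_nonneg (by positivity) (h.momentRatio_pos ht ν _ y).le

theorem ratioSeries_le (ν : ι) (y : ι → ℕ) :
    ratioSeries μ σ t ν y ≤ (1 + A ν + δ) / δ * (1 + size y) := by
  have h1 : ratioSeries μ σ t ν y ≤ (1 + A ν + y ν + δ) / δ := by
    refine le_of_mul_le_mul_right ?_ (h.moment_pos ht y)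
    rw [← h.integral_log_eq ht, ← (h.integrable_and_hasSum_log ht y ν).2.tsum_eq]
    exact h.tsum_moment_shift_le ht y ν
  refine h1.trans ?_
  have hδ := h.pos
  have hA := h.nonneg ν
  have hy := le_size y ν
  have hs := size_nonneg y
  rw [div_mul_eq_mul_div]
  gcongr
  nlinarith [mul_nonneg hA hs, mul_nonneg hδ.le hs]

theorem abs_ratioSeries_le (ν : ι) (y : ι → ℕ) :
    |ratioSeries μ σ t ν y| ≤ (1 + A ν + δ) / δ * (1 + size y) := by
  rw [abs_of_nonneg (h.ratioSeries_nonneg ht ν y)]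
  exact h.ratioSeries_le ht ν y

theorem summable_nbMass_mul_momentRatio (hr : ∀ ν, 0 < r ν) (hθ : ∀ ν, θ ν ∈ Ioo (0 : ℝ) 1)
    (ν : ι) (k : ℕ) : Summable fun y => nbMass t θ y * momentRatio μ σ t ν k y := by
  refine summable_nbMass_mul (fun ν => (hr ν).trans_le (ht ν)) hθ (C := 1) fun y => ?_
  rw [abs_of_pos (h.momentRatio_pos ht ν k y)]
  linarith [h.momentRatio_le_one ht ν k y, size_nonneg y]

/-- The term E[d_k - θ^k log d_k] has two sources: the d_k sum to the expected ratio series, and the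
logarithmic increments weighted by θ^k / k form the compound Poisson generator applied to log Φ_t.
The limit is the negative partial derivative of E log Φ_t in t_ν. -/
theorem hasSum_lossTerm (hr : ∀ ν, 0 < r ν) (hθ : ∀ ν, θ ν ∈ Ioo (0 : ℝ) 1) (ν : ι) :
    HasSum (fun k : ℕ => 1 / ((k : ℝ) + 1) * lossTerm μ σ t θ ν (k + 1))
      (∑' y, nbMass t θ y * ratioSeries μ σ t ν y
        - ∑' y, nbMassDeriv t θ ν y * Real.log (moment μ σ t y)) := by
  have ht0 : ∀ ν, 0 < t ν := fun ν => (hr ν).trans_le (ht ν)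
  obtain ⟨C, hC⟩ := h.exists_abs_log_moment_le ht
  have hL := fun y => hC t ht (fun _ => le_rfl) y
  have h1 := hasSum_nbMassDeriv_mul ht0 hθ hL ν
  set f : (ι → ℕ) × ℕ → ℝ := fun x =>
    nbMass t θ x.1 * (1 / ((x.2 : ℝ) + 1) * momentRatio μ σ t ν (x.2 + 1) x.1) with hf
  have hfs : Summable f := by
    have hf0 : 0 ≤ f := fun x => by
      have h2 := nbMass_nonneg (fun ν => (ht0 ν).le) hθ x.1
      have h3 := (h.momentRatio_pos ht ν (x.2 + 1) x.1).le
      simp only [hf, Pi.zero_apply]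
      positivity
    refine (summable_prod_of_nonneg hf0).2 ⟨fun y => ?_, ?_⟩
    · exact (h.hasSum_ratioSeries ht ν y).summable.mul_left (nbMass t θ y)
    simp only [hf, tsum_mul_left]
    exact summable_nbMass_mul ht0 hθ (h.abs_ratioSeries_le ht ν)
  have h2 : HasSum (fun k : ℕ => ∑' y, f (y, k)) (∑' y, nbMass t θ y * ratioSeries μ σ t ν y) := by
    have h3 := hfs.prod_symm.prod.hasSum
    have h4 : ∑' k, ∑' y, f (y, k) = ∑' y, ∑' k, f (y, k) :=
      Summable.tsum_comm (f := fun y k => f (y, k)) hfs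
    simp only [Prod.swap_prod_mk] at h3
    rw [h4] at h3
    simp only [hf, tsum_mul_left] at h3 ⊢
    exact h3
  refine (h2.sub h1).congr_fun fun k => ?_
  have hs1 := h.summable_nbMass_mul_momentRatio ht hr hθ ν (k + 1)
  have hs2 : Summable fun y => nbMass t θ y *
      (Real.log (moment μ σ t (y + Pi.single ν (k + 1))) - Real.log (moment μ σ t y)) := by
    simp_rw [mul_sub]
    exact (summable_nbMass_mul ht0 hθ fun y => abs_shift_le hL ν (k + 1) y).sub
      (summable_nbMass_mul ht0 hθ hL)
  have e1 : ∀ y, f (y, k)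
      = 1 / ((k : ℝ) + 1) * (nbMass t θ y * momentRatio μ σ t ν (k + 1) y) := fun y => by
    simp only [hf]; ring
  have e2 : lossTerm μ σ t θ ν (k + 1) = ∑' y, nbMass t θ y * momentRatio μ σ t ν (k + 1) y
      - θ ν ^ (k + 1) * ∑' y, nbMass t θ y *
        (Real.log (moment μ σ t (y + Pi.single ν (k + 1))) - Real.log (moment μ σ t y)) := by
    rw [lossTerm, ← tsum_mul_left, ← hs1.tsum_sub (hs2.mul_left _)]
    exact tsum_congr fun y => by ring
  simp_rw [e1, e2, tsum_mul_left]
  ring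

end

/-- Uniformity over r ≤ t ≤ T bounds the integrand in τ, hence makes it integrable over the unit
interval. -/
theorem exists_abs_tsum_lossTerm_le (hr : ∀ ν, 0 < r ν) (hrT : ∀ ν, r ν ≤ T ν)
    (hθ : ∀ ν, θ ν ∈ Ioo (0 : ℝ) 1) (ν : ι) :
    ∃ C : ℝ, ∀ t : ι → ℝ, (∀ ν, r ν ≤ t ν) → (∀ ν, t ν ≤ T ν) →
      |∑' k : ℕ, 1 / ((k : ℝ) + 1) * lossTerm μ σ t θ ν (k + 1)| ≤ C := by
  obtain ⟨C, hC⟩ := h.exists_abs_log_moment_le hrT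
  have hT0 : ∀ ν, 0 < T ν := fun ν => (hr ν).trans_le (hrT ν)
  have hs1 := (summable_size_pow_mul_domMass hT0 hθ 1).mul_left ((1 + A ν + δ) / δ)
  have hs2 := (summable_size_pow_mul_domMass hT0 hθ 2).mul_left
    ((1 / r ν + |Real.log (1 - θ ν)|) * C)
  refine ⟨(∑' y, (1 + A ν + δ) / δ * ((1 + size y) ^ 1 * domMass T θ y))
    + ∑' y, (1 / r ν + |Real.log (1 - θ ν)|) * C * ((1 + size y) ^ 2 * domMass T θ y),
    fun t ht htT => ?_⟩
  have ht0 : ∀ ν, 0 < t ν := fun ν => (hr ν).trans_le (ht ν)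
  rw [(h.hasSum_lossTerm ht hr hθ ν).tsum_eq]
  refine (abs_sub _ _).trans (add_le_add ?_ ?_)
  · rw [← Real.norm_eq_abs]
    refine tsum_of_norm_bounded hs1.hasSum fun y => ?_
    have h1 := nbMass_le_domMass (fun ν => (ht0 ν).le) htT hθ y
    have h2 := nbMass_nonneg (fun ν => (ht0 ν).le) hθ y
    rw [norm_mul, Real.norm_of_nonneg h2, Real.norm_eq_abs]
    refine (mul_le_mul h1 (h.abs_ratioSeries_le ht ν y) (abs_nonneg _) (h2.trans h1)).trans
      (le_of_eq ?_)
    ring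
  · rw [← Real.norm_eq_abs]
    refine tsum_of_norm_bounded hs2.hasSum fun y => ?_
    have h1 := abs_nbMassDeriv_le hr ht htT hθ ν y
    rw [norm_mul, Real.norm_eq_abs, Real.norm_eq_abs]
    refine (mul_le_mul h1 (hC t ht htT y) (abs_nonneg _) ((abs_nonneg _).trans h1)).trans
      (le_of_eq ?_)
    ring

section Path

variable {t t' : ι → ℝ → ℝ} {B : ℝ} (hp : SizePath t t' r T B)
include hp

theorem hasDerivAt_log_moment (y : ι → ℕ) {τ : ℝ} (hτ : τ ∈ Ioo (0 : ℝ) 1) :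
    HasDerivAt (fun τ => Real.log (moment μ σ (fun ν => t ν τ) y))
      (-∑ ν, t' ν τ * ratioSeries μ σ (fun ν => t ν τ) ν y) τ := by
  have hge : ∀ τ ∈ Ioo (0 : ℝ) 1, ∀ ν, r ν ≤ t ν τ := fun τ hτ => hp.ge τ (Ioo_subset_Icc_self hτ)
  have hm := h.meas
  have hint := fun ν => (h.integrable_and_hasSum_log (fun _ => le_rfl) 0 ν).1
  have hd := hasDerivAt_integral_of_dominated_loc_of_deriv_le (μ := μ) (Ioo_mem_nhds hτ.1 hτ.2)
    (F := fun τ q => kern (fun ν => t ν τ) y (σ q))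
    (F' := fun τ q => -∑ ν, t' ν τ * (-Real.log (1 - σ q ν) * kern (fun ν => t ν τ) y (σ q)))
    -- The kernel at t ≥ r and any y is below the kernel at r with y = 0, so this majorant is free
    -- of τ; its integrability is the logarithmic integral at t = r, y = 0.
    (bound := fun q => ∑ ν, B * (-Real.log (1 - σ q ν) * kern r 0 (σ q)))
    (Eventually.of_forall fun τ => ((measurable_kern _ y).comp hm).aestronglyMeasurable)
    (h.integrable_kern (hge τ hτ) y)
    (Measurable.aestronglyMeasurable (by fun_prop))
    (by
      filter_upwards [h.mem] with q hq s hs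
      rw [norm_neg]
      refine (norm_sum_le _ _).trans (Finset.sum_le_sum fun ν _ => ?_)
      have h1 : 0 ≤ -Real.log (1 - σ q ν) := by
        have := Real.log_nonpos (x := 1 - σ q ν) (by linarith [(hq ν).2]) (by linarith [(hq ν).1])
        linarith
      have h2 := (kern_pos (fun ν => t ν s) y hq).le
      rw [norm_mul, norm_mul, Real.norm_of_nonneg h1, Real.norm_of_nonneg h2, Real.norm_eq_abs]
      have h3 := kern_le_kern_zero (hge s hs) y hq
      have h4 := hp.bound s hs ν
      have h5 := (abs_nonneg _).trans h4
      gcongr)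
    (integrable_finsetSum _ fun ν _ => (hint ν).const_mul B)
    (by
      filter_upwards [h.mem] with q hq s hs
      exact hasDerivAt_kern (hp.deriv s hs) y hq)
  have hpos := h.moment_pos (hge τ hτ) y
  refine (hd.2.log hpos.ne').congr_deriv ?_
  rw [integral_neg, integral_finsetSum _ fun ν _ =>
    ((h.integrable_and_hasSum_log (hge τ hτ) y ν).1.const_mul _), neg_div, Finset.sum_div]
  congr 1
  refine Finset.sum_congr rfl fun ν _ => ?_
  rw [integral_const_mul, h.integral_log_eq (hge τ hτ), mul_div_assoc,
    mul_div_assoc]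
  change t' ν τ * (_ * (moment μ σ _ y / moment μ σ _ y)) = _
  rw [div_self hpos.ne', mul_one]

omit [DecidableEq ι] in
theorem continuousOn_log_moment (y : ι → ℕ) :
    ContinuousOn (fun τ => Real.log (moment μ σ (fun ν => t ν τ) y)) (Icc 0 1) := by
  refine ContinuousOn.log ?_ fun τ hτ => (h.moment_pos (hp.ge τ hτ) y).ne'
  refine continuousOn_of_dominated
    (fun τ _ => ((measurable_kern _ y).comp h.meas).aestronglyMeasurable)
    (fun τ hτ => ?_) h.int ?_
  · filter_upwards [h.mem] with q hq
    rw [Real.norm_of_nonneg (kern_pos _ y hq).le]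
    exact kern_le_kern_zero (hp.ge τ hτ) y hq
  · filter_upwards [h.mem] with q hq
    simp_rw [kern_eq_exp _ y hq]
    have := hp.cont
    fun_prop

omit [DecidableEq ι] h in
theorem _root_.NegMult.continuousOn_nbMass (hθ : ∀ ν, θ ν ∈ Ioo (0 : ℝ) 1) (y : ι → ℕ) :
    ContinuousOn (fun τ => nbMass (fun ν => t ν τ) θ y) (Icc 0 1) := by
  refine continuousOn_finsetProd _ fun ν _ => ?_
  have : Continuous fun t => nb t (θ ν) (y ν) :=
    continuous_iff_continuousAt.2 fun t => (hasDerivAt_nb t (hθ ν) (y ν)).continuousAt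
  exact this.comp_continuousOn (hp.cont ν)

omit [DecidableEq ι] in
theorem continuousOn_expLogMoment (hr : ∀ ν, 0 < r ν) (hrT : ∀ ν, r ν ≤ T ν)
    (hθ : ∀ ν, θ ν ∈ Ioo (0 : ℝ) 1) :
    ContinuousOn (fun τ => expLogMoment μ σ (fun ν => t ν τ) θ) (Icc 0 1) := by
  obtain ⟨C, hC⟩ := h.exists_abs_log_moment_le hrT
  have hT0 : ∀ ν, 0 < T ν := fun ν => (hr ν).trans_le (hrT ν)
  refine continuousOn_tsum
    (fun y => (continuousOn_nbMass hp hθ y).mul (h.continuousOn_log_moment hp y))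
    ((summable_size_pow_mul_domMass hT0 hθ 1).mul_left C) fun y τ hτ => ?_
  have h2 := nbMass_nonneg (fun ν => ((hr ν).trans_le (hp.ge τ hτ ν)).le) hθ y
  have h1 := nbMass_le_domMass (fun ν => ((hr ν).trans_le (hp.ge τ hτ ν)).le) (hp.le τ hτ) hθ y
  rw [norm_mul, Real.norm_of_nonneg h2, Real.norm_eq_abs]
  refine (mul_le_mul h1 (hC _ (hp.ge τ hτ) (hp.le τ hτ) y) (abs_nonneg _) (h2.trans h1)).trans
    (le_of_eq ?_)
  ring

/-- Termwise differentiation with majorant a multiple of (1 + |y|)² `domMass`: the derivative of the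
mass and the log moment each contribute one linear factor. The derivative of the mass and that of
log Φ_t then combine through `hasSum_lossTerm`. -/
theorem hasDerivAt_expLogMoment (hr : ∀ ν, 0 < r ν) (hrT : ∀ ν, r ν ≤ T ν)
    (hθ : ∀ ν, θ ν ∈ Ioo (0 : ℝ) 1) {τ : ℝ} (hτ : τ ∈ Ioo (0 : ℝ) 1) :
    HasDerivAt (fun τ => expLogMoment μ σ (fun ν => t ν τ) θ)
      (-∑ ν, t' ν τ * ∑' k : ℕ, 1 / ((k : ℝ) + 1) *
        lossTerm μ σ (fun ν => t ν τ) θ ν (k + 1)) τ := by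
  obtain ⟨C, hC⟩ := h.exists_abs_log_moment_le hrT
  have hT0 : ∀ ν, 0 < T ν := fun ν => (hr ν).trans_le (hrT ν)
  have hge : ∀ τ ∈ Ioo (0 : ℝ) 1, ∀ ν, r ν ≤ t ν τ := fun τ hτ => hp.ge τ (Ioo_subset_Icc_self hτ)
  have hle : ∀ τ ∈ Ioo (0 : ℝ) 1, ∀ ν, t ν τ ≤ T ν := fun τ hτ => hp.le τ (Ioo_subset_Icc_self hτ)
  have ht0 : ∀ τ ∈ Ioo (0 : ℝ) 1, ∀ ν, 0 < t ν τ := fun τ hτ ν => (hr ν).trans_le (hge τ hτ ν)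
  set g' : (ι → ℕ) → ℝ → ℝ := fun y τ => ∑ ν, t' ν τ *
    (nbMassDeriv (fun ν => t ν τ) θ ν y * Real.log (moment μ σ (fun ν => t ν τ) y)
      - nbMass (fun ν => t ν τ) θ y * ratioSeries μ σ (fun ν => t ν τ) ν y) with hg'
  set K : ι → ℝ := fun ν => B * ((1 / r ν + |Real.log (1 - θ ν)|) * C + (1 + A ν + δ) / δ) with hK
  have hu := (summable_size_pow_mul_domMass hT0 hθ 2).mul_left (∑ ν, K ν)
  have hd := hasDerivAt_tsum_of_isPreconnected hu isOpen_Ioo (isPreconnected_Ioo (a := (0 : ℝ))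
    (b := 1)) (g := fun y τ => nbMass (fun ν => t ν τ) θ y *
      Real.log (moment μ σ (fun ν => t ν τ) y)) (g' := g') (y₀ := τ) (y := τ)
    (fun y s hs => by
      refine ((hasDerivAt_nbMass (hp.deriv s hs) hθ y).mul
        (h.hasDerivAt_log_moment hp y hs)).congr_deriv ?_
      simp only [hg', Finset.sum_mul, mul_neg, Finset.mul_sum, ← sub_eq_add_neg,
        ← Finset.sum_sub_distrib]
      exact Finset.sum_congr rfl fun ν _ => by ring)
    (fun y s hs => by
      rw [Finset.sum_mul]
      refine (norm_sum_le _ _).trans (Finset.sum_le_sum fun ν _ => ?_)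
      have h1 := abs_nbMassDeriv_le hr (hge s hs) (hle s hs) hθ ν y
      have h2 := hC _ (hge s hs) (hle s hs) y
      have h3 := nbMass_nonneg (fun ν => (ht0 s hs ν).le) hθ y
      have h4 := nbMass_le_domMass (fun ν => (ht0 s hs ν).le) (hle s hs) hθ y
      have h5 := h.abs_ratioSeries_le (hge s hs) ν y
      have h6 := hp.bound s hs ν
      have h7 := domMass_nonneg (fun ν => (hT0 ν).le) hθ y
      have h8 := size_nonneg y
      have hδ := h.pos
      have hA := h.nonneg ν
      rw [norm_mul, Real.norm_eq_abs, Real.norm_eq_abs, hK]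
      have h9 : |nbMassDeriv (fun ν => t ν s) θ ν y * Real.log (moment μ σ (fun ν => t ν s) y)
          - nbMass (fun ν => t ν s) θ y * ratioSeries μ σ (fun ν => t ν s) ν y|
          ≤ ((1 / r ν + |Real.log (1 - θ ν)|) * C + (1 + A ν + δ) / δ)
            * ((1 + size y) ^ 2 * domMass T θ y) := by
        refine (abs_sub _ _).trans ?_
        rw [abs_mul, abs_mul, abs_of_nonneg h3, add_mul]
        refine add_le_add ?_ ?_
        · refine (mul_le_mul h1 h2 (abs_nonneg _) ((abs_nonneg _).trans h1)).trans (le_of_eq ?_)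
          ring
        · refine (mul_le_mul h4 h5 (abs_nonneg _) (h3.trans h4)).trans ?_
          have : (1 + size y) ≤ (1 + size y) ^ 2 := by nlinarith
          calc _ = (1 + A ν + δ) / δ * ((1 + size y) * domMass T θ y) := by ring
            _ ≤ _ := by gcongr
      simp only
      rw [mul_assoc]
      exact mul_le_mul h6 h9 (abs_nonneg _) ((abs_nonneg _).trans h6))
    hτ (summable_nbMass_mul (ht0 τ hτ) hθ (hC _ (hge τ hτ) (hle τ hτ))) hτ
  refine hd.congr_deriv ?_
  refine HasSum.tsum_eq ?_
  rw [← Finset.sum_neg_distrib]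
  refine hasSum_sum fun ν _ => ?_
  rw [← mul_neg]
  refine HasSum.mul_left _ ?_
  rw [(h.hasSum_lossTerm (hge τ hτ) hr hθ ν).tsum_eq, neg_sub]
  refine HasSum.sub ?_ ?_
  · exact (summable_abs_nbMassDeriv_mul (ht0 τ hτ) hθ (hC _ (hge τ hτ) (hle τ hτ)) ν).hasSum
  · exact (summable_nbMass_mul (ht0 τ hτ) hθ (h.abs_ratioSeries_le (hge τ hτ) ν)).hasSum

/-- The change of the expected log moment along a path of size parameters. -/
theorem integral_lossTerm (hr : ∀ ν, 0 < r ν) (hrT : ∀ ν, r ν ≤ T ν)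
    (hθ : ∀ ν, θ ν ∈ Ioo (0 : ℝ) 1) :
    IntervalIntegrable (fun τ => ∑ ν, t' ν τ * ∑' k : ℕ, 1 / ((k : ℝ) + 1) *
        lossTerm μ σ (fun ν => t ν τ) θ ν (k + 1)) volume 0 1 ∧
    ∫ τ in (0 : ℝ)..1, (∑ ν, t' ν τ * ∑' k : ℕ, 1 / ((k : ℝ) + 1) *
        lossTerm μ σ (fun ν => t ν τ) θ ν (k + 1))
      = expLogMoment μ σ (fun ν => t ν 0) θ - expLogMoment μ σ (fun ν => t ν 1) θ := by
  set f : ℝ → ℝ := fun τ => ∑ ν, t' ν τ * ∑' k : ℕ, 1 / ((k : ℝ) + 1) *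
        lossTerm μ σ (fun ν => t ν τ) θ ν (k + 1)
  set G : ℝ → ℝ := fun τ => expLogMoment μ σ (fun ν => t ν τ) θ
  have hG : ∀ τ ∈ Ioo (0 : ℝ) 1, HasDerivAt G (-f τ) τ :=
    fun τ hτ => h.hasDerivAt_expLogMoment hp hr hrT hθ hτ
  choose C hC using h.exists_abs_tsum_lossTerm_le hr hrT hθ
  have hfi : IntervalIntegrable f volume 0 1 := by
    rw [intervalIntegrable_iff_integrableOn_Ioo_of_le zero_le_one]
    -- Measurability of the integrand is inherited from `deriv G`, which is always measurable.
    have hae : f =ᵐ[volume.restrict (Ioo (0 : ℝ) 1)] fun τ => -deriv G τ := by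
      filter_upwards [ae_restrict_mem measurableSet_Ioo] with τ hτ
      rw [(hG τ hτ).deriv, neg_neg]
    refine Integrable.of_bound
      ⟨fun τ => -deriv G τ, (measurable_deriv G).neg.stronglyMeasurable, hae⟩ (∑ ν, B * C ν) ?_
    filter_upwards [ae_restrict_mem measurableSet_Ioo] with τ hτ
    refine (norm_sum_le _ _).trans (Finset.sum_le_sum fun ν _ => ?_)
    have h1 := hC ν _ (hp.ge τ (Ioo_subset_Icc_self hτ)) (hp.le τ (Ioo_subset_Icc_self hτ))
    have h2 := hp.bound τ hτ ν
    rw [norm_mul, Real.norm_eq_abs, Real.norm_eq_abs]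
    exact mul_le_mul h2 h1 (abs_nonneg _) ((abs_nonneg _).trans h2)
  refine ⟨hfi, ?_⟩
  -- Derivatives are available only inside the interval; continuity of G on the closed interval
  -- covers the end points.
  have h1 := intervalIntegral.integral_eq_sub_of_hasDerivAt_of_le zero_le_one
    (h.continuousOn_expLogMoment hp hr hrT hθ) hG hfi.neg
  rw [intervalIntegral.integral_neg] at h1
  rw [← neg_neg (∫ τ in (0 : ℝ)..1, f τ), h1, neg_sub]

end Path

end MomentData

end

/-! ### Discrete laws and block totals -/

section

section Discrete

variable {β β' : Type*} [MeasurableSpace β] [MeasurableSpace β']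

/-- The measure with mass function `w`. -/
def discreteLaw (w : β → ℝ) : Measure β :=
  Measure.sum fun x => ENNReal.ofReal (w x) • Measure.dirac x

theorem lintegral_discreteLaw [MeasurableSingletonClass β] (w : β → ℝ) (f : β → ℝ≥0∞) :
    ∫⁻ x, f x ∂(discreteLaw w) = ∑' x, ENNReal.ofReal (w x) * f x := by
  rw [discreteLaw, lintegral_sum_measure]
  simp

variable [Countable β] [MeasurableSingletonClass β]

omit [Countable β] in
theorem discreteLaw_singleton (w : β → ℝ) (x : β) :
    discreteLaw w {x} = ENNReal.ofReal (w x) := by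
  classical
  rw [← lintegral_indicator_one (measurableSet_singleton x), lintegral_discreteLaw,
    tsum_eq_single x]
  · simp
  · intro y hy; simp [hy]

theorem integrable_discreteLaw {w : β → ℝ} (hw : ∀ x, 0 ≤ w x) {f : β → ℝ}
    (hf : Summable fun x => w x * f x) : Integrable f (discreteLaw w) := by
  refine ⟨(measurable_of_countable f).aestronglyMeasurable, ?_⟩
  rw [hasFiniteIntegral_iff_norm, lintegral_discreteLaw]
  have : ∀ x, ENNReal.ofReal (w x) * ENNReal.ofReal ‖f x‖ = ENNReal.ofReal ‖w x * f x‖ := fun x => by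
    rw [norm_mul, Real.norm_of_nonneg (hw x), ENNReal.ofReal_mul (hw x)]
  simp_rw [this]
  rw [← ENNReal.ofReal_tsum_of_nonneg (fun _ => norm_nonneg _) hf.norm]
  exact ENNReal.ofReal_lt_top

theorem integral_discreteLaw {w : β → ℝ} (hw : ∀ x, 0 ≤ w x) {f : β → ℝ}
    (hf : Summable fun x => w x * f x) : ∫ x, f x ∂(discreteLaw w) = ∑' x, w x * f x := by
  rw [integral_countable (integrable_discreteLaw hw hf)]
  refine tsum_congr fun x => ?_
  rw [Measure.real, discreteLaw_singleton, ENNReal.toReal_ofReal (hw x), smul_eq_mul]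

/-- Finite fibres, supplied as finsets, reduce a pushforward to a finite sum identity for each
target point. -/
theorem map_discreteLaw [Countable β'] [MeasurableSingletonClass β'] {w : β → ℝ} {w' : β' → ℝ}
    (hw : ∀ x, 0 ≤ w x) (g : β → β') (S : β' → Finset β) (hS : ∀ y x, x ∈ S y ↔ g x = y)
    (h : ∀ y, ∑ x ∈ S y, w x = w' y) : (discreteLaw w).map g = discreteLaw w' := by
  refine Measure.ext_of_singleton fun y => ?_
  rw [Measure.map_apply (measurable_of_countable g) (measurableSet_singleton y),
    discreteLaw_singleton, ← lintegral_indicator_one (measurable_of_countable g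
      (measurableSet_singleton y)), lintegral_discreteLaw, tsum_eq_sum (s := S y), ← h,
    ENNReal.ofReal_sum_of_nonneg fun x _ => hw x]
  · refine Finset.sum_congr rfl fun x hx => ?_
    rw [indicator_of_mem (show x ∈ g ⁻¹' {y} from (hS y x).1 hx)]
    simp
  · intro x hx
    rw [indicator_of_notMem (show x ∉ g ⁻¹' {y} from fun h => hx ((hS y x).2 h)), mul_zero]

instance (w : β → ℝ) : SFinite (discreteLaw w) := by
  unfold discreteLaw; infer_instance

omit [Countable β] in
theorem isProbabilityMeasure_discreteLaw {w : β → ℝ} (hw : ∀ x, 0 ≤ w x) (h : HasSum w 1) :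
    IsProbabilityMeasure (discreteLaw w) := by
  constructor
  rw [← lintegral_one, lintegral_discreteLaw]
  simp_rw [mul_one]
  rw [← ENNReal.ofReal_tsum_of_nonneg hw h.summable, h.tsum_eq, ENNReal.ofReal_one]

theorem prod_discreteLaw [Countable β'] [MeasurableSingletonClass β'] {w : β → ℝ} {w' : β' → ℝ}
    (hw : ∀ x, 0 ≤ w x) : (discreteLaw w).prod (discreteLaw w')
      = discreteLaw fun x : β × β' => w x.1 * w' x.2 := by
  refine Measure.ext_of_singleton fun x => ?_
  rw [discreteLaw_singleton, ← Prod.mk.eta (p := x), ← singleton_prod_singleton,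
    Measure.prod_prod, discreteLaw_singleton, discreteLaw_singleton, ENNReal.ofReal_mul (hw _)]

end Discrete

section Multinomial

variable {ι : Type} [Fintype ι] {m : ι → ℕ}

theorem Gamma_add_natCast_eq {r : ℝ} (hr : 0 < r) (n : ℕ) :
    Real.Gamma (r + n) = (ascPochhammer ℝ n).eval r * Real.Gamma r := by
  induction n with
  | zero => simp
  | succ n ih =>
    rw [Nat.cast_add, Nat.cast_one, ← add_assoc, Real.Gamma_add_one (by positivity), ih,
      ascPochhammer_succ_eval]
    ring

theorem nmMass_eq {k : ℕ} {r : ℝ} (hr : 0 < r) (p : Fin k → ℝ) (x : Fin k → ℕ) :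
    nmMass r p x = risingCoeff (∑ i, x i) r * (1 - ∑ i, p i) ^ r
      * ((Nat.multinomial Finset.univ x : ℝ) * ∏ i, p i ^ x i) := by
  have h1 := (Real.Gamma_pos_of_pos hr).ne'
  have h2 : (∏ i, ((x i).factorial : ℝ)) * (Nat.multinomial Finset.univ x : ℝ)
      = ((∑ i, x i).factorial : ℝ) := by
    exact_mod_cast Nat.multinomial_spec Finset.univ x
  have h3 : (∏ i, ((x i).factorial : ℝ)) ≠ 0 := Finset.prod_ne_zero_iff.2 fun i _ => by positivity
  have h4 : ((∑ i, x i).factorial : ℝ) ≠ 0 := by positivity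
  have h5 : (Nat.multinomial Finset.univ x : ℝ)
      = ((∑ i, x i).factorial : ℝ) / ∏ i, ((x i).factorial : ℝ) := by
    rw [eq_div_iff h3, mul_comm, h2]
  rw [nmMass, ← Nat.cast_sum, Gamma_add_natCast_eq hr, risingCoeff, h5]
  field_simp

/-- For a fixed total the mass depends on x only through the multinomial term, so the multinomial
theorem sums the fibre. -/
theorem sum_nmMass {k : ℕ} {r : ℝ} (hr : 0 < r) (p : Fin k → ℝ) (n : ℕ) :
    ∑ x ∈ Finset.piAntidiag Finset.univ n, nmMass r p x = nb r (∑ i, p i) n := by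
  rw [nb, Finset.sum_pow_eq_sum_piAntidiag, Finset.mul_sum, Finset.mul_sum]
  refine Finset.sum_congr rfl fun x hx => ?_
  rw [nmMass_eq hr, (Finset.mem_piAntidiag.1 hx).1]
  ring

theorem jointMass_pos {t : ι → ℝ} (ht : ∀ ν, 0 < t ν) {p : Params m} (hp : p ∈ paramSpace m)
    (x : Counts m) : 0 < jointMass t p x := by
  refine Finset.prod_pos fun ν _ => ?_
  have h1 : 0 < 1 - ∑ i, p ν i := by linarith [(hp ν).2]
  have h2 : 0 < ∏ i, p ν i ^ x ν i := Finset.prod_pos fun i _ => pow_pos ((hp ν).1 i) _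
  have h3 : (0 : ℝ) < Nat.multinomial Finset.univ (x ν) := by
    exact_mod_cast Nat.multinomial_pos _ _
  have h4 := risingCoeff_pos (ht ν) (∑ i, x ν i)
  rw [nmMass_eq (ht ν)]
  positivity

/-- The block totals of independent negative multinomial vectors are independent negative
binomial variables. -/
theorem map_blockTotal_jointLaw {t : ι → ℝ} (ht : ∀ ν, 0 < t ν) {p : Params m}
    (hp : p ∈ paramSpace m) :
    (jointLaw t p).map blockTotal = discreteLaw (nbMass t (blockSum p)) := by
  classical
  refine map_discreteLaw (fun x => (jointMass_pos ht hp x).le) _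
    (fun y => Fintype.piFinset fun ν => Finset.piAntidiag Finset.univ (y ν)) (fun y x => ?_)
    fun y => ?_
  · simp only [Fintype.mem_piFinset, Finset.mem_piAntidiag, funext_iff]
    exact forall_congr' fun ν => and_iff_left fun i _ => Finset.mem_univ i
  · simp only [jointMass]
    rw [← Finset.prod_univ_sum, nbMass]
    exact Finset.prod_congr rfl fun ν _ => sum_nmMass (ht ν) _ _

/-- The total mass is read off from the pushforward under block totals, where the binomial series
applies. -/
theorem isProbabilityMeasure_jointLaw (hm : ∀ ν, 1 ≤ m ν) {t : ι → ℝ} (ht : ∀ ν, 0 < t ν)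
    {p : Params m} (hp : p ∈ paramSpace m) : IsProbabilityMeasure (jointLaw t p) := by
  have := isProbabilityMeasure_discreteLaw
    (nbMass_nonneg (fun ν => (ht ν).le) (blockSum_mem hm hp))
    (hasSum_nbMass (fun ν => (ht ν).le) (blockSum_mem hm hp))
  rw [← map_blockTotal_jointLaw ht hp] at this
  have h1 := this.measure_univ
  rw [Measure.map_apply (measurable_of_countable _) MeasurableSet.univ, preimage_univ] at h1
  exact ⟨h1⟩

theorem integrable_comp_blockTotal (hm : ∀ ν, 1 ≤ m ν) {t : ι → ℝ} (ht : ∀ ν, 0 < t ν)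
    {p : Params m} (hp : p ∈ paramSpace m) {f : (ι → ℕ) → ℝ}
    (hf : Summable fun y => nbMass t (blockSum p) y * f y) :
    Integrable (fun x => f (blockTotal x)) (jointLaw t p) := by
  have h := integrable_discreteLaw
    (nbMass_nonneg (fun ν => (ht ν).le) (blockSum_mem hm hp)) hf
  rw [← map_blockTotal_jointLaw ht hp] at h
  exact h.comp_measurable (measurable_of_countable _)

theorem integral_comp_blockTotal (hm : ∀ ν, 1 ≤ m ν) {t : ι → ℝ} (ht : ∀ ν, 0 < t ν)
    {p : Params m} (hp : p ∈ paramSpace m) {f : (ι → ℕ) → ℝ}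
    (hf : Summable fun y => nbMass t (blockSum p) y * f y) :
    ∫ x, f (blockTotal x) ∂(jointLaw t p) = ∑' y, nbMass t (blockSum p) y * f y := by
  rw [← integral_discreteLaw (nbMass_nonneg (fun ν => (ht ν).le) (blockSum_mem hm hp)) hf,
    ← map_blockTotal_jointLaw ht hp, integral_map (measurable_of_countable _).aemeasurable
      (measurable_of_countable f).aestronglyMeasurable]

end Multinomial

section Convolution

/-- Negative binomial sizes add under convolution, by Vandermonde's identity for the coefficients.
-/
theorem sum_nb_mul_nb {r s θ : ℝ} (hθ : θ < 1) (n : ℕ) :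
    ∑ j ∈ Finset.range (n + 1), nb r θ (n - j) * nb s θ j = nb (r + s) θ n := by
  have h : (1 - θ) ^ (r + s) = (1 - θ) ^ r * (1 - θ) ^ s := Real.rpow_add (by linarith) _ _
  rw [nb, add_comm r s, ← risingCoeff_add, Finset.Nat.sum_antidiagonal_eq_sum_range_succ_mk,
    Finset.sum_mul, add_comm s r, h]
  refine Finset.sum_congr rfl fun j hj => ?_
  have hj' : n = (n - j) + j := by have := Finset.mem_range.1 hj; omega
  have h2 : θ ^ n = θ ^ (n - j) * θ ^ j := by rw [← pow_add, ← hj']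
  rw [nb, nb, h2]; ring

theorem prod_dite_lt {R : Type*} [CommMonoid R] {N n : ℕ} (hnN : n ≤ N) (g : Fin n → R) :
    (∏ ν : Fin N, if h : (ν : ℕ) < n then g ⟨ν, h⟩ else 1) = ∏ j, g j := by
  obtain ⟨d, rfl⟩ := Nat.exists_eq_add_of_le hnN
  rw [Fin.prod_univ_add]
  simp

theorem sum_dite_lt {N n : ℕ} (hnN : n ≤ N) (g : Fin n → ℝ) :
    (∑ ν : Fin N, if h : (ν : ℕ) < n then g ⟨ν, h⟩ else 0) = ∑ j, g j := by
  obtain ⟨d, rfl⟩ := Nat.exists_eq_add_of_le hnN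
  rw [Fin.sum_univ_add]
  simp

/-- Extension of a family of counts by zero. -/
def extendZero {N n : ℕ} (y : Fin n → ℕ) (ν : Fin N) : ℕ :=
  if h : (ν : ℕ) < n then y ⟨ν, h⟩ else 0

theorem size_extendZero {N n : ℕ} (hnN : n ≤ N) (y : Fin n → ℕ) :
    size (extendZero y : Fin N → ℕ) = size y := by
  rw [size, size, ← sum_dite_lt hnN]
  refine Finset.sum_congr rfl fun ν _ => ?_
  unfold extendZero
  split_ifs <;> simp

theorem map_add_extendZero {N n : ℕ} (hnN : n ≤ N) {r T θ : Fin N → ℝ} {s : Fin n → ℝ}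
    (hr : ∀ ν, 0 ≤ r ν) (hs : ∀ j, 0 ≤ s j) (hθ : ∀ ν, θ ν ∈ Ioo (0 : ℝ) 1)
    (hT : ∀ j : Fin n, T (Fin.castLE hnN j) = r (Fin.castLE hnN j) + s j)
    (hT' : ∀ ν : Fin N, n ≤ (ν : ℕ) → T ν = r ν) :
    ((discreteLaw (nbMass r θ)).prod (discreteLaw
        (nbMass s fun j => θ (Fin.castLE hnN j)))).map (fun x => x.1 + extendZero x.2)
      = discreteLaw (nbMass T θ) := by
  classical
  have hinj : ∀ y : Fin N → ℕ, Function.Injective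
      fun z : Fin n → ℕ => ((y - extendZero z : Fin N → ℕ), z) :=
    fun y z z' h => (Prod.mk.inj h).2
  rw [prod_discreteLaw (nbMass_nonneg hr hθ)]
  refine map_discreteLaw (fun x => mul_nonneg (nbMass_nonneg hr hθ _)
    (nbMass_nonneg hs (fun j => hθ _) _)) _
    -- The fibre over y consists of the pairs (y - z, z) with z_j ≤ y_j in the first n coordinates;
    -- under this restriction the truncated subtraction is exact.
    (fun y => (Fintype.piFinset fun j : Fin n =>
      Finset.range (y (Fin.castLE hnN j) + 1)).map ⟨_, hinj y⟩) (fun y x => ?_) fun y => ?_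
  · obtain ⟨x, z⟩ := x
    simp only [Finset.mem_map, Fintype.mem_piFinset, Finset.mem_range, Function.Embedding.coeFn_mk,
      Prod.mk.injEq]
    constructor
    · rintro ⟨z', hz, rfl, rfl⟩
      ext ν
      simp only [Pi.add_apply, Pi.sub_apply]
      refine Nat.sub_add_cancel ?_
      unfold extendZero
      split_ifs with hν
      · exact Nat.le_of_lt_succ (hz ⟨ν, hν⟩)
      · exact Nat.zero_le _
    · rintro rfl
      refine ⟨z, fun j => ?_, add_tsub_cancel_right _ _, rfl⟩
      have : extendZero z (Fin.castLE hnN j) = z j := by simp [extendZero]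
      simp only [Pi.add_apply, this]
      omega
  · rw [Finset.sum_map]
    simp only [Function.Embedding.coeFn_mk, nbMass]
    have e1 : ∀ z : Fin n → ℕ, (∏ ν, nb (r ν) (θ ν) ((y - extendZero z : Fin N → ℕ) ν))
        * ∏ j, nb (s j) (θ (Fin.castLE hnN j)) (z j)
        = (∏ ν : Fin N, if (ν : ℕ) < n then 1 else nb (r ν) (θ ν) (y ν))
          * ∏ j, nb (r (Fin.castLE hnN j)) (θ (Fin.castLE hnN j)) (y (Fin.castLE hnN j) - z j)
            * nb (s j) (θ (Fin.castLE hnN j)) (z j) := by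
      intro z
      rw [Finset.prod_mul_distrib, ← mul_assoc]
      congr 1
      rw [← prod_dite_lt hnN fun j => nb (r (Fin.castLE hnN j)) (θ (Fin.castLE hnN j))
        (y (Fin.castLE hnN j) - z j), ← Finset.prod_mul_distrib]
      refine Finset.prod_congr rfl fun ν _ => ?_
      by_cases hν : (ν : ℕ) < n <;> simp [extendZero, hν]
    simp_rw [e1]
    rw [← Finset.mul_sum, ← Finset.prod_univ_sum (fun j : Fin n =>
      Finset.range (y (Fin.castLE hnN j) + 1)) (fun j k => nb (r (Fin.castLE hnN j))
        (θ (Fin.castLE hnN j)) (y (Fin.castLE hnN j) - k) * nb (s j) (θ (Fin.castLE hnN j)) k)]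
    simp_rw [sum_nb_mul_nb (hθ _).2, ← hT]
    rw [← prod_dite_lt hnN fun j => nb (T (Fin.castLE hnN j)) (θ (Fin.castLE hnN j))
        (y (Fin.castLE hnN j)), ← Finset.prod_mul_distrib]
    refine Finset.prod_congr rfl fun ν _ => ?_
    by_cases hν : (ν : ℕ) < n
    · simp [hν]
    · simp [hν, hT' ν (not_lt.1 hν)]

end Convolution

end

/-! ### Likelihoods, posterior means and predictive masses -/

section

/-- The part of the negative multinomial likelihood that depends on the parameter. -/
def likelihood {ι : Type} [Fintype ι] {m : ι → ℕ} (t : ι → ℝ) (x : Counts m) (q : Params m) : ℝ :=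
  kern t 0 (blockSum q) * ∏ ν, ∏ i, q ν i ^ x ν i

/-- The part of the negative multinomial likelihood that does not depend on the parameter. -/
def massCoeff {ι : Type} [Fintype ι] {m : ι → ℕ} (t : ι → ℝ) (x : Counts m) : ℝ :=
  ∏ ν, risingCoeff (∑ i, x ν i) (t ν) * (Nat.multinomial Finset.univ (x ν) : ℝ)

section General

variable {ι : Type} [Fintype ι] {m : ι → ℕ} {t : ι → ℝ}

theorem massCoeff_pos (ht : ∀ ν, 0 < t ν) (x : Counts m) : 0 < massCoeff t x := by
  refine Finset.prod_pos fun ν _ => mul_pos (risingCoeff_pos (ht ν) _) ?_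
  exact_mod_cast Nat.multinomial_pos _ _

theorem jointMass_eq (ht : ∀ ν, 0 < t ν) (q : Params m) (x : Counts m) :
    jointMass t q x = massCoeff t x * likelihood t x q := by
  rw [jointMass, massCoeff, likelihood, kern, ← Finset.prod_mul_distrib, ← Finset.prod_mul_distrib]
  refine Finset.prod_congr rfl fun ν _ => ?_
  rw [nmMass_eq (ht ν), blockSum, Pi.zero_apply, pow_zero]
  ring

theorem likelihood_pos (hm : ∀ ν, 1 ≤ m ν) (t : ι → ℝ) (x : Counts m) {q : Params m}
    (hq : q ∈ paramSpace m) : 0 < likelihood t x q :=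
  mul_pos (kern_pos _ _ (blockSum_mem hm hq))
    (Finset.prod_pos fun ν _ => Finset.prod_pos fun i _ => pow_pos ((hq ν).1 i) _)

@[fun_prop]
theorem measurable_likelihood (t : ι → ℝ) (x : Counts m) : Measurable (likelihood t x) := by
  unfold likelihood; fun_prop

omit [Fintype ι] in
theorem coord_lt_one {q : Params m} (hq : q ∈ paramSpace m) (ν : ι) (i : Fin (m ν)) :
    q ν i < 1 :=
  (Finset.single_le_sum (f := q ν) (fun j _ => ((hq ν).1 j).le) (Finset.mem_univ i)).trans_lt
    (hq ν).2

theorem prod_coord_le_one {q : Params m} (hq : q ∈ paramSpace m) (x : Counts m) :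
    ∏ ν, ∏ i, q ν i ^ x ν i ≤ 1 :=
  Finset.prod_le_one
    (fun ν _ => Finset.prod_nonneg fun i _ => pow_nonneg ((hq ν).1 i).le _)
    fun ν _ => Finset.prod_le_one (fun i _ => pow_nonneg ((hq ν).1 i).le _)
      fun i _ => pow_le_one₀ ((hq ν).1 i).le (coord_lt_one hq ν i).le

/-- The analogue of `prod_pow_le` for individual coordinates, needed because the integrated
likelihood depends on all counts and not only on block totals. -/
theorem prod_coord_pow_le {q : Params m} (hq : q ∈ paramSpace m) (x : Counts m) :
    (∏ ν, ∏ i, q ν i) ^ (∑ ν, blockTotal x ν) ≤ ∏ ν, ∏ i, q ν i ^ x ν i := by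
  have h0 : ∀ ν, 0 < ∏ i, q ν i := fun ν => Finset.prod_pos fun i _ => (hq ν).1 i
  have h1 : ∀ ν, ∏ i, q ν i ≤ 1 := fun ν =>
    Finset.prod_le_one (fun i _ => ((hq ν).1 i).le) fun i _ => (coord_lt_one hq ν i).le
  have h2 : 0 < ∏ ν, ∏ i, q ν i := Finset.prod_pos fun ν _ => h0 ν
  rw [← Finset.prod_pow_eq_pow_sum]
  refine Finset.prod_le_prod (fun ν _ => pow_nonneg h2.le _) fun ν _ => ?_
  rw [blockTotal, ← Finset.prod_pow_eq_pow_sum]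
  refine Finset.prod_le_prod (fun i _ => pow_nonneg h2.le _) fun i _ => ?_
  refine pow_le_pow_left₀ h2.le ?_ _
  classical
  rw [← Finset.mul_prod_erase _ _ (Finset.mem_univ ν),
    ← Finset.mul_prod_erase _ _ (Finset.mem_univ i), mul_assoc]
  refine mul_le_of_le_one_right ((hq ν).1 i).le (mul_le_one₀ ?_ ?_ ?_)
  · exact Finset.prod_le_one (fun i _ => ((hq ν).1 i).le) fun i _ => (coord_lt_one hq ν i).le
  · exact Finset.prod_nonneg fun j _ => (h0 j).le
  · exact Finset.prod_le_one (fun j _ => (h0 j).le) fun j _ => h1 j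

end General

section Prior

variable {N : ℕ} {m : Fin N → ℕ} {M : Measure (Ioi (0 : ℝ))} {γ : Ioi (0 : ℝ) → Fin N → ℝ}
  {a₀ : Fin N → ℝ} {a : Params m} {r t : Fin N → ℝ} {δ : ℝ}

theorem marginal_eq [SFinite M] (hγ : Measurable γ) (ht : ∀ ν, 0 < t ν) (x : Counts m) :
    marginal (mixedPrior M γ a₀ a) t x = ENNReal.ofReal (massCoeff t x) *
      ∫⁻ q, ENNReal.ofReal (likelihood t x q) ∂(priorMeasure M γ a₀ a) := by
  rw [← lintegral_const_mul' _ _ ENNReal.ofReal_ne_top, priorMeasure,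
    lintegral_withDensity_eq_lintegral_mul _ (measurable_mixedPrior hγ) (by fun_prop), marginal]
  refine lintegral_congr fun q => ?_
  rw [jointMass_eq ht, ENNReal.ofReal_mul (massCoeff_pos ht x).le]
  rfl

/-- A measure for which some positive finite function has a finite integral is s-finite. -/
theorem sFinite_of_lintegral_ne_top {α : Type*} [MeasurableSpace α] {μ : Measure α}
    {g : α → ℝ≥0∞} (hg : Measurable g) (h0 : ∀ x, g x ≠ 0) (htop : ∀ x, g x ≠ ⊤)
    (h : ∫⁻ x, g x ∂μ ≠ ⊤) : SFinite μ := by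
  have hfin : IsFiniteMeasure (μ.withDensity g) := isFiniteMeasure_withDensity h
  have e := withDensity_inv_same hg (μ := μ) (Eventually.of_forall h0) (Eventually.of_forall htop)
  rw [← e]
  infer_instance

/-- A mixing measure with proper posteriors is s-finite. -/
theorem sFinite_of_properPosterior (hγ : Measurable γ)
    (h : ProperPosterior (mixedPrior M γ a₀ a) r) (hm : ∀ ν, 1 ≤ m ν) (hr : ∀ ν, 0 < r ν) :
    SFinite M := by
  obtain ⟨h0, htop⟩ := h 0
  obtain ⟨q, hq, hqt⟩ : ∃ q ∈ paramSpace m, mixedPrior M γ a₀ a q ≠ ⊤ := by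
    by_contra! hcon
    -- The likelihood is positive on the parameter space, so a density infinite throughout would
    -- make the marginal ⊤ times a volume, that is 0 or ⊤, and properness excludes both.
    have e : marginal (mixedPrior M γ a₀ a) r 0 = ∫⁻ _ in paramSpace m, ⊤ := by
      refine setLIntegral_congr_fun (measurableSet_paramSpace m) fun q hq => ?_
      rw [hcon q hq, ENNReal.top_mul]
      rw [jointMass_eq hr]
      exact (ENNReal.ofReal_pos.2 (mul_pos (massCoeff_pos hr _) (likelihood_pos hm _ _ hq))).ne'
    rw [lintegral_const] at e
    rw [e] at h0 htop
    exact htop (ENNReal.top_mul (right_ne_zero_of_mul h0))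
  -- At such a q the mixing integrand is a positive finite function of u with finite M-integral.
  refine sFinite_of_lintegral_ne_top ((measurable_mixedPrior_integrand hγ).comp
    (measurable_prodMk_left (x := q))) (fun u => (ENNReal.ofReal_pos.2 ?_).ne')
    (fun u => ENNReal.ofReal_ne_top) hqt
  exact Finset.prod_pos fun ν _ => mul_pos
    (Real.rpow_pos_of_pos (by linarith [(hq ν).2]) _)
    (Finset.prod_pos fun i _ => Real.rpow_pos_of_pos ((hq ν).1 i) _)

/-- At the observation x = 0 the likelihood is the kernel itself, so properness there is precisely
this claim up to a positive constant. -/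
theorem lintegral_kern_of_properPosterior [SFinite M] (hγ : Measurable γ)
    (h : ProperPosterior (mixedPrior M γ a₀ a) r) (hr : ∀ ν, 0 < r ν) :
    ∫⁻ q, ENNReal.ofReal (kern r 0 (blockSum q)) ∂(priorMeasure M γ a₀ a) ≠ 0 ∧
      ∫⁻ q, ENNReal.ofReal (kern r 0 (blockSum q)) ∂(priorMeasure M γ a₀ a) ≠ ⊤ := by
  have h0 := h 0
  rw [marginal_eq hγ hr] at h0
  have e : ∀ q : Params m, likelihood r 0 q = kern r 0 (blockSum q) := fun q => by
    simp [likelihood]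
  simp_rw [e] at h0
  refine ⟨right_ne_zero_of_mul h0.1, fun htop => h0.2 ?_⟩
  rw [htop]
  exact ENNReal.mul_top (ENNReal.ofReal_pos.2 (massCoeff_pos hr _)).ne'

theorem momentData_priorMeasure [SFinite M] (hγ : Measurable γ) (hγ0 : ∀ u ν, 0 ≤ γ u ν)
    (hm : ∀ ν, 1 ≤ m ν) (ha : ∀ ν i, 0 < a ν i) (hδ : 0 < δ) (hra : ∀ ν, δ ≤ r ν + a₀ ν)
    (h : ∫⁻ q, ENNReal.ofReal (kern r 0 (blockSum q)) ∂(priorMeasure M γ a₀ a) ≠ 0 ∧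
      ∫⁻ q, ENNReal.ofReal (kern r 0 (blockSum q)) ∂(priorMeasure M γ a₀ a) ≠ ⊤) :
    MomentData (priorMeasure M γ a₀ a) blockSum r (fun ν => ∑ i, a ν i) δ := by
  have hmem : ∀ᵐ q ∂(priorMeasure M γ a₀ a), ∀ ν, blockSum q ν ∈ Ioo (0 : ℝ) 1 :=
    ae_priorMeasure_mem.mono fun q hq => blockSum_mem hm hq
  have hint : Integrable (fun q => kern r 0 (blockSum q)) (priorMeasure M γ a₀ a) := by
    refine ⟨Measurable.aestronglyMeasurable (by fun_prop), ?_⟩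
    rw [hasFiniteIntegral_iff_ofReal (hmem.mono fun q hq => (kern_pos r 0 hq).le)]
    exact h.2.lt_top
  refine ⟨measurable_blockSum, hmem, ?_, hint, hδ,
    fun ν => Finset.sum_nonneg fun i _ => (ha ν i).le, fun t ht y ν => ?_⟩
  · intro h0
    rw [h0, lintegral_zero_measure] at h
    exact h.1 rfl
  · have hi : Integrable (fun q => kern t y (blockSum q)) (priorMeasure M γ a₀ a) := by
      refine hint.mono' (Measurable.aestronglyMeasurable (by fun_prop)) ?_
      filter_upwards [hmem] with q hq
      rw [Real.norm_of_nonneg (kern_pos _ _ hq).le]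
      exact kern_le_kern_zero ht y hq
    have hi2 : Integrable (fun q => (1 - blockSum q ν) * kern t y (blockSum q))
        (priorMeasure M γ a₀ a) := by
      refine hi.mono' (Measurable.aestronglyMeasurable (by fun_prop)) ?_
      filter_upwards [hmem] with q hq
      have h1 := (kern_pos t y hq).le
      rw [norm_mul, Real.norm_of_nonneg h1, Real.norm_of_nonneg (by linarith [(hq ν).2])]
      exact mul_le_of_le_one_left h1 (by linarith [(hq ν).1])
    have hn : 0 ≤ᵐ[priorMeasure M γ a₀ a] fun q => kern t y (blockSum q) :=
      hmem.mono fun q hq => (kern_pos t y hq).le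
    have hn2 : 0 ≤ᵐ[priorMeasure M γ a₀ a] fun q => (1 - blockSum q ν) * kern t y (blockSum q) :=
      hmem.mono fun q hq => mul_nonneg (by linarith [(hq ν).2]) (kern_pos t y hq).le
    have hA : 0 ≤ ∑ i, a ν i := Finset.sum_nonneg fun i _ => (ha ν i).le
    have hg := lintegral_one_sub_mul_kern_ge (M := M) (a₀ := a₀) hγ hγ0 hm ha hδ t
      (fun ν => (hra ν).trans (by linarith [ht ν])) y ν
    rw [← ofReal_integral_eq_lintegral_ofReal hi hn, ← ofReal_integral_eq_lintegral_ofReal hi2 hn2,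
      ← ENNReal.ofReal_mul (by positivity), ENNReal.ofReal_le_ofReal_iff (integral_nonneg_of_ae hn2)]
      at hg
    exact hg

/-- K is the direction integral and depends only on z and a. It therefore cancels both within one
posterior mean and between the two priors. -/
theorem exists_integral_likelihood_mul_pow (hm : ∀ ν, 1 ≤ m ν) (ha : ∀ ν i, 0 < a ν i)
    (z : Counts m) :
    ∃ K : ℝ, 0 < K ∧ ∀ (M : Measure (Ioi (0 : ℝ))) [SFinite M]
      (γ : Ioi (0 : ℝ) → Fin N → ℝ), Measurable γ → ∀ (a₀ t : Fin N → ℝ) (ν : Fin N) (k : ℕ),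
      ∫ q, likelihood t z q * blockSum q ν ^ k ∂(priorMeasure M γ a₀ a)
        = K * moment (priorMeasure M γ a₀ a) blockSum t (blockTotal z + Pi.single ν k) := by
  obtain ⟨K, hK, h⟩ := exists_lintegral_kern_mul_eq hm ha z
  refine ⟨K, hK, fun M _ γ hγ a₀ t ν k => ?_⟩
  have hmem : ∀ᵐ q ∂(priorMeasure M γ a₀ a), q ∈ paramSpace m := ae_priorMeasure_mem
  have h1 := h M γ hγ a₀ t (Pi.single ν k)
  have e : ∀ q : Params m, likelihood t z q * blockSum q ν ^ k
      = kern t (Pi.single ν k) (blockSum q) * ∏ ν, ∏ i, q ν i ^ z ν i := fun q => by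
    have := kern_add_single t 0 ν k (blockSum q)
    rw [zero_add] at this
    rw [this, likelihood]; ring
  simp_rw [e]
  rw [moment, integral_eq_lintegral_of_nonneg_ae, integral_eq_lintegral_of_nonneg_ae, h1,
    ENNReal.toReal_mul, ENNReal.toReal_ofReal hK.le, add_comm]
  · exact hmem.mono fun q hq => (kern_pos _ _ (blockSum_mem hm hq)).le
  · exact Measurable.aestronglyMeasurable (by fun_prop)
  · refine hmem.mono fun q hq => mul_nonneg (kern_pos _ _ (blockSum_mem hm hq)).le
      (Finset.prod_nonneg fun ν _ => Finset.prod_nonneg fun i _ => pow_nonneg ((hq ν).1 i).le _)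
  · exact Measurable.aestronglyMeasurable (by fun_prop)

section Posterior

variable {A : Fin N → ℝ} (h : MomentData (priorMeasure M γ a₀ a) blockSum r A δ)
  (hm : ∀ ν, 1 ≤ m ν) (ht : ∀ ν, r ν ≤ t ν)
include h hm ht

theorem integrable_likelihood (x : Counts m) :
    Integrable (likelihood t x) (priorMeasure M γ a₀ a) := by
  refine (h.integrable_kern ht 0).mono' (Measurable.aestronglyMeasurable (by fun_prop)) ?_
  filter_upwards [ae_priorMeasure_mem] with q hq
  rw [Real.norm_of_nonneg (likelihood_pos hm t x hq).le]
  exact mul_le_of_le_one_right (kern_pos _ _ (blockSum_mem hm hq)).le (prod_coord_le_one hq x)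

theorem exists_pow_le_integral_likelihood : ∃ c ∈ Ioc (0 : ℝ) 1, ∀ x : Counts m,
    c ^ (∑ ν, blockTotal x ν + 1) ≤ ∫ q, likelihood t x q ∂(priorMeasure M γ a₀ a) := by
  obtain ⟨c, hc, hcn⟩ := exists_pow_le_integral h.ne (f := fun q => ∏ ν, ∏ i, q ν i)
    (g := fun q => kern t 0 (blockSum q)) (by fun_prop)
    (ae_priorMeasure_mem.mono fun q hq => Finset.prod_pos fun ν _ =>
      Finset.prod_pos fun i _ => (hq ν).1 i)
    (h.integrable_kern ht 0) (h.mem.mono fun q hq => kern_pos t 0 hq)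
  refine ⟨c, hc, fun x => hcn _ _ (integrable_likelihood h hm ht x) ?_⟩
  filter_upwards [ae_priorMeasure_mem] with q hq
  rw [likelihood, mul_comm]
  exact mul_le_mul_of_nonneg_left (prod_coord_pow_le hq x) (kern_pos _ _ (blockSum_mem hm hq)).le

theorem integral_likelihood_pos (x : Counts m) :
    0 < ∫ q, likelihood t x q ∂(priorMeasure M γ a₀ a) := by
  obtain ⟨c, hc, hcx⟩ := exists_pow_le_integral_likelihood h hm ht
  exact (pow_pos hc.1 _).trans_le (hcx x)

theorem exists_abs_log_integral_likelihood_le : ∃ C : ℝ, ∀ x : Counts m,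
    |Real.log (∫ q, likelihood t x q ∂(priorMeasure M γ a₀ a))|
      ≤ C * (1 + size (blockTotal x)) := by
  obtain ⟨c, hc, hcx⟩ := exists_pow_le_integral_likelihood h hm ht
  refine ⟨|Real.log (moment (priorMeasure M γ a₀ a) blockSum t 0)| + |Real.log c|, fun x => ?_⟩
  have h2 := abs_log_le_of_pow_le hc (hcx x) (B := moment (priorMeasure M γ a₀ a) blockSum t 0) (by
    refine integral_mono_ae (integrable_likelihood h hm ht x) (h.integrable_kern ht 0) ?_
    filter_upwards [ae_priorMeasure_mem] with q hq
    exact mul_le_of_le_one_right (kern_pos _ _ (blockSum_mem hm hq)).le (prod_coord_le_one hq x))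
  rw [Nat.cast_sum] at h2
  exact h2

theorem integral_posterior [SFinite M] (hγ : Measurable γ) (ht0 : ∀ ν, 0 < t ν) (x : Counts m)
    (g : Params m → ℝ) :
    ∫ q, g q ∂(posterior (mixedPrior M γ a₀ a) t x)
      = (∫ q, likelihood t x q * g q ∂(priorMeasure M γ a₀ a))
        / ∫ q, likelihood t x q ∂(priorMeasure M γ a₀ a) := by
  have hI := integral_likelihood_pos h hm ht x
  have hC := massCoeff_pos ht0 x
  have hL : 0 ≤ᵐ[priorMeasure M γ a₀ a] likelihood t x :=
    ae_priorMeasure_mem.mono fun q hq => (likelihood_pos hm t x hq).le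
  have hjm : Measurable fun q : Params m => ENNReal.ofReal (jointMass t q x) := by
    simp_rw [jointMass_eq ht0]; fun_prop
  have hd : (volume.restrict (paramSpace m)).withDensity
      (fun q => mixedPrior M γ a₀ a q * ENNReal.ofReal (jointMass t q x))
      = (priorMeasure M γ a₀ a).withDensity fun q => ENNReal.ofReal (jointMass t q x) :=
    withDensity_mul _ (measurable_mixedPrior hγ) hjm
  rw [posterior, hd, integral_smul_measure, integral_withDensity_eq_integral_toReal_smul hjm
    (Eventually.of_forall fun q => ENNReal.ofReal_lt_top), marginal_eq hγ ht0,
    ← ofReal_integral_eq_lintegral_ofReal (integrable_likelihood h hm ht x) hL,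
    ← ENNReal.ofReal_mul hC.le, ENNReal.toReal_inv, ENNReal.toReal_ofReal (by positivity)]
  have e : ∫ q, (ENNReal.ofReal (jointMass t q x)).toReal • g q ∂(priorMeasure M γ a₀ a)
      = massCoeff t x * ∫ q, likelihood t x q * g q ∂(priorMeasure M γ a₀ a) := by
    rw [← integral_const_mul]
    refine integral_congr_ae ?_
    filter_upwards [ae_priorMeasure_mem] with q hq
    rw [jointMass_eq ht0, ENNReal.toReal_ofReal (mul_pos hC (likelihood_pos hm t x hq)).le,
      smul_eq_mul, mul_assoc]
  rw [e, smul_eq_mul]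
  field_simp

/-- Numerator and denominator carry the same K(x), so the posterior mean sees the data only through
block totals. -/
theorem posteriorMeanPow_eq [SFinite M] (hγ : Measurable γ) (ha : ∀ ν i, 0 < a ν i)
    (ht0 : ∀ ν, 0 < t ν) (ν : Fin N) (k : ℕ) (x : Counts m) :
    posteriorMeanPow (mixedPrior M γ a₀ a) t ν k x
      = momentRatio (priorMeasure M γ a₀ a) blockSum t ν k (blockTotal x) := by
  obtain ⟨K, hK, hKm⟩ := exists_integral_likelihood_mul_pow hm ha x
  have h1 := hKm M γ hγ a₀ t ν k
  have h2 := hKm M γ hγ a₀ t ν 0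
  simp only [pow_zero, mul_one, Pi.single_zero, add_zero] at h2
  have e : ∫ q, likelihood t x q * (∑ i, q ν i) ^ k ∂(priorMeasure M γ a₀ a) = _ := h1
  rw [posteriorMeanPow, integral_posterior h hm ht hγ ht0, e, h2, momentRatio,
    mul_div_mul_left _ _ hK.ne']

end Posterior

section Predictive

variable {n : ℕ} {s : Fin n → ℝ} {T : Fin N → ℝ}

/-- Extension of future counts by zero to all blocks. -/
def extendCounts (hnN : n ≤ N) (y : Counts fun j : Fin n => m (Fin.castLE hnN j)) : Counts m :=
  fun ν => if h : (ν : ℕ) < n then y ⟨ν, h⟩ else 0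

theorem blockTotal_extendCounts (hnN : n ≤ N) (y : Counts fun j : Fin n => m (Fin.castLE hnN j)) :
    blockTotal (extendCounts hnN y) = extendZero (blockTotal y) := by
  ext ν
  by_cases hν : (ν : ℕ) < n
  · simp only [blockTotal, extendCounts, extendZero, dif_pos hν]
    rfl
  · simp [blockTotal, extendCounts, extendZero, hν]

theorem blockTotal_add {ι : Type} {m : ι → ℕ} (x z : Counts m) :
    blockTotal (x + z) = blockTotal x + blockTotal z := by
  ext ν; simp [blockTotal, Finset.sum_add_distrib]

/-- X and Y share the parameter, so exponents add: counts add, and so do the sizes in the first n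
blocks. -/
theorem likelihood_mul_likelihood (hnN : n ≤ N)
    (hT : ∀ j : Fin n, T (Fin.castLE hnN j) = r (Fin.castLE hnN j) + s j)
    (hT' : ∀ ν : Fin N, n ≤ (ν : ℕ) → T ν = r ν) (x : Counts m)
    (y : Counts fun j : Fin n => m (Fin.castLE hnN j)) {q : Params m} (hq : q ∈ paramSpace m) :
    likelihood r x q * likelihood s y (firstParams hnN q)
      = likelihood T (x + extendCounts hnN y) q := by
  simp only [likelihood, kern, ← Finset.prod_mul_distrib]
  rw [← prod_dite_lt hnN, ← Finset.prod_mul_distrib]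
  refine Finset.prod_congr rfl fun ν _ => ?_
  by_cases hν : (ν : ℕ) < n
  · have e := hT ⟨ν, hν⟩
    have e' : Fin.castLE hnN ⟨ν, hν⟩ = ν := rfl
    rw [e'] at e
    have hq1 : 0 < 1 - blockSum q ν := by
      have := (hq ν).2
      unfold blockSum
      linarith
    rw [dif_pos hν, e, Real.rpow_add hq1]
    have e2 : ∏ i, q ν i ^ (x + extendCounts hnN y) ν i
        = (∏ i, q ν i ^ x ν i) * ∏ i, q ν i ^ extendCounts hnN y ν i := by
      rw [← Finset.prod_mul_distrib]
      exact Finset.prod_congr rfl fun i _ => pow_add _ _ _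
    have e3 : ∏ i, q ν i ^ extendCounts hnN y ν i
        = ∏ i, firstParams hnN q ⟨ν, hν⟩ i ^ y ⟨ν, hν⟩ i := by
      simp only [extendCounts, dif_pos hν]
      rfl
    have e4 : blockSum (firstParams hnN q) ⟨ν, hν⟩ = blockSum q ν := rfl
    rw [e2, e3, e4]
    simp only [Pi.zero_apply, pow_zero]
    ring
  · have e2 : ∏ i, q ν i ^ (x + extendCounts hnN y) ν i = ∏ i, q ν i ^ x ν i :=
      Finset.prod_congr rfl fun i _ => by simp [extendCounts, hν]
    rw [dif_neg hν, hT' ν (not_lt.1 hν), e2, mul_one]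

theorem firstParams_mem (hnN : n ≤ N) {q : Params m} (hq : q ∈ paramSpace m) :
    firstParams hnN q ∈ paramSpace fun j : Fin n => m (Fin.castLE hnN j) :=
  fun j => hq (Fin.castLE hnN j)

theorem predictiveMass_eq [SFinite M] {A : Fin N → ℝ}
    (h : MomentData (priorMeasure M γ a₀ a) blockSum r A δ) (hm : ∀ ν, 1 ≤ m ν)
    (hγ : Measurable γ) (hr : ∀ ν, 0 < r ν) (hs : ∀ j, 0 < s j) (hnN : n ≤ N)
    (hT : ∀ j : Fin n, T (Fin.castLE hnN j) = r (Fin.castLE hnN j) + s j)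
    (hT' : ∀ ν : Fin N, n ≤ (ν : ℕ) → T ν = r ν)
    (y : Counts fun j : Fin n => m (Fin.castLE hnN j)) (x : Counts m) :
    predictiveMass hnN (mixedPrior M γ a₀ a) r s y x = massCoeff s y *
      ((∫ q, likelihood T (x + extendCounts hnN y) q ∂(priorMeasure M γ a₀ a))
        / ∫ q, likelihood r x q ∂(priorMeasure M γ a₀ a)) := by
  rw [predictiveMass, integral_posterior h hm (fun _ => le_rfl) hγ hr, ← mul_div_assoc,
    ← integral_const_mul]
  congr 1
  refine integral_congr_ae ?_
  filter_upwards [ae_priorMeasure_mem] with q hq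
  rw [jointMass_eq hs, mul_left_comm, likelihood_mul_likelihood hnN hT hT' x y hq]

end Predictive

end Prior

end

/-! ### Expected losses and the risk difference -/

section

/-- Monotonicity places the path between its end values, and compactness bounds the derivative,
which is continuous up to the end points. -/
theorem exists_sizePath {ι : Type} [Fintype ι] {t : ι → ℝ → ℝ}
    (ht : ∀ ν, ContDiffOn ℝ (⊤ : ℕ∞) (t ν) (Icc 0 1)) (hmono : ∀ ν, MonotoneOn (t ν) (Icc 0 1)) :
    ∃ B, SizePath t (fun ν => derivWithin (t ν) (Icc 0 1)) (fun ν => t ν 0) (fun ν => t ν 1) B := by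
  have hb : ∀ ν, ∃ C, ∀ τ ∈ Icc (0 : ℝ) 1, ‖derivWithin (t ν) (Icc 0 1) τ‖ ≤ C := fun ν =>
    isCompact_Icc.exists_bound_of_continuousOn
      ((ht ν).continuousOn_derivWithin (uniqueDiffOn_Icc zero_lt_one) (by norm_cast))
  choose C hC using hb
  refine ⟨∑ ν, C ν, fun ν => (ht ν).continuousOn, fun τ hτ ν => ?_, fun τ hτ ν => ?_,
    fun τ hτ ν => ?_, fun τ hτ ν => ?_⟩
  · exact hmono ν (left_mem_Icc.2 zero_le_one) hτ hτ.1
  · exact hmono ν hτ (right_mem_Icc.2 zero_le_one) hτ.2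
  · exact (((ht ν).differentiableOn (by simp)) τ
      (Ioo_subset_Icc_self hτ)).hasDerivWithinAt.hasDerivAt (Icc_mem_nhds hτ.1 hτ.2)
  · refine (hC ν τ (Ioo_subset_Icc_self hτ)).trans
      (Finset.single_le_sum (f := C) (fun j _ => ?_) (Finset.mem_univ ν))
    exact (norm_nonneg _).trans (hC j τ (Ioo_subset_Icc_self hτ))

/-- Used for the blocks without future observations: t_ν is constant there, which reduces the sum
over all N blocks to the first n. -/
theorem derivWithin_eq_zero_of_monotoneOn {f : ℝ → ℝ} (hf : MonotoneOn f (Icc 0 1))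
    (h : f 1 = f 0) {τ : ℝ} (hτ : τ ∈ Icc (0 : ℝ) 1) : derivWithin f (Icc 0 1) τ = 0 := by
  have hc : EqOn f (fun _ => f 0) (Icc 0 1) := fun x hx =>
    le_antisymm ((hf hx (right_mem_Icc.2 zero_le_one) hx.2).trans h.le)
      (hf (left_mem_Icc.2 zero_le_one) hx hx.1)
  rw [derivWithin_congr hc (hc hτ), derivWithin_fun_const, Pi.zero_apply]

theorem exists_abs_log_likelihood_le {ι : Type} [Fintype ι] {m : ι → ℕ} (hm : ∀ ν, 1 ≤ m ν)
    (t : ι → ℝ) {q : Params m} (hq : q ∈ paramSpace m) :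
    ∃ C : ℝ, ∀ x, |Real.log (likelihood t x q)| ≤ C * (1 + size (blockTotal x)) := by
  have hk := kern_pos t 0 (blockSum_mem hm hq)
  have hP : 0 < ∏ ν, ∏ i, q ν i := Finset.prod_pos fun ν _ =>
    Finset.prod_pos fun i _ => (hq ν).1 i
  set c := min (∏ ν, ∏ i, q ν i) (min 1 (kern t 0 (blockSum q))) with hc
  have hc0 : 0 < c := lt_min hP (lt_min one_pos hk)
  have hc1 : c ≤ 1 := (min_le_right _ _).trans (min_le_left _ _)
  refine ⟨|Real.log (kern t 0 (blockSum q))| + |Real.log c|, fun x => ?_⟩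
  have h := abs_log_le_of_pow_le (c := c) (x := likelihood t x q) ⟨hc0, hc1⟩
    (n := ∑ ν, blockTotal x ν) ?_ (mul_le_of_le_one_right hk.le (prod_coord_le_one hq x))
  · rw [Nat.cast_sum] at h
    exact h
  · rw [pow_succ, mul_comm, likelihood]
    exact mul_le_mul ((min_le_right _ _).trans (min_le_right _ _))
      ((pow_le_pow_left₀ hc0.le (min_le_left _ _) _).trans (prod_coord_pow_le hq x))
      (pow_nonneg hc0.le _) hk.le

section Loss

variable {N : ℕ} {m : Fin N → ℕ} {M M' : Measure (Ioi (0 : ℝ))} {γ γ' : Ioi (0 : ℝ) → Fin N → ℝ}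
  {a₀ : Fin N → ℝ} {a p : Params m} {r t A : Fin N → ℝ} {δ : ℝ}

/-- With θ the true power, the loss is d - θ log d plus θ log θ - θ. Only the first part involves
the prior, and it is a function of the block totals. -/
theorem integrable_and_integral_klLoss [SFinite M] (hγ : Measurable γ)
    (h : MomentData (priorMeasure M γ a₀ a) blockSum r A δ)
    (hm : ∀ ν, 1 ≤ m ν) (ha : ∀ ν i, 0 < a ν i) (hr : ∀ ν, 0 < r ν)
    (ht : ∀ ν, r ν ≤ t ν) (hp : p ∈ paramSpace m) (ν : Fin N) (k : ℕ) :
    Integrable (fun z => klLoss (posteriorMeanPow (mixedPrior M γ a₀ a) t ν k z)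
      ((∑ i, p ν i) ^ k)) (jointLaw t p) ∧
    ∫ z, klLoss (posteriorMeanPow (mixedPrior M γ a₀ a) t ν k z) ((∑ i, p ν i) ^ k) ∂(jointLaw t p)
      = lossTerm (priorMeasure M γ a₀ a) blockSum t (blockSum p) ν k
        + ((∑ i, p ν i) ^ k * Real.log ((∑ i, p ν i) ^ k) - (∑ i, p ν i) ^ k) := by
  have ht0 : ∀ ν, 0 < t ν := fun ν => (hr ν).trans_le (ht ν)
  have hθ : ∀ ν, blockSum p ν ∈ Ioo (0 : ℝ) 1 := blockSum_mem hm hp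
  set μ := priorMeasure M γ a₀ a
  set c := (∑ i, p ν i) ^ k * Real.log ((∑ i, p ν i) ^ k) - (∑ i, p ν i) ^ k
  set f : (Fin N → ℕ) → ℝ := fun y => momentRatio μ blockSum t ν k y - blockSum p ν ^ k *
    (Real.log (moment μ blockSum t (y + Pi.single ν k)) - Real.log (moment μ blockSum t y)) with hf
  have hkl : ∀ z, klLoss (posteriorMeanPow (mixedPrior M γ a₀ a) t ν k z) ((∑ i, p ν i) ^ k)
      = f (blockTotal z) + c := fun z => by
    have h1 := h.moment_pos ht (blockTotal z)
    have h2 := h.moment_pos ht (blockTotal z + Pi.single ν k)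
    have h3 : 0 < (∑ i, p ν i) ^ k := pow_pos (hθ ν).1 k
    rw [posteriorMeanPow_eq h hm ht hγ ha ht0, klLoss,
      Real.log_div (h.momentRatio_pos ht ν k _).ne' h3.ne', momentRatio,
      Real.log_div h2.ne' h1.ne']
    simp only [hf, c, momentRatio, blockSum]
    ring
  obtain ⟨C, hC⟩ := h.exists_abs_log_moment_le ht
  have hL := fun y => hC t ht (fun _ => le_rfl) y
  have hs : Summable fun y => nbMass t (blockSum p) y * f y := by
    have hs1 := h.summable_nbMass_mul_momentRatio ht hr hθ ν k
    have hs2 : Summable fun y => nbMass t (blockSum p) y *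
        (Real.log (moment μ blockSum t (y + Pi.single ν k))
          - Real.log (moment μ blockSum t y)) := by
      simp_rw [mul_sub]
      exact (summable_nbMass_mul ht0 hθ fun y => abs_shift_le hL ν k y).sub
        (summable_nbMass_mul ht0 hθ hL)
    exact (hs1.sub (hs2.mul_left (blockSum p ν ^ k))).congr fun y => by simp only [hf]; ring
  have := isProbabilityMeasure_jointLaw hm ht0 hp
  have hi := integrable_comp_blockTotal hm ht0 hp hs
  simp_rw [hkl]
  refine ⟨hi.add (integrable_const c), ?_⟩
  rw [integral_add hi (integrable_const c), integral_comp_blockTotal hm ht0 hp hs]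
  simp [lossTerm, hf]

theorem expectedLossDiff_eq [SFinite M] [SFinite M'] (hγ : Measurable γ) (hγ' : Measurable γ')
    (h : MomentData (priorMeasure M γ a₀ a) blockSum r A δ)
    (h' : MomentData (priorMeasure M' γ' a₀ a) blockSum r A δ)
    (hm : ∀ ν, 1 ≤ m ν) (ha : ∀ ν i, 0 < a ν i) (hr : ∀ ν, 0 < r ν)
    (ht : ∀ ν, r ν ≤ t ν) (hp : p ∈ paramSpace m) (ν : Fin N) (k : ℕ) :
    expectedLossDiff (mixedPrior M γ a₀ a) (mixedPrior M' γ' a₀ a) t p ν k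
      = lossTerm (priorMeasure M γ a₀ a) blockSum t (blockSum p) ν k
        - lossTerm (priorMeasure M' γ' a₀ a) blockSum t (blockSum p) ν k := by
  have h1 := integrable_and_integral_klLoss hγ h hm ha hr ht hp ν k
  have h2 := integrable_and_integral_klLoss hγ' h' hm ha hr ht hp ν k
  rw [expectedLossDiff, integral_sub h1.1 h2.1, h1.2, h2.2]
  ring

end Loss

section Risk

variable {N n : ℕ} {m : Fin N → ℕ} {M M' : Measure (Ioi (0 : ℝ))}
  {γ γ' : Ioi (0 : ℝ) → Fin N → ℝ}
  {a₀ : Fin N → ℝ} {a p : Params m} {r T A : Fin N → ℝ} {s : Fin n → ℝ} {δ : ℝ}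

/-- The block totals of the observed and future counts together. -/
def pooledTotal {hnN : n ≤ N} (z : Counts m × Counts fun j : Fin n => m (Fin.castLE hnN j)) :
    Fin N → ℕ :=
  blockTotal z.1 + extendZero (blockTotal z.2)

section
variable (hm : ∀ ν, 1 ≤ m ν) (hr : ∀ ν, 0 < r ν) (hs : ∀ j, 0 < s j) (hnN : n ≤ N)
  (hT : ∀ j : Fin n, T (Fin.castLE hnN j) = r (Fin.castLE hnN j) + s j)
  (hT' : ∀ ν : Fin N, n ≤ (ν : ℕ) → T ν = r ν) (hp : p ∈ paramSpace m)
include hm hr hs hT hT' hp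

theorem map_pooledTotal_sampleLaw :
    (sampleLaw hnN r s p).map pooledTotal = discreteLaw (nbMass T (blockSum p)) := by
  have := isProbabilityMeasure_jointLaw hm hr hp
  have := isProbabilityMeasure_jointLaw (fun j => hm (Fin.castLE hnN j)) hs (firstParams_mem hnN hp)
  rw [← map_add_extendZero hnN (fun ν => (hr ν).le) (fun j => (hs j).le) (blockSum_mem hm hp) hT hT',
    ← map_blockTotal_jointLaw hr hp]
  have e := map_blockTotal_jointLaw hs (firstParams_mem hnN hp)
  have e' : blockSum (firstParams hnN p) = fun j => blockSum p (Fin.castLE hnN j) := rfl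
  rw [e'] at e
  rw [← e, Measure.map_prod_map _ _ (measurable_of_countable _) (measurable_of_countable _),
    Measure.map_map (measurable_of_countable _) (measurable_of_countable _), sampleLaw]
  rfl

theorem integrable_comp_pooledTotal {F : (Fin N → ℕ) → ℝ} {C : ℝ} (hT0 : ∀ ν, 0 < T ν)
    (hF : ∀ y, |F y| ≤ C * (1 + size y)) :
    Integrable (fun z => F (pooledTotal z)) (sampleLaw hnN r s p) ∧
      ∫ z, F (pooledTotal z) ∂(sampleLaw hnN r s p) = ∑' y, nbMass T (blockSum p) y * F y := by
  have h0 := nbMass_nonneg (fun ν => (hT0 ν).le) (blockSum_mem hm hp)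
  have hF := summable_nbMass_mul hT0 (blockSum_mem hm hp) hF
  have h1 := integrable_discreteLaw h0 hF
  have h2 := integral_discreteLaw h0 hF
  rw [← map_pooledTotal_sampleLaw hm hr hs hnN hT hT' hp] at h1 h2
  rw [integral_map (measurable_of_countable _).aemeasurable
    (measurable_of_countable F).aestronglyMeasurable] at h2
  exact ⟨h1.comp_measurable (measurable_of_countable _), h2⟩

end

theorem size_pooledTotal (hnN : n ≤ N)
    (z : Counts m × Counts fun j : Fin n => m (Fin.castLE hnN j)) :
    size (pooledTotal z) = size (blockTotal z.1) + size (blockTotal z.2) := by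
  rw [pooledTotal, size_add, size_extendZero hnN]

theorem le_of_eq_add (hs : ∀ j, 0 < s j) (hnN : n ≤ N)
    (hT : ∀ j : Fin n, T (Fin.castLE hnN j) = r (Fin.castLE hnN j) + s j)
    (hT' : ∀ ν : Fin N, n ≤ (ν : ℕ) → T ν = r ν) (ν : Fin N) : r ν ≤ T ν := by
  by_cases hν : (ν : ℕ) < n
  · exact (le_add_of_nonneg_right (hs ⟨ν, hν⟩).le).trans (hT ⟨ν, hν⟩).ge
  · exact (hT' ν (not_lt.1 hν)).ge

theorem logRatio_eq [SFinite M] (hγ : Measurable γ)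
    (h : MomentData (priorMeasure M γ a₀ a) blockSum r A δ)
    (hm : ∀ ν, 1 ≤ m ν) (hr : ∀ ν, 0 < r ν) (hs : ∀ j, 0 < s j) (hnN : n ≤ N)
    (hT : ∀ j : Fin n, T (Fin.castLE hnN j) = r (Fin.castLE hnN j) + s j)
    (hT' : ∀ ν : Fin N, n ≤ (ν : ℕ) → T ν = r ν) (hp : p ∈ paramSpace m)
    (z : Counts m × Counts fun j : Fin n => m (Fin.castLE hnN j)) :
    logRatio hnN (mixedPrior M γ a₀ a) r s p z
      = Real.log (likelihood s z.2 (firstParams hnN p))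
        + Real.log (∫ q, likelihood r z.1 q ∂(priorMeasure M γ a₀ a))
        - Real.log (∫ q, likelihood T (z.1 + extendCounts hnN z.2) q ∂(priorMeasure M γ a₀ a)) := by
  have h1 := integral_likelihood_pos h hm (fun _ => le_rfl) z.1
  have h2 := integral_likelihood_pos h hm (le_of_eq_add hs hnN hT hT')
    (z.1 + extendCounts hnN z.2)
  have h3 := likelihood_pos (fun j => hm (Fin.castLE hnN j)) s z.2 (firstParams_mem hnN hp)
  rw [logRatio, predictiveMass_eq h hm hγ hr hs hnN hT hT', jointMass_eq hs,
    mul_div_mul_left _ _ (massCoeff_pos hs _).ne', Real.log_div h3.ne' (div_pos h2 h1).ne',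
    Real.log_div h2.ne' h1.ne']
  ring

theorem integrable_logRatio [SFinite M] (hγ : Measurable γ)
    (h : MomentData (priorMeasure M γ a₀ a) blockSum r A δ)
    (hm : ∀ ν, 1 ≤ m ν) (hr : ∀ ν, 0 < r ν) (hs : ∀ j, 0 < s j) (hnN : n ≤ N)
    (hT : ∀ j : Fin n, T (Fin.castLE hnN j) = r (Fin.castLE hnN j) + s j)
    (hT' : ∀ ν : Fin N, n ≤ (ν : ℕ) → T ν = r ν) (hp : p ∈ paramSpace m) :
    Integrable (logRatio hnN (mixedPrior M γ a₀ a) r s p) (sampleLaw hnN r s p) := by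
  have hrT := le_of_eq_add hs hnN hT hT'
  obtain ⟨C₁, h1⟩ := exists_abs_log_likelihood_le (fun j => hm (Fin.castLE hnN j)) s
    (firstParams_mem hnN hp)
  obtain ⟨C₂, h2⟩ := exists_abs_log_integral_likelihood_le h hm fun _ => le_rfl
  obtain ⟨C₃, h3⟩ := exists_abs_log_integral_likelihood_le h hm hrT
  -- Each of the three logarithms in the log ratio grows at most linearly in the pooled total, so
  -- one affine function of it is an integrable majorant.
  have hi := (integrable_comp_pooledTotal hm hr hs hnN hT hT' hp
    (F := fun y => (|C₁| + |C₂| + |C₃|) * (1 + size y)) (C := |C₁| + |C₂| + |C₃|)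
    (fun ν => (hr ν).trans_le (hrT ν)) fun y => by
      have := size_nonneg y
      rw [abs_of_nonneg (by positivity)]).1
  refine hi.mono' (measurable_of_countable _).aestronglyMeasurable
    (Eventually.of_forall fun z => ?_)
  rw [logRatio_eq hγ h hm hr hs hnN hT hT' hp, Real.norm_eq_abs, size_pooledTotal hnN]
  have e : size (blockTotal (z.1 + extendCounts hnN z.2))
      = size (blockTotal z.1) + size (blockTotal z.2) := by
    rw [← size_pooledTotal hnN, pooledTotal, blockTotal_add, blockTotal_extendCounts]
  have hz := size_nonneg (blockTotal z.1)
  have hw := size_nonneg (blockTotal z.2)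
  have k1 := h1 z.2
  have k2 := h2 z.1
  have k3 := h3 (z.1 + extendCounts hnN z.2)
  rw [e] at k3
  have l1 : C₁ * (1 + size (blockTotal z.2))
      ≤ |C₁| * (1 + (size (blockTotal z.1) + size (blockTotal z.2))) :=
    mul_le_mul (le_abs_self _) (by linarith) (by linarith) (abs_nonneg _)
  have l2 : C₂ * (1 + size (blockTotal z.1))
      ≤ |C₂| * (1 + (size (blockTotal z.1) + size (blockTotal z.2))) :=
    mul_le_mul (le_abs_self _) (by linarith) (by linarith) (abs_nonneg _)
  have l3 : C₃ * (1 + (size (blockTotal z.1) + size (blockTotal z.2)))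
      ≤ |C₃| * (1 + (size (blockTotal z.1) + size (blockTotal z.2))) :=
    mul_le_mul_of_nonneg_right (le_abs_self _) (by linarith)
  refine (abs_sub _ _).trans ((add_le_add_left (abs_add_le _ _) _).trans ?_)
  linarith

theorem log_integral_likelihood_sub [SFinite M] [SFinite M'] (hγ : Measurable γ)
    (hγ' : Measurable γ')
    (h : MomentData (priorMeasure M γ a₀ a) blockSum r A δ)
    (h' : MomentData (priorMeasure M' γ' a₀ a) blockSum r A δ)
    (hm : ∀ ν, 1 ≤ m ν) (ha : ∀ ν i, 0 < a ν i) (ν : Fin N) (hrT : ∀ ν, r ν ≤ T ν)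
    (z : Counts m) :
    Real.log (∫ q, likelihood T z q ∂(priorMeasure M γ a₀ a))
        - Real.log (∫ q, likelihood T z q ∂(priorMeasure M' γ' a₀ a))
      = Real.log (moment (priorMeasure M γ a₀ a) blockSum T (blockTotal z))
        - Real.log (moment (priorMeasure M' γ' a₀ a) blockSum T (blockTotal z)) := by
  obtain ⟨K, hK, hKm⟩ := exists_integral_likelihood_mul_pow hm ha z
  -- The power k = 0 yields the plain integrated likelihood, whichever block ν is chosen.
  have h1 := hKm M γ hγ a₀ T ν 0
  have h2 := hKm M' γ' hγ' a₀ T ν 0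
  simp only [pow_zero, mul_one, Pi.single_zero, add_zero] at h1 h2
  rw [h1, h2, Real.log_mul hK.ne' (h.moment_pos hrT _).ne',
    Real.log_mul hK.ne' (h'.moment_pos hrT _).ne', add_sub_add_left_eq_sub]

/-- The risk difference of two Bayesian predictive masses in terms of expected log moments. -/
theorem risk_sub_risk [SFinite M] [SFinite M'] (hγ : Measurable γ) (hγ' : Measurable γ')
    (h : MomentData (priorMeasure M γ a₀ a) blockSum r A δ)
    (h' : MomentData (priorMeasure M' γ' a₀ a) blockSum r A δ)
    (hm : ∀ ν, 1 ≤ m ν) (ha : ∀ ν i, 0 < a ν i) (hr : ∀ ν, 0 < r ν) (hs : ∀ j, 0 < s j)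
    (hN : 0 < N) (hnN : n ≤ N)
    (hT : ∀ j : Fin n, T (Fin.castLE hnN j) = r (Fin.castLE hnN j) + s j)
    (hT' : ∀ ν : Fin N, n ≤ (ν : ℕ) → T ν = r ν) (hp : p ∈ paramSpace m) :
    risk hnN (mixedPrior M γ a₀ a) r s p - risk hnN (mixedPrior M' γ' a₀ a) r s p
      = (expLogMoment (priorMeasure M γ a₀ a) blockSum r (blockSum p)
          - expLogMoment (priorMeasure M γ a₀ a) blockSum T (blockSum p))
        - (expLogMoment (priorMeasure M' γ' a₀ a) blockSum r (blockSum p)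
          - expLogMoment (priorMeasure M' γ' a₀ a) blockSum T (blockSum p)) := by
  have hrT := le_of_eq_add hs hnN hT hT'
  have hT0 : ∀ ν, 0 < T ν := fun ν => (hr ν).trans_le (hrT ν)
  have hθ := blockSum_mem hm hp
  have := isProbabilityMeasure_jointLaw hm hr hp
  have := isProbabilityMeasure_jointLaw (fun j => hm (Fin.castLE hnN j)) hs (firstParams_mem hnN hp)
  obtain ⟨C, hC⟩ := h.exists_abs_log_moment_le hrT
  obtain ⟨C', hC'⟩ := h'.exists_abs_log_moment_le hrT
  set F : (Fin N → ℝ) → (Fin N → ℕ) → ℝ := fun t y =>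
    Real.log (moment (priorMeasure M γ a₀ a) blockSum t y)
      - Real.log (moment (priorMeasure M' γ' a₀ a) blockSum t y) with hF
  have hFb : ∀ t, (∀ ν, r ν ≤ t ν) → (∀ ν, t ν ≤ T ν) → ∀ y,
      |F t y| ≤ (C + C') * (1 + size y) := fun t h1 h2 y =>
    (abs_sub _ _).trans ((add_le_add (hC t h1 h2 y) (hC' t h1 h2 y)).trans_eq (by ring))
  have hsum : ∀ t, (∀ ν, r ν ≤ t ν) → (∀ ν, t ν ≤ T ν) →
      ∑' y, nbMass t (blockSum p) y * F t y
        = expLogMoment (priorMeasure M γ a₀ a) blockSum t (blockSum p)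
          - expLogMoment (priorMeasure M' γ' a₀ a) blockSum t (blockSum p) := fun t h1 h2 => by
    have ht0 : ∀ ν, 0 < t ν := fun ν => (hr ν).trans_le (h1 ν)
    rw [expLogMoment, expLogMoment, ← (summable_nbMass_mul ht0 hθ (hC t h1 h2)).tsum_sub
      (summable_nbMass_mul ht0 hθ (hC' t h1 h2))]
    exact tsum_congr fun y => mul_sub _ _ _
  -- The true likelihood cancels between the two priors, and so do the direction constants of z.1
  -- and of the pooled counts; only log moments remain.
  have hd : ∀ z, logRatio hnN (mixedPrior M γ a₀ a) r s p z
      - logRatio hnN (mixedPrior M' γ' a₀ a) r s p z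
      = F r (blockTotal z.1) - F T (pooledTotal z) := fun z => by
    have e1 := log_integral_likelihood_sub hγ hγ' h h' hm ha ⟨0, hN⟩ (fun _ => le_rfl) z.1
    have e2 := log_integral_likelihood_sub hγ hγ' h h' hm ha ⟨0, hN⟩ hrT
      (z.1 + extendCounts hnN z.2)
    rw [blockTotal_add, blockTotal_extendCounts] at e2
    rw [logRatio_eq hγ h hm hr hs hnN hT hT' hp, logRatio_eq hγ' h' hm hr hs hnN hT hT' hp]
    simp only [hF, pooledTotal]
    linarith
  have hs1 := summable_nbMass_mul hr hθ (hFb r (fun _ => le_rfl) hrT)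
  have hi1 : Integrable (fun z : Counts m × Counts fun j : Fin n => m (Fin.castLE hnN j) =>
      F r (blockTotal z.1)) (sampleLaw hnN r s p) :=
    (integrable_comp_blockTotal hm hr hp hs1).comp_fst _
  have hv1 : ∫ z, F r (blockTotal z.1) ∂(sampleLaw hnN r s p)
      = ∑' y, nbMass r (blockSum p) y * F r y := by
    rw [sampleLaw, integral_fun_fst (fun x => F r (blockTotal x)), probReal_univ, one_smul,
      integral_comp_blockTotal hm hr hp hs1]
  obtain ⟨hi2, hv2⟩ := integrable_comp_pooledTotal hm hr hs hnN hT hT' hp hT0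
    (hFb T hrT fun _ => le_rfl)
  rw [risk, risk, ← integral_sub (integrable_logRatio hγ h hm hr hs hnN hT hT' hp)
    (integrable_logRatio hγ' h' hm hr hs hnN hT hT' hp)]
  simp_rw [hd]
  rw [integral_sub hi1 hi2, hv1, hv2, hsum r (fun _ => le_rfl) hrT, hsum T hrT fun _ => le_rfl]
  ring

/-- The risk difference of two Bayesian predictive masses as an integral of expected losses. -/
theorem risk_sub_risk_eq_integral [SFinite M] [SFinite M'] (hγ : Measurable γ)
    (hγ' : Measurable γ')
    (h : MomentData (priorMeasure M γ a₀ a) blockSum r A δ)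
    (h' : MomentData (priorMeasure M' γ' a₀ a) blockSum r A δ)
    (hm : ∀ ν, 1 ≤ m ν) (ha : ∀ ν i, 0 < a ν i) (hr : ∀ ν, 0 < r ν) (hs : ∀ j, 0 < s j)
    (hN : 0 < N) (hnN : n ≤ N) (hp : p ∈ paramSpace m)
    {t : Fin N → ℝ → ℝ} (ht : ∀ ν, ContDiffOn ℝ (⊤ : ℕ∞) (t ν) (Icc 0 1))
    (htmono : ∀ ν, MonotoneOn (t ν) (Icc 0 1)) (ht0 : ∀ ν, t ν 0 = r ν)
    (ht1 : ∀ ν : Fin n, t (Fin.castLE hnN ν) 1 = r (Fin.castLE hnN ν) + s ν)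
    (ht1' : ∀ ν : Fin N, n ≤ (ν : ℕ) → t ν 1 = r ν) :
    (∀ τ ∈ Icc (0 : ℝ) 1, ∀ ν : Fin N, Summable fun k : ℕ => 1 / ((k : ℝ) + 1) *
      expectedLossDiff (mixedPrior M γ a₀ a) (mixedPrior M' γ' a₀ a) (fun j => t j τ) p ν
        (k + 1)) ∧
    IntervalIntegrable (fun τ => ∑ ν : Fin n,
        derivWithin (t (Fin.castLE hnN ν)) (Icc 0 1) τ * ∑' k : ℕ, 1 / ((k : ℝ) + 1) *
          expectedLossDiff (mixedPrior M γ a₀ a) (mixedPrior M' γ' a₀ a) (fun j => t j τ) p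
            (Fin.castLE hnN ν) (k + 1)) volume 0 1 ∧
    risk hnN (mixedPrior M γ a₀ a) r s p - risk hnN (mixedPrior M' γ' a₀ a) r s p
      = ∫ τ in (0 : ℝ)..1, ∑ ν : Fin n,
        derivWithin (t (Fin.castLE hnN ν)) (Icc 0 1) τ * ∑' k : ℕ, 1 / ((k : ℝ) + 1) *
          expectedLossDiff (mixedPrior M γ a₀ a) (mixedPrior M' γ' a₀ a) (fun j => t j τ) p
            (Fin.castLE hnN ν) (k + 1) := by
  have hθ := blockSum_mem hm hp
  have hrT := le_of_eq_add hs hnN (T := fun ν => t ν 1) ht1 ht1'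
  obtain ⟨B, hB⟩ := exists_sizePath ht htmono
  have e0 : (fun ν => t ν 0) = r := funext ht0
  rw [e0] at hB
  have hS : ∀ τ ∈ Icc (0 : ℝ) 1, ∀ ν, HasSum (fun k : ℕ => 1 / ((k : ℝ) + 1) *
      expectedLossDiff (mixedPrior M γ a₀ a) (mixedPrior M' γ' a₀ a) (fun j => t j τ) p ν (k + 1))
      (∑' k : ℕ, 1 / ((k : ℝ) + 1) * lossTerm (priorMeasure M γ a₀ a) blockSum
          (fun j => t j τ) (blockSum p) ν (k + 1)
        - ∑' k : ℕ, 1 / ((k : ℝ) + 1) * lossTerm (priorMeasure M' γ' a₀ a) blockSum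
          (fun j => t j τ) (blockSum p) ν (k + 1)) := fun τ hτ ν => by
    have h1 := (h.hasSum_lossTerm (hB.ge τ hτ) hr hθ ν).summable.hasSum
    have h2 := (h'.hasSum_lossTerm (hB.ge τ hτ) hr hθ ν).summable.hasSum
    refine (h1.sub h2).congr_fun fun k => ?_
    rw [expectedLossDiff_eq hγ hγ' h h' hm ha hr (hB.ge τ hτ) hp, mul_sub]
  have hI := h.integral_lossTerm hB hr hrT hθ
  have hI' := h'.integral_lossTerm hB hr hrT hθ
  have hE : ∀ τ ∈ Icc (0 : ℝ) 1, (∑ ν, derivWithin (t ν) (Icc 0 1) τ *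
        ∑' k : ℕ, 1 / ((k : ℝ) + 1) * lossTerm (priorMeasure M γ a₀ a) blockSum
          (fun j => t j τ) (blockSum p) ν (k + 1))
      - (∑ ν, derivWithin (t ν) (Icc 0 1) τ *
        ∑' k : ℕ, 1 / ((k : ℝ) + 1) * lossTerm (priorMeasure M' γ' a₀ a) blockSum
          (fun j => t j τ) (blockSum p) ν (k + 1))
      = ∑ ν : Fin n, derivWithin (t (Fin.castLE hnN ν)) (Icc 0 1) τ *
        ∑' k : ℕ, 1 / ((k : ℝ) + 1) *
          expectedLossDiff (mixedPrior M γ a₀ a) (mixedPrior M' γ' a₀ a) (fun j => t j τ) p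
            (Fin.castLE hnN ν) (k + 1) := fun τ hτ => by
    rw [← Finset.sum_sub_distrib, ← sum_dite_lt hnN]
    refine Finset.sum_congr rfl fun ν _ => ?_
    rw [← mul_sub, ← (hS τ hτ ν).tsum_eq]
    split_ifs with hν
    · rfl
    -- For ν ≥ n, in zero-based indexing, the two end values of t_ν agree and the term vanishes.
    · rw [derivWithin_eq_zero_of_monotoneOn (htmono ν)
        ((ht1' ν (not_lt.1 hν)).trans (ht0 ν).symm) hτ, zero_mul]
  refine ⟨fun τ hτ ν => (hS τ hτ ν).summable, ?_, ?_⟩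
  · refine (hI.1.sub hI'.1).congr fun τ hτ => ?_
    rw [uIoc_of_le zero_le_one] at hτ
    exact hE τ (Ioc_subset_Icc_self hτ)
  · rw [risk_sub_risk hγ hγ' h h' hm ha hr hs hN hnN ht1 ht1' hp]
    have e1 := hI.2
    have e2 := hI'.2
    rw [e0] at e1 e2
    rw [← e1, ← e2, ← intervalIntegral.integral_sub hI.1 hI'.1]
    refine intervalIntegral.integral_congr fun τ hτ => ?_
    rw [uIcc_of_le zero_le_one] at hτ
    exact hE τ hτ

end Risk

end

end NegMult

end

/-! ### The risk identity -/

theorem mainTheorem8 {N n : ℕ} (hn : 1 ≤ n) (hnN : n ≤ N) (m : Fin N → ℕ) (hm : ∀ ν, 1 ≤ m ν)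
    (r : Fin N → ℝ) (hr : ∀ ν, 0 < r ν) (s : Fin n → ℝ) (hs : ∀ ν, 0 < s ν)
    (p : NegMult.Params m) (hp : p ∈ NegMult.paramSpace m)
    (a₀ : Fin N → ℝ) (a : NegMult.Params m) (ha : ∀ ν i, 0 < a ν i)
    (hra : ∀ ν, 0 < r ν + a₀ ν)
    (M : Measure (Ioi (0 : ℝ))) (γ : Ioi (0 : ℝ) → Fin N → ℝ) (hγ : Measurable γ)
    (hγpos : ∀ u ν, 0 < γ u ν)
    (hM : NegMult.ProperPosterior (NegMult.mixedPrior M γ a₀ a) r)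
    (t : Fin N → ℝ → ℝ) (ht : ∀ ν, ContDiffOn ℝ (⊤ : ℕ∞) (t ν) (Icc 0 1))
    (htmono : ∀ ν, MonotoneOn (t ν) (Icc 0 1))
    (ht0 : ∀ ν, t ν 0 = r ν)
    (ht1 : ∀ ν : Fin n, t (Fin.castLE hnN ν) 1 = r (Fin.castLE hnN ν) + s ν)
    (ht1' : ∀ ν : Fin N, n ≤ (ν : ℕ) → t ν 1 = r ν) :
    -- both risks are finite
    Integrable (NegMult.logRatio hnN (NegMult.mixedPrior M γ a₀ a) r s p)
      (NegMult.sampleLaw hnN r s p) ∧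
    Integrable (NegMult.logRatio hnN (NegMult.dirichletPrior a₀ a) r s p)
      (NegMult.sampleLaw hnN r s p) ∧
    -- the expected losses are finite, and the series over `k` converge
    (∀ τ ∈ Icc (0 : ℝ) 1, ∀ ν : Fin n,
      (∀ k : ℕ, 1 ≤ k →
        Integrable (fun z => NegMult.klLoss
            (NegMult.posteriorMeanPow (NegMult.mixedPrior M γ a₀ a) (fun j => t j τ)
              (Fin.castLE hnN ν) k z)
            ((∑ i, p (Fin.castLE hnN ν) i) ^ k))
          (NegMult.jointLaw (fun j => t j τ) p) ∧
        Integrable (fun z => NegMult.klLoss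
            (NegMult.posteriorMeanPow (NegMult.dirichletPrior a₀ a) (fun j => t j τ)
              (Fin.castLE hnN ν) k z)
            ((∑ i, p (Fin.castLE hnN ν) i) ^ k))
          (NegMult.jointLaw (fun j => t j τ) p)) ∧
      Summable (fun k : ℕ => 1 / ((k : ℝ) + 1) *
        NegMult.expectedLossDiff (NegMult.mixedPrior M γ a₀ a) (NegMult.dirichletPrior a₀ a)
          (fun j => t j τ) p (Fin.castLE hnN ν) (k + 1))) ∧
    -- the integral over `τ` converges
    IntervalIntegrable (fun τ => ∑ ν : Fin n,
        derivWithin (t (Fin.castLE hnN ν)) (Icc 0 1) τ *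
          ∑' k : ℕ, 1 / ((k : ℝ) + 1) *
            NegMult.expectedLossDiff (NegMult.mixedPrior M γ a₀ a) (NegMult.dirichletPrior a₀ a)
              (fun j => t j τ) p (Fin.castLE hnN ν) (k + 1))
      volume 0 1 ∧
    -- the identity for the risk difference
    NegMult.risk hnN (NegMult.mixedPrior M γ a₀ a) r s p
        - NegMult.risk hnN (NegMult.dirichletPrior a₀ a) r s p
      = ∫ τ in (0 : ℝ)..1, ∑ ν : Fin n,
          derivWithin (t (Fin.castLE hnN ν)) (Icc 0 1) τ *
            ∑' k : ℕ, 1 / ((k : ℝ) + 1) *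
              NegMult.expectedLossDiff (NegMult.mixedPrior M γ a₀ a) (NegMult.dirichletPrior a₀ a)
                (fun j => t j τ) p (Fin.castLE hnN ν) (k + 1) := by
  have hN : 0 < N := by omega
  have hne : Nonempty (Fin N) := ⟨⟨0, hN⟩⟩
  -- The minimum of r_ν + a_{0,ν} over the blocks serves as δ for both priors, since γ ≥ 0 can only
  -- increase the exponent.
  obtain ⟨ν₀, hν₀⟩ := Finite.exists_min fun ν => r ν + a₀ ν
  have hsf := NegMult.sFinite_of_properPosterior hγ hM hm hr
  have h1 := NegMult.momentData_priorMeasure hγ (fun u ν => (hγpos u ν).le) hm ha (hra ν₀) hν₀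
    (NegMult.lintegral_kern_of_properPosterior hγ hM hr)
  have hγ0 : Measurable fun (_ : Ioi (0 : ℝ)) (_ : Fin N) => (0 : ℝ) := measurable_const
  have h2 := NegMult.momentData_priorMeasure hγ0 (fun _ _ => le_rfl) hm ha (hra ν₀) hν₀
    (NegMult.lintegral_kern_dirac hm ha r hra)
  rw [NegMult.dirichletPrior_eq_mixedPrior]
  obtain ⟨hS, hI, hR⟩ := NegMult.risk_sub_risk_eq_integral hγ hγ0 h1 h2 hm ha hr hs hN hnN hp ht
    htmono ht0 ht1 ht1'
  have hrt : ∀ τ ∈ Icc (0 : ℝ) 1, ∀ ν, r ν ≤ t ν τ := fun τ hτ ν =>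
    (ht0 ν).ge.trans (htmono ν (left_mem_Icc.2 zero_le_one) hτ hτ.1)
  exact ⟨NegMult.integrable_logRatio hγ h1 hm hr hs hnN (T := fun ν => t ν 1) ht1 ht1' hp,
    NegMult.integrable_logRatio hγ0 h2 hm hr hs hnN (T := fun ν => t ν 1) ht1 ht1' hp,
    fun τ hτ ν => ⟨fun k _ =>
      ⟨(NegMult.integrable_and_integral_klLoss hγ h1 hm ha hr (hrt τ hτ) hp _ k).1,
        (NegMult.integrable_and_integral_klLoss hγ0 h2 hm ha hr (hrt τ hτ) hp _ k).1⟩,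
      hS τ hτ _⟩, hI, hR⟩
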